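/- **Proposition 1.4 (Asymptotic solutions).** Let $\mathbb T=\mathbb R/\mathbb Z$ and $\Omega=\mathbb T\times[0,1]$, with points $(x,y)$. Let $\mathcal H$ be the space of real vector fields $\mathbf u=(u,v)\in L^2(\Omega)^2$ with $u_x+v_y=0$ and $v|_{y=0}=v|_{y=1}=0$ (both in the weak sense, that is, $\int_\Omega \mathbf u\cdot\nabla\psi\,dx\,dy=0$ for every $\psi\in C^\infty(\mathbb T\times[0,1])$), with the $L^2$ norm, and let $\mathcal V=\mathcal H\cap (H^1(\Omega))^2$. Consider the Navier–Stokes equations with horizontal viscosity only and without force, $$\mathbf u_t-\mathbf u_{xx}+(\mathbf u\cdot\nabla)\mathbf u+\nabla p=0,\qquad \nabla\cdot\mathbf u=0,\qquad v|_{y=0}=v|_{y=1}=0 .\tag{1}$$ A *global weak solution* of (1) with initial value $\mathbf u_0=(u_0,v_0)$ is a function $\mathbf u=(u,v)$ with $\mathbf u(0)=\mathbf u_0$ such that, for every $T>0$, $\mathbf u\in C([0,T];\mathcal H)$, $u_y\in L^\infty(0,T;L^2(\Omega))$ and $u_x,v_x,u_{xy}\in L^2(0,T;L^2(\Omega))$,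 and such that for every $\mathbf w\in\mathcal V$ $$\frac{d}{dt}(\mathbf u,\mathbf w)_{L^2}+(\mathbf u_x,\mathbf w_x)_{L^2}+\int_\Omega[(\mathbf u\cdot\nabla)\mathbf u]\cdot\mathbf w\,dx\,dy=0,\qquad t>0,$$ in the sense that the equation integrated over $[0,t]$ holds for all $t\ge0$. A *steady-state solution* is a vector field which, taken constant in time, is a global weak solution. For a function $g$ on $\Omega$ write $\bar g(y)=\int_0^1 g(x,y)\,dx$ and $\tilde g(x,y)=g(x,y)-\bar g(y)$. Let $\mathbf u_0\in\mathcal H\cap(H^1(\Omega))^2$ and let $\mathbf u=(u,v)$ be the global weak solution of (1) with initial value $\mathbf u_0$. Then $$\lim_{t\to\infty}(\tilde u(t),v(t))=(0,0)\ \text{ in }\mathcal H,$$ and there is $\phi\in L^2(0,1)$ such that $$\lim_{t\to\infty}\bar u(t)=\phi\ \text{ in }L^2(0,1)$$ and $(\phi(y),0)$ is a steady-state solution of (1). -/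

import Mathlib

open MeasureTheory Set Filter Topology

noncomputable section

/-- Lebesgue measure on one period `Ω = 𝕋 × [0,1]` of the channel, where the circle `𝕋` is
identified with the fundamental domain `(0,1]`. -/
def volOmega : Measure (ℝ × ℝ) :=
  (volume.restrict (Ioc (0 : ℝ) 1)).prod (volume.restrict (Ioo (0 : ℝ) 1))

/-- Lebesgue measure on the vertical interval `(0,1)`. -/
def volI : Measure ℝ := volume.restrict (Ioo (0 : ℝ) 1)

/-- The real space `L²(Ω)`. -/
abbrev L2Omega : Type := Lp ℝ 2 volOmega

/-- The real space `L²(0,1)`. -/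
abbrev L2I : Type := Lp ℝ 2 volI

lemma measurePreserving_snd_volOmega : MeasurePreserving Prod.snd volOmega volI := by
  have : IsProbabilityMeasure (volume.restrict (Ioc (0 : ℝ) 1)) := ⟨by simp⟩
  unfold volOmega volI
  exact measurePreserving_snd

/-- A function `φ ∈ L²(0,1)` of the variable `y`, seen as the element `(x,y) ↦ φ y` of `L²(Ω)`. -/
def liftY (φ : L2I) : L2Omega :=
  Lp.compMeasurePreserving Prod.snd measurePreserving_snd_volOmega φ

/-- Classical partial derivatives of a function on the plane (used on smooth functions only). -/
def partialX (ψ : ℝ × ℝ → ℝ) (z : ℝ × ℝ) : ℝ := fderiv ℝ ψ z (1, 0)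

/-- See `partialX`. -/
def partialY (ψ : ℝ × ℝ → ℝ) (z : ℝ × ℝ) : ℝ := fderiv ℝ ψ z (0, 1)

/-- Smooth functions on the plane, 1-periodic in `x`; they restrict to smooth functions on the
closed cylinder `𝕋 × [0,1]`. -/
def IsSmoothPeriodic (ψ : ℝ × ℝ → ℝ) : Prop :=
  ContDiff ℝ ((⊤ : ℕ∞) : WithTop ℕ∞) ψ ∧ ∀ x y : ℝ, ψ (x + 1, y) = ψ (x, y)

/-- Smooth functions with compact support in the open cylinder `𝕋 × (0,1)`. -/
def IsTestFunction (ψ : ℝ × ℝ → ℝ) : Prop :=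
  IsSmoothPeriodic ψ ∧
    ∃ a b : ℝ, 0 < a ∧ b < 1 ∧ ∀ z : ℝ × ℝ, ψ z ≠ 0 → z.2 ∈ Icc a b

/-- `g = ∂ₓ f` in the sense of distributions on `𝕋 × (0,1)`. -/
def HasWeakDerivX (f g : L2Omega) : Prop :=
  ∀ ψ : ℝ × ℝ → ℝ, IsTestFunction ψ →
    ∫ z, f z * partialX ψ z ∂volOmega = -∫ z, g z * ψ z ∂volOmega

/-- `g = ∂_y f` in the sense of distributions on `𝕋 × (0,1)`. -/
def HasWeakDerivY (f g : L2Omega) : Prop :=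
  ∀ ψ : ℝ × ℝ → ℝ, IsTestFunction ψ →
    ∫ z, f z * partialY ψ z ∂volOmega = -∫ z, g z * ψ z ∂volOmega

/-- The space `𝓗` of real square-integrable vector fields `(u,v)` on `Ω` with `u_x + v_y = 0` and
`v = 0` at `y = 0` and at `y = 1`. Both conditions are expressed, as usual for fields that are only
square integrable, by orthogonality to the gradients of all functions that are smooth up to the
boundary. -/
def MemH (u v : ℝ × ℝ → ℝ) : Prop :=
  MemLp u 2 volOmega ∧ MemLp v 2 volOmega ∧
    ∀ ψ : ℝ × ℝ → ℝ, IsSmoothPeriodic ψ →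
      ∫ z, (u z * partialX ψ z + v z * partialY ψ z) ∂volOmega = 0

/-- Membership in `H¹(Ω)`. -/
def MemH1 (f : L2Omega) : Prop :=
  (∃ g : L2Omega, HasWeakDerivX f g) ∧ ∃ g : L2Omega, HasWeakDerivY f g

/-- The space `𝓥 = 𝓗 ∩ (H¹(Ω))²`. -/
def MemV (u v : L2Omega) : Prop :=
  MemH u v ∧ MemH1 u ∧ MemH1 v

/-- `(u,v)` is a global weak solution, with initial value `(u₀,v₀)`, of the unforced system
`𝐮_t - 𝐮_xx + (𝐮·∇)𝐮 + ∇p = 0`, `∇·𝐮 = 0`, `v = 0` at `y = 0, 1`, where `𝐮 = (u,v)`.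
Only times `t ≥ 0` matter. -/
def IsGlobalWeakSolution (u v : ℝ → L2Omega) (u₀ v₀ : L2Omega) : Prop :=
  -- `𝐮 ∈ C([0,T]; 𝓗)` for all `T`, and `𝐮(0) = 𝐮₀`
  ContinuousOn u (Ici 0) ∧ ContinuousOn v (Ici 0) ∧
  (∀ t : ℝ, 0 ≤ t → MemH (u t) (v t)) ∧
  u 0 = u₀ ∧ v 0 = v₀ ∧
  ∃ ux uy vx vy uxy : ℝ → L2Omega,
    (∀ᵐ t ∂(volume.restrict (Ioi (0 : ℝ))),
      HasWeakDerivX (u t) (ux t) ∧ HasWeakDerivY (u t) (uy t) ∧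
      HasWeakDerivX (v t) (vx t) ∧ HasWeakDerivY (v t) (vy t) ∧
      HasWeakDerivY (ux t) (uxy t)) ∧
    -- `u_y ∈ L^∞(0,T; L²(Ω))` and `u_x, v_x, u_xy ∈ L²(0,T; L²(Ω))`
    (∀ T : ℝ, 0 < T →
      MemLp uy ⊤ (volume.restrict (Ioo 0 T)) ∧
      MemLp ux 2 (volume.restrict (Ioo 0 T)) ∧
      MemLp vx 2 (volume.restrict (Ioo 0 T)) ∧
      MemLp uxy 2 (volume.restrict (Ioo 0 T))) ∧
    -- `d/dt (𝐮,𝐰) + (𝐮_x,𝐰_x) + ∫ [(𝐮·∇)𝐮]·𝐰 = 0` for all `𝐰 ∈ 𝓥`, integrated over `[0,t]`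
    ∀ w₁ w₂ : L2Omega, MemV w₁ w₂ →
      ∀ w₁x w₂x : L2Omega, HasWeakDerivX w₁ w₁x → HasWeakDerivX w₂ w₂x →
        ∀ t : ℝ, 0 ≤ t →
          (∫ z, (u t z * w₁ z + v t z * w₂ z) ∂volOmega)
            + (∫ s in (0 : ℝ)..t,
                ((∫ z, (ux s z * w₁x z + vx s z * w₂x z) ∂volOmega)
                + ∫ z, ((u s z * ux s z + v s z * uy s z) * w₁ z
                    + (u s z * vx s z + v s z * vy s z) * w₂ z) ∂volOmega))
          = ∫ z, (u₀ z * w₁ z + v₀ z * w₂ z) ∂volOmega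

/-- A steady state: a velocity field that, kept constant in time, is a global weak solution. -/
def IsSteadyState (U V : L2Omega) : Prop :=
  IsGlobalWeakSolution (fun _ => U) (fun _ => V) U V

/-- The horizontal mean `ḡ(y) = ∫₀¹ g(x,y) dx`. -/
def hmean (g : ℝ × ℝ → ℝ) (y : ℝ) : ℝ := ∫ x in (0 : ℝ)..1, g (x, y)

/-- The oscillating part `g̃(x,y) = g(x,y) - ḡ(y)`. -/
def osc (g : ℝ × ℝ → ℝ) (z : ℝ × ℝ) : ℝ := g z - hmean g z.2

end

/-!
The walls are removed by reflection. The tangential velocity `u` is extended evenly and the normal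
velocity `v` oddly across `y = 0`, which makes a solution on the channel a solution on the torus
`ℝ/ℤ × ℝ/2ℤ` (`IsGlobalWeakSolution.exists_torusSolution`); the condition `v = 0` at the walls is
what keeps the odd extension differentiable, and `u_xy` is odd across the walls like `u_y`. On the
torus derivatives are derivatives of translation orbits (`HasOrbitDeriv`), and translates of
solutions, also vertical ones, are solutions. All a priori estimates are therefore estimates of
differences of solutions, in the form of the energy identity `IsTorusSolution.energy_sub`. That
identity follows from the weak formulation, without forming time derivatives, by the continuity of
translations of `L²` functions of time (`energy_identity`).

Viscosity acts in `x` only. The nonlinearity is controlled by the anisotropic product estimate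
`lintegral_sq_mul_sq_le`: `f h` is square integrable as soon as `f` has a `y`-derivative and `h` an
`x`-derivative, and incompressibility provides the `y`-derivative of `v` as `-u_x`.

Three balances carry the proof.

* The energy `‖u‖² + ‖v‖²` decreases, and `‖u_x‖² + ‖v_x‖²` is integrable over all times
  (`IsTorusSolution.energy_eq`).
* The gradient energy `2 ‖u_x‖² + ‖u_y‖² + ‖v_x‖²` decreases, and `‖u_xy‖²` is integrable over all
  times (`IsTorusSolution.gradEnergy_add_le`). This is the planar fact that vortex stretching is
  absent: the cubic terms of the horizontal and the vertical difference quotients cancel in the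
  limit. To pass to that limit, `u_xx` must be known to be square integrable in time, and this comes
  from Gronwall's inequality for the horizontal quotients
  (`IsTorusSolution.exists_horizontal_regularity`).
* The horizontal mean of `v` vanishes, so the mean of `u` does not transport itself, and it is not
  subject to viscosity. Testing with its own increment bounds the increment over `[s, t]` by the
  integral of `2 (‖u_x‖² + ‖v_x‖²) + ‖u_xy‖²` (`IsTorusSolution.norm_meanX_sub_le`).

The integrand of the last bound is integrable over all times, so the mean of `u` converges. Then
`‖u - ū‖² + ‖v‖²`, being the energy minus the squared norm of the mean, converges as well; by the
Poincaré inequality in `x` it is integrable in time, so its limit is zero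
(`IsTorusSolution.tendsto_oscillation`). Finally, `u_y` stays bounded, so the limit profile has a
weak derivative by weak compactness (`exists_hasWeakDerivY_of_tendsto`), and every shear flow with a
weak derivative is a steady state (`isSteadyState_liftY`).
-/

noncomputable section

/-! ### Compactness, Gronwall and convergence criteria -/

/-- Bounded families in a Hilbert space cluster weakly. An ultrafilter replaces a subsequence, so no
separability is needed. -/
theorem exists_weak_cluster {H ι : Type*} [NormedAddCommGroup H] [InnerProductSpace ℝ H]
    [CompleteSpace H] (l : Filter ι) [NeBot l] (f : ι → H) (C : ℝ) (hf : ∀ᶠ i in l, ‖f i‖ ≤ C) :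
    ∃ 𝒰 : Ultrafilter ι, (𝒰 : Filter ι) ≤ l ∧ ∃ g : H, ‖g‖ ≤ C ∧
      ∀ φ : H, Tendsto (fun i => inner ℝ (f i) φ) 𝒰 (𝓝 (inner ℝ g φ)) := by
  refine ⟨Ultrafilter.of l, Ultrafilter.of_le l, ?_⟩
  set 𝒰 := Ultrafilter.of l
  let F : ι → WeakDual ℝ H := fun i => StrongDual.toWeakDual (InnerProductSpace.toDual ℝ H (f i))
  have hK := WeakDual.isCompact_closedBall (𝕜 := ℝ) (E := H) 0 C
  obtain ⟨x, hx, hlim⟩ := hK.ultrafilter_le_nhds (𝒰.map F) (by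
    rw [le_principal_iff]
    change ∀ᶠ i in (𝒰 : Filter ι), _
    filter_upwards [(Ultrafilter.of_le l) hf] with i hi
    simpa [F] using hi)
  refine ⟨(InnerProductSpace.toDual ℝ H).symm (WeakDual.toStrongDual x), ?_, fun φ => ?_⟩
  · simpa using hx
  · have h1 : Tendsto F 𝒰 (𝓝 x) := hlim
    -- evaluation at `φ` is continuous for the weak-* topology, by definition
    have h2 := (WeakDual.eval_continuous φ).continuousAt.tendsto.comp h1
    rw [InnerProductSpace.toDual_symm_apply]
    exact h2

/-- Gronwall inequality in integrated form with a merely integrable coefficient, with a cruder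
constant than the exponential: `y` at most doubles while `a` accumulates the integral `1 / 2`. -/
theorem gronwall_of_integrable_coeff {y a : ℝ → ℝ} {s T : ℝ} (hy : ContinuousOn y (Icc s T))
    (hy0 : ∀ t ∈ Icc s T, 0 ≤ y t) (ha : IntervalIntegrable a volume s T) (ha0 : ∀ t, 0 ≤ a t)
    (h : ∀ r t, s ≤ r → r ≤ t → t ≤ T → y t ≤ y r + ∫ x in r..t, a x * y x) :
    ∀ t ∈ Icc s T, y t ≤ 2 ^ (⌈2 * ∫ x in s..T, a x⌉₊) * y s := by
  intro t₀ ht₀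
  have hsT : s ≤ T := ht₀.1.trans ht₀.2
  have hint : ∀ r t, s ≤ r → r ≤ t → t ≤ T → IntervalIntegrable a volume r t := by
    intro r t h1 h2 h3
    refine ha.mono_set ?_
    rw [uIcc_of_le h2, uIcc_of_le hsT]
    exact Icc_subset_Icc h1 h3
  -- On an interval where `a` has integral at most `c`, the maximum `M` of `y` obeys `M ≤ y r + c M`.
  have key : ∀ r t c, s ≤ r → r ≤ t → t ≤ T → (∫ x in r..t, a x) ≤ c →
      ∃ M, y t ≤ M ∧ 0 ≤ M ∧ M ≤ y r + c * M := by
    intro r t c h1 h2 h3 hc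
    obtain ⟨m, hm, hmax⟩ := isCompact_Icc.exists_isMaxOn (nonempty_Icc.2 h2)
      (hy.mono (Icc_subset_Icc h1 h3))
    have hm0 : 0 ≤ y m := hy0 m ⟨h1.trans hm.1, hm.2.trans h3⟩
    refine ⟨y m, hmax (right_mem_Icc.2 h2), hm0, ?_⟩
    refine (h r m h1 hm.1 (hm.2.trans h3)).trans ?_
    have h4 : ∫ x in r..m, a x * y x ≤ ∫ x in r..m, a x * y m := by
      refine intervalIntegral.integral_mono_on hm.1 ?_ ?_ ?_
      · refine (hint r m h1 hm.1 (hm.2.trans h3)).mul_continuousOn ?_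
        rw [uIcc_of_le hm.1]
        exact hy.mono (Icc_subset_Icc h1 (hm.2.trans h3))
      · exact (hint r m h1 hm.1 (hm.2.trans h3)).mul_const _
      · intro x hx
        exact mul_le_mul_of_nonneg_left (hmax ⟨hx.1, hx.2.trans hm.2⟩) (ha0 x)
    rw [intervalIntegral.integral_mul_const] at h4
    have h5 : ∫ x in r..m, a x ≤ ∫ x in r..t, a x :=
      intervalIntegral.integral_mono_interval le_rfl hm.1 hm.2
        (Eventually.of_forall ha0) (hint r t h1 h2 h3)
    nlinarith [mul_le_mul_of_nonneg_right (h5.trans hc) hm0]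
  have hcont : ContinuousOn (fun t => ∫ x in s..t, a x) (Icc s T) := by
    have := intervalIntegral.continuousOn_primitive_interval' ha left_mem_uIcc
    rwa [uIcc_of_le hsT] at this
  -- induction on the number of portions of size `1 / 2` of the integral of `a`
  have main : ∀ k : ℕ, ∀ t ∈ Icc s T, (∫ x in s..t, a x) ≤ k / 2 → y t ≤ 2 ^ k * y s := by
    intro k
    induction k with
    | zero =>
      intro t ht hk
      obtain ⟨M, h1, h2, h3⟩ := key s t 0 le_rfl ht.1 ht.2 (by simpa using hk)
      simp only [pow_zero, one_mul]
      linarith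
    | succ k ih =>
      intro t ht hk
      have : ∃ r ∈ Icc s t, (∫ x in s..r, a x) ≤ k / 2 ∧ (∫ x in r..t, a x) ≤ 1 / 2 := by
        by_cases h1 : (∫ x in s..t, a x) ≤ k / 2
        · exact ⟨t, right_mem_Icc.2 ht.1, h1, by simp⟩
        · have h2 := intermediate_value_Icc ht.1 (hcont.mono (Icc_subset_Icc le_rfl ht.2))
          obtain ⟨r, hr, hr2⟩ := h2 (show (k / 2 : ℝ) ∈ _ from
            ⟨by simp only [intervalIntegral.integral_same]; positivity, (not_le.1 h1).le⟩)
          refine ⟨r, hr, hr2.le, ?_⟩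
          have := intervalIntegral.integral_add_adjacent_intervals
            (hint s r le_rfl hr.1 (hr.2.trans ht.2)) (hint r t hr.1 hr.2 ht.2)
          simp only at hr2
          push_cast at hk
          linarith
      obtain ⟨r, hr, h1, h2⟩ := this
      obtain ⟨M, h3, h4, h5⟩ := key r t _ hr.1 hr.2 ht.2 h2
      have := ih r ⟨hr.1, hr.2.trans ht.2⟩ h1
      rw [pow_succ]
      linarith
  refine main _ t₀ ht₀ ?_
  have h5 : ∫ x in s..t₀, a x ≤ ∫ x in s..T, a x :=
      intervalIntegral.integral_mono_interval le_rfl ht₀.1 ht₀.2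
        (Eventually.of_forall ha0) ha
  have := Nat.le_ceil (2 * ∫ x in s..T, a x)
  linarith

/-- If a function converges and its integrals over `[s, t]` stay bounded above, the limit cannot be
positive. -/
theorem nonpos_of_tendsto_of_integral_bounded {y : ℝ → ℝ} {s ℓ C : ℝ}
    (hy : Tendsto y atTop (𝓝 ℓ)) (hint : ∀ t, s ≤ t → IntervalIntegrable y volume s t)
    (hC : ∀ t, s ≤ t → ∫ x in s..t, y x ≤ C) : ℓ ≤ 0 := by
  by_contra! hℓ
  obtain ⟨T, hT⟩ := eventually_atTop.1 (hy.eventually (lt_mem_nhds (half_lt_self hℓ)))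
  set T' := max s T
  have h1 : ∀ r, 0 ≤ r → r * (ℓ / 2) ≤ C - ∫ x in s..T', y x := by
    intro r hr
    have hs : s ≤ T' := le_max_left _ _
    have hi : IntervalIntegrable y volume T' (T' + r) :=
      (hint T' hs).symm.trans (hint (T' + r) (by linarith))
    have h2 := intervalIntegral.integral_add_adjacent_intervals (hint T' hs) hi
    have h3 : ∫ x in T'..(T' + r), (ℓ / 2) ≤ ∫ x in T'..(T' + r), y x := by
      refine intervalIntegral.integral_mono_on (by linarith) (by simp) hi ?_
      intro x hx
      exact (hT x ((le_max_right s T).trans hx.1)).le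
    simp only [intervalIntegral.integral_const, smul_eq_mul, add_sub_cancel_left] at h3
    have h4 := hC (T' + r) (by linarith)
    linarith
  have h2 := h1 ((|C - ∫ x in s..T', y x| + 1) / (ℓ / 2)) (by positivity)
  rw [div_mul_cancel₀ _ (by positivity)] at h2
  have := le_abs_self (C - ∫ x in s..T', y x)
  linarith

/-- A continuous curve whose increments are bounded by those of a bounded monotone function
converges. The bound is only needed between times of a set of full measure. -/
theorem exists_tendsto_of_increment_le {H : Type*} [NormedAddCommGroup H] [CompleteSpace H]
    {f : ℝ → H} {K : ℝ → ℝ} {s C : ℝ} (hf : ContinuousOn f (Ici s)) (hK : ContinuousOn K (Ici s))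
    (hmono : MonotoneOn K (Ici s)) (hC : ∀ t, s ≤ t → K t ≤ C) {p : ℝ → Prop}
    (hp : ∀ᵐ r ∂(volume.restrict (Ici s)), p r)
    (h : ∀ r t, s ≤ r → r ≤ t → p r → p t → ‖f t - f r‖ ≤ K t - K r) :
    ∃ L, Tendsto f atTop (𝓝 L) := by
  -- sets of full measure meet every right neighbourhood, so the bound extends by continuity
  have hdense : ∀ r, s ≤ r → ∃ᶠ x in 𝓝[>] r, p x ∧ r < x := by
    intro r hr hneg
    obtain ⟨b, hb, hb2⟩ := (mem_nhdsGT_iff_exists_Ioo_subset).1 hneg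
    rw [ae_restrict_iff' measurableSet_Ici] at hp
    have : volume (Ioo r b) = 0 := by
      refine measure_mono_null ?_ hp
      intro x hx hx'
      exact hb2 hx ⟨hx' (hr.trans hx.1.le), hx.1⟩
    simp only [Real.volume_Ioo, ENNReal.ofReal_eq_zero, sub_nonpos] at this
    exact absurd hb (not_lt.2 this)
  have h1 : ∀ r, s ≤ r → p r → ∀ t, r ≤ t → ‖f t - f r‖ ≤ K t - K r := by
    intro r hsr hr t hrt
    have hst := hsr.trans hrt
    have hsub : Ioi t ⊆ Ici s := fun x hx => hst.trans (le_of_lt hx)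
    have hf' : Tendsto f (𝓝[>] t) (𝓝 (f t)) := (hf t hst).mono_left (nhdsWithin_mono t hsub)
    have hK' : Tendsto K (𝓝[>] t) (𝓝 (K t)) := (hK t hst).mono_left (nhdsWithin_mono t hsub)
    refine le_of_tendsto_of_tendsto_of_frequently (hf'.sub_const (f r)).norm
      (hK'.sub_const (K r)) ?_
    refine (hdense t hst).mono fun x hx => ?_
    exact h r x hsr (hrt.trans hx.2.le) hr hx.1
  refine cauchy_map_iff_exists_tendsto.1 (Metric.cauchySeq_iff'.2 fun ε hε => ?_)
  have hbdd : BddAbove (K '' Ici s) := ⟨C, by rintro _ ⟨t, ht, rfl⟩; exact hC t ht⟩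
  obtain ⟨_, ⟨R, hR, rfl⟩, hR2⟩ := exists_lt_of_lt_csSup (nonempty_Ici.image K)
    (sub_lt_self (sSup (K '' Ici s)) hε)
  obtain ⟨r, hr1, hr2⟩ := (hdense R hR).exists
  have hsr : s ≤ r := le_trans hR hr2.le
  refine ⟨r, fun t ht => ?_⟩
  rw [dist_eq_norm]
  have h2 := h1 r hsr hr1 t ht
  have h3 : K R ≤ K r := hmono hR hsr hr2.le
  have h4 : K t ≤ sSup (K '' Ici s) := le_csSup hbdd ⟨t, hsr.trans ht, rfl⟩
  linarith

/-! ### The energy identity for abstract weak evolution equations -/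

/-- Continuity of translations in `L²(ℝ; Y)`, for a fixed representative. -/
theorem tendsto_eLpNorm_translate_sub {Y : Type*} [NormedAddCommGroup Y] {W : ℝ → Y}
    (hW : MemLp W 2 volume) :
    Tendsto (fun s : ℝ => eLpNorm (fun t => W (t + s) - W t) 2 volume) (𝓝 0) (𝓝 0) := by
  have : Fact ((2 : ENNReal) ≠ ⊤) := ⟨by simp⟩
  have h1 : Continuous fun s : ℝ => (DomAddAct.mk s +ᵥ hW.toLp W : Lp Y 2 volume) - hW.toLp W := by
    have := (DomAddAct.continuous_mk (M := ℝ)).vadd (continuous_const (y := hW.toLp W))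
    exact this.sub continuous_const
  have h2 := (h1.enorm.tendsto 0)
  refine (h2.congr fun s => ?_).trans_eq ?_
  · rw [DomAddAct.mk_vadd_toLp, ← MemLp.toLp_sub, Lp.enorm_toLp]
    refine eLpNorm_congr_ae (Eventually.of_forall fun t => ?_)
    simp [add_comm]
  · simp

theorem lintegral_enorm_mul_enorm_le {α E E' : Type*} [MeasurableSpace α] {μ : Measure α}
    [NormedAddCommGroup E] [NormedAddCommGroup E'] {f : α → E} {k : α → E'}
    (hf : AEStronglyMeasurable f μ) (hk : AEStronglyMeasurable k μ) :
    ∫⁻ x, ‖f x‖ₑ * ‖k x‖ₑ ∂μ ≤ eLpNorm f 2 μ * eLpNorm k 2 μ := by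
  have h := ENNReal.lintegral_mul_le_Lp_mul_Lq μ Real.HolderConjugate.two_two hf.enorm hk.enorm
  rw [eLpNorm_eq_lintegral_rpow_enorm_toReal two_ne_zero (by simp),
    eLpNorm_eq_lintegral_rpow_enorm_toReal two_ne_zero (by simp)]
  simpa using h

/-- The energy identity on a bounded interval. The time derivative of `w` is never formed: for the
defect `e = ‖w‖² - 2 ∫ F(W)`, testing with `W (t + h) + W t` expresses `e (t + h) - e t` through
`g` times increments of `W`, and continuity of translations in `L²` makes these increments
`o(h)` in the mean. -/
theorem energy_identity_of_memLp {X Y : Type*} [NormedAddCommGroup X] [InnerProductSpace ℝ X]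
    [NormedAddCommGroup Y] [NormedSpace ℝ Y] (J : Y →ₗ[ℝ] X) (A : Submodule ℝ Y) {T : ℝ}
    {w : ℝ → X} (hw : ContinuousOn w (Icc 0 T)) {W : ℝ → Y} (hW : MemLp W 2 volume)
    (hWm : StronglyMeasurable W) {g : ℝ → ℝ} (hg : MemLp g 2 volume) (hgm : StronglyMeasurable g)
    (hWA : ∀ᵐ t, t ∈ Ioo 0 T → W t ∈ A ∧ J (W t) = w t) {F : ℝ → Y → ℝ}
    (Fadd : ∀ᵐ r, r ∈ Ioo 0 T → ∀ y ∈ A, ∀ y' ∈ A, F r (y + y') = F r y + F r y')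
    (Fbd : ∀ᵐ r, r ∈ Ioo 0 T → ∀ y ∈ A, |F r y| ≤ g r * ‖y‖)
    (Fint : ∀ y ∈ A, IntervalIntegrable (fun r => F r y) volume 0 T)
    (FW : IntervalIntegrable (fun r => F r (W r)) volume 0 T)
    (heq : ∀ y ∈ A, ∀ t ∈ Icc 0 T, inner ℝ (w t) (J y) - inner ℝ (w 0) (J y) = ∫ r in 0..t, F r y)
    {a b : ℝ} (ha : 0 ≤ a) (hab : a ≤ b) (hbT : b < T) :
    ‖w b‖ ^ 2 - ‖w a‖ ^ 2 = 2 * ∫ r in a..b, F r (W r) := by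
  have hT : 0 < T := by linarith
  -- the defect in the energy identity, to be shown constant
  set e : ℝ → ℝ := fun t => ‖w t‖ ^ 2 - 2 * ∫ r in 0..t, F r (W r) with he
  have hFWi : ∀ s t, 0 ≤ s → s ≤ t → t ≤ T →
      IntervalIntegrable (fun r => F r (W r)) volume s t := by
    intro s t h1 h2 h3
    refine FW.mono_set ?_
    rw [uIcc_of_le h2, uIcc_of_le hT.le]
    exact Icc_subset_Icc h1 h3
  have hFi : ∀ y ∈ A, ∀ s t, 0 ≤ s → s ≤ t → t ≤ T →
      IntervalIntegrable (fun r => F r y) volume s t := by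
    intro y hy s t h1 h2 h3
    refine (Fint y hy).mono_set ?_
    rw [uIcc_of_le h2, uIcc_of_le hT.le]
    exact Icc_subset_Icc h1 h3
  have hec : ContinuousOn e (Icc 0 T) := by
    refine (hw.norm.pow 2).sub (continuousOn_const.mul ?_)
    have := intervalIntegral.continuousOn_primitive_interval' FW left_mem_uIcc
    rwa [uIcc_of_le hT.le] at this
  suffices hconst : e b = e a by
    have h1 := intervalIntegral.integral_add_adjacent_intervals
      (hFWi 0 a le_rfl ha (by linarith)) (hFWi a b ha hab hbT.le)
    simp only [he] at hconst
    linarith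
  set ω : ℝ → ENNReal := fun s => eLpNorm (fun t => W (t + s) - W t) 2 volume with hω
  have hω0 : Tendsto ω (𝓝 0) (𝓝 0) := tendsto_eLpNorm_translate_sub hW
  -- The increment of `e` over `[t, t + h]`, for almost every `t`.
  have hD : ∀ h, 0 < h → b + h < T → ∀ᵐ t, t ∈ Ioc a b →
      ‖e (t + h) - e t‖ₑ ≤ ∫⁻ σ in Ioc 0 h,
        ‖g (t + σ)‖ₑ * (‖W (t + h) - W (t + σ)‖ₑ + ‖W (t + σ) - W t‖ₑ) := by
    intro h hh hbh
    have hsh := (measurePreserving_add_right volume h).quasiMeasurePreserving.ae hWA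
    filter_upwards [hWA, hsh] with t h1 h2 ht
    have ht0 : 0 < t := lt_of_le_of_lt ha ht.1
    have htT : t + h < T := by linarith [ht.2]
    obtain ⟨hA1, hJ1⟩ := h1 ⟨ht0, by linarith⟩
    obtain ⟨hA2, hJ2⟩ := h2 ⟨by linarith, htT⟩
    -- polarization: the increment of `‖w‖²` is the pairing of the increment with the sum
    have hsum : ‖w (t + h)‖ ^ 2 - ‖w t‖ ^ 2 = ∫ r in t..(t + h), F r (W (t + h) + W t) := by
      have hA := A.add_mem hA2 hA1
      have e1 := heq _ hA (t + h) ⟨by linarith, htT.le⟩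
      have e2 := heq _ hA t ⟨ht0.le, by linarith⟩
      have e3 := intervalIntegral.integral_add_adjacent_intervals
        (hFi _ hA 0 t le_rfl ht0.le (by linarith)) (hFi _ hA t (t + h) ht0.le (by linarith) htT.le)
      rw [map_add, hJ1, hJ2] at e1 e2
      simp only [inner_add_right, real_inner_self_eq_norm_sq] at e1 e2
      have e4 := real_inner_comm (w t) (w (t + h))
      linarith
    have hee : e (t + h) - e t =
        ∫ r in t..(t + h), (F r (W (t + h) + W t) - 2 * F r (W r)) := by
      rw [intervalIntegral.integral_sub
        (hFi _ (A.add_mem hA2 hA1) t (t + h) ht0.le (by linarith) htT.le)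
        ((hFWi t (t + h) ht0.le (by linarith) htT.le).const_mul 2),
        intervalIntegral.integral_const_mul, ← hsum]
      have e3 := intervalIntegral.integral_add_adjacent_intervals
        (hFWi 0 t le_rfl ht0.le (by linarith)) (hFWi t (t + h) ht0.le (by linarith) htT.le)
      simp only [he]
      linarith
    have hsub := intervalIntegral.integral_comp_add_left (a := 0) (b := h)
      (fun r => F r (W (t + h) + W t) - 2 * F r (W r)) t
    rw [add_zero] at hsub
    rw [hee, ← hsub, intervalIntegral.integral_of_le hh.le]
    refine (enorm_integral_le_lintegral_enorm _).trans ?_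
    have hq := (measurePreserving_add_left volume t).quasiMeasurePreserving
    refine setLIntegral_mono_ae' measurableSet_Ioc ?_
    filter_upwards [hq.ae hWA, hq.ae Fadd, hq.ae Fbd] with σ k1 k2 k3 hσ
    have hmem : t + σ ∈ Ioo 0 T := ⟨by linarith [hσ.1], by linarith [hσ.2]⟩
    obtain ⟨hA3, -⟩ := k1 hmem
    have k2 := k2 hmem
    have k3 := k3 hmem
    have d1 := A.sub_mem hA2 hA3
    have d2 := A.sub_mem hA3 hA1
    have p1 := k2 _ d1 _ hA3
    have p2 := k2 _ d2 _ hA1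
    have p3 := k2 _ hA2 _ hA1
    rw [sub_add_cancel] at p1 p2
    have q1 := k3 _ d1
    have q2 := k3 _ d2
    have hg0 : g (t + σ) * ‖W (t + h) - W (t + σ)‖ ≤ ‖g (t + σ)‖ * ‖W (t + h) - W (t + σ)‖ :=
      mul_le_mul_of_nonneg_right (le_abs_self _) (norm_nonneg _)
    have hg1 : g (t + σ) * ‖W (t + σ) - W t‖ ≤ ‖g (t + σ)‖ * ‖W (t + σ) - W t‖ :=
      mul_le_mul_of_nonneg_right (le_abs_self _) (norm_nonneg _)
    have : ‖F (t + σ) (W (t + h) + W t) - 2 * F (t + σ) (W (t + σ))‖ ≤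
        ‖g (t + σ)‖ * (‖W (t + h) - W (t + σ)‖ + ‖W (t + σ) - W t‖) := by
      rw [Real.norm_eq_abs, abs_le]
      rw [abs_le] at q1 q2
      constructor <;> linarith
    rw [← ofReal_norm, ← ofReal_norm, ← ofReal_norm,
      ← ofReal_norm, ← ENNReal.ofReal_add (norm_nonneg _) (norm_nonneg _),
      ← ENNReal.ofReal_mul (norm_nonneg _)]
    exact ENNReal.ofReal_le_ofReal this
  have hHolder : ∀ h σ, ∫⁻ t, ‖g (t + σ)‖ₑ * (‖W (t + h) - W (t + σ)‖ₑ + ‖W (t + σ) - W t‖ₑ) ≤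
      eLpNorm g 2 volume * (ω (h - σ) + ω σ) := by
    intro h σ
    have hσ := measurePreserving_add_right (volume : Measure ℝ) σ
    have hWs : ∀ s, AEStronglyMeasurable (fun t => W (t + s) - W t) volume := fun s =>
      ((hWm.comp_measurable (measurable_add_const s)).sub hWm).aestronglyMeasurable
    have c1 : AEStronglyMeasurable (fun t => g (t + σ)) volume :=
      (hgm.comp_measurable (measurable_add_const σ)).aestronglyMeasurable
    have c2 : eLpNorm (fun t => g (t + σ)) 2 volume = eLpNorm g 2 volume :=
      eLpNorm_comp_measurePreserving hgm.aestronglyMeasurable hσ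
    have c3 : (fun t => W (t + h) - W (t + σ)) =
        (fun t => W (t + (h - σ)) - W t) ∘ (fun t => t + σ) := by
      ext t; simp [add_assoc]
    have c4 : eLpNorm (fun t => W (t + h) - W (t + σ)) 2 volume = ω (h - σ) := by
      rw [c3]
      exact eLpNorm_comp_measurePreserving (hWs _) hσ
    have c5 : AEStronglyMeasurable (fun t => W (t + h) - W (t + σ)) volume := by
      rw [c3]
      exact (hWs _).comp_measurePreserving hσ
    simp only [mul_add]
    rw [lintegral_add_left' (show AEMeasurable (fun t => ‖g (t + σ)‖ₑ * ‖W (t + h) - W (t + σ)‖ₑ)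
      volume from c1.enorm.mul c5.enorm)]
    refine add_le_add ?_ ?_
    · rw [← c2, ← c4]
      exact lintegral_enorm_mul_enorm_le c1 c5
    · rw [← c2]
      exact lintegral_enorm_mul_enorm_le c1 (hWs σ)
  have hint : ∀ h, 0 < h → b + h < T → ‖∫ t in a..b, (e (t + h) - e t)‖ₑ ≤
      ∫⁻ σ in Ioc 0 h, eLpNorm g 2 volume * (ω (h - σ) + ω σ) := by
    intro h hh hbh
    rw [intervalIntegral.integral_of_le hab]
    refine (enorm_integral_le_lintegral_enorm _).trans ?_
    refine (setLIntegral_mono_ae' measurableSet_Ioc (hD h hh hbh)).trans ?_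
    rw [lintegral_lintegral_swap]
    · refine lintegral_mono fun σ => ?_
      exact (setLIntegral_le_lintegral _ _).trans (hHolder h σ)
    · refine Measurable.aemeasurable ?_
      have := hgm.measurable
      have m1 : Measurable fun p : ℝ × ℝ => ‖g (p.1 + p.2)‖ₑ := by fun_prop
      have m2 : Measurable fun p : ℝ × ℝ => ‖W (p.1 + h) - W (p.1 + p.2)‖ₑ :=
        ((hWm.comp_measurable (g := fun p : ℝ × ℝ => p.1 + h) (by fun_prop)).sub
         (hWm.comp_measurable (g := fun p : ℝ × ℝ => p.1 + p.2) (by fun_prop))).enorm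
      have m3 : Measurable fun p : ℝ × ℝ => ‖W (p.1 + p.2) - W p.1‖ₑ :=
        ((hWm.comp_measurable (g := fun p : ℝ × ℝ => p.1 + p.2) (by fun_prop)).sub
         (hWm.comp_measurable (g := fun p : ℝ × ℝ => p.1) (by fun_prop))).enorm
      exact m1.mul (m2.add m3)
  -- The averages of `e` over `[a, a + h]` and `[b, b + h]` have asymptotically equal values.
  have heii : ∀ s t, 0 ≤ s → s ≤ t → t ≤ T → IntervalIntegrable e volume s t := by
    intro s t h1 h2 h3
    refine ContinuousOn.intervalIntegrable (hec.mono ?_)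
    rw [uIcc_of_le h2]
    exact Icc_subset_Icc h1 h3
  have hshift : ∀ h, 0 < h → b + h < T → ∫ t in a..b, (e (t + h) - e t) =
      (∫ t in b..(b + h), e t) - ∫ t in a..(a + h), e t := by
    intro h hh hbh
    rw [intervalIntegral.integral_sub, intervalIntegral.integral_comp_add_right]
    · have e1 := intervalIntegral.integral_add_adjacent_intervals
        (heii a (a + h) ha (by linarith) (by linarith))
        (heii (a + h) (b + h) (by linarith) (by linarith) (by linarith))
      have e2 := intervalIntegral.integral_add_adjacent_intervals
        (heii a b ha hab (by linarith)) (heii b (b + h) (by linarith) (by linarith) (by linarith))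
      linarith
    · refine ContinuousOn.intervalIntegrable (hec.comp (by fun_prop) ?_)
      intro t ht
      rw [uIcc_of_le hab] at ht
      exact ⟨by linarith [ht.1], by linarith [ht.2]⟩
    · exact heii a b ha hab (by linarith)
  have havg : ∀ c, 0 ≤ c → c < T →
      Tendsto (fun h => h⁻¹ * ∫ t in c..(c + h), e t) (𝓝[>] 0) (𝓝 (e c)) := by
    intro c hc hcT
    have hd : HasDerivWithinAt (fun u => ∫ x in c..u, e x) (e c) (Ici c) c := by
      have hcc : ContinuousWithinAt e (Ioi c) c :=
        (hec c ⟨hc, hcT.le⟩).mono_of_mem_nhdsWithin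
          (mem_of_superset (Ioo_mem_nhdsGT hcT) fun x hx => ⟨hc.trans hx.1.le, hx.2.le⟩)
      refine intervalIntegral.integral_hasDerivWithinAt_right (by simp) ?_ hcc
      refine ⟨Ioo c T, Ioo_mem_nhdsGT hcT, ?_⟩
      exact (hec.mono fun x hx => ⟨hc.trans hx.1.le, hx.2.le⟩).aestronglyMeasurable
        measurableSet_Ioo
    have h1 := (hasDerivWithinAt_iff_tendsto_slope' (by simp)).1 (hd.mono Ioi_subset_Ici_self)
    have h2 : Tendsto (fun h : ℝ => c + h) (𝓝[>] 0) (𝓝[>] c) := by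
      refine tendsto_nhdsWithin_iff.2 ⟨?_, ?_⟩
      · have : Tendsto (fun h : ℝ => c + h) (𝓝 0) (𝓝 (c + 0)) :=
          (continuous_const_add c).tendsto 0
        rw [add_zero] at this
        exact this.mono_left nhdsWithin_le_nhds
      · filter_upwards [self_mem_nhdsWithin] with h hh
        simpa using hh
    refine (h1.comp h2).congr fun h => ?_
    simp [slope_def_field, div_eq_inv_mul]
  have hlim : Tendsto (fun h => h⁻¹ * ∫ t in a..b, (e (t + h) - e t)) (𝓝[>] 0)
      (𝓝 (e b - e a)) := by
    refine ((havg b (ha.trans hab) hbT).sub (havg a ha (by linarith))).congr' ?_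
    filter_upwards [Ioo_mem_nhdsGT (show (0 : ℝ) < T - b by linarith)] with h hh
    rw [hshift h hh.1 (by linarith [hh.2]), mul_sub]
  -- the averaged increments are bounded by the modulus of continuity of `W` in `L²`
  have hzero : Tendsto (fun h => h⁻¹ * ∫ t in a..b, (e (t + h) - e t)) (𝓝[>] 0) (𝓝 0) := by
    set G := (eLpNorm g 2 volume).toReal
    have hG : 0 ≤ G := ENNReal.toReal_nonneg
    rw [Metric.tendsto_nhds]
    intro ε hε
    obtain ⟨δ, hδ, hδ2⟩ := Metric.eventually_nhds_iff.1
      (hω0.eventually (show Iic (ENNReal.ofReal (ε / (4 * (G + 1)))) ∈ 𝓝 (0 : ENNReal) from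
        Iic_mem_nhds (ENNReal.ofReal_pos.2 (by positivity))))
    have hδT : 0 < min δ (T - b) := lt_min hδ (by linarith)
    filter_upwards [Ioo_mem_nhdsGT hδT] with h hh
    have hhδ : h < δ := hh.2.trans_le (min_le_left _ _)
    have hhT : h < T - b := hh.2.trans_le (min_le_right _ _)
    have h1 := hint h hh.1 (by linarith)
    have h2 : ∫⁻ σ in Ioc 0 h, eLpNorm g 2 volume * (ω (h - σ) + ω σ) ≤
        ∫⁻ σ in Ioc 0 h, ENNReal.ofReal (G * (ε / (4 * (G + 1)) + ε / (4 * (G + 1)))) := by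
      refine setLIntegral_mono' measurableSet_Ioc fun σ hσ => ?_
      rw [ENNReal.ofReal_mul (by positivity), ENNReal.ofReal_add (by positivity) (by positivity),
        ENNReal.ofReal_toReal hg.eLpNorm_ne_top]
      refine mul_le_mul_right (add_le_add (hδ2 ?_) (hδ2 ?_)) _
      · rw [Real.dist_eq, sub_zero, abs_of_nonneg (by linarith [hσ.2])]; linarith [hσ.1]
      · rw [Real.dist_eq, sub_zero, abs_of_pos hσ.1]; linarith [hσ.2]
    have h3 := h1.trans h2
    rw [setLIntegral_const, Real.volume_Ioc, sub_zero, ← ENNReal.ofReal_mul (by positivity),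
      ← ofReal_norm, ENNReal.ofReal_le_ofReal_iff (by have := hh.1; positivity)] at h3
    rw [dist_zero_right, norm_mul, norm_inv, Real.norm_of_nonneg hh.1.le]
    have h4 : h⁻¹ * ‖∫ t in a..b, (e (t + h) - e t)‖ ≤
        G * (ε / (4 * (G + 1)) + ε / (4 * (G + 1))) := by
      rw [inv_mul_le_iff₀ hh.1]
      linarith
    have h5 : G * (ε / (4 * (G + 1)) + ε / (4 * (G + 1))) < ε := by
      rw [← add_div, mul_div_assoc', div_lt_iff₀ (by positivity)]
      nlinarith
    linarith
  exact sub_eq_zero.1 (tendsto_nhds_unique hlim hzero)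

/-- The energy identity on the half line: if `w = J W` almost everywhere, `W ∈ L²_loc` takes its
values in the space `A` of admissible test elements, and `w` solves `⟨w', J y⟩ = F(y)` on `A`
weakly in time, with `|F r y| ≤ g r ‖y‖` and `g ∈ L²_loc`, then `½ (‖w‖²)' = F(W)`. -/
theorem energy_identity {X Y : Type*} [NormedAddCommGroup X] [InnerProductSpace ℝ X]
    [NormedAddCommGroup Y] [NormedSpace ℝ Y] (J : Y →ₗ[ℝ] X) (A : Submodule ℝ Y)
    {w : ℝ → X} (hw : ContinuousOn w (Ici 0)) {W : ℝ → Y}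
    (hW : ∀ T, 0 < T → MemLp W 2 (volume.restrict (Ioo 0 T))) {g : ℝ → ℝ}
    (hg : ∀ T, 0 < T → MemLp g 2 (volume.restrict (Ioo 0 T)))
    (hWA : ∀ᵐ t ∂(volume.restrict (Ioi (0 : ℝ))), W t ∈ A ∧ J (W t) = w t) {F : ℝ → Y → ℝ}
    (Fadd : ∀ᵐ r ∂(volume.restrict (Ioi (0 : ℝ))),
      ∀ y ∈ A, ∀ y' ∈ A, F r (y + y') = F r y + F r y')
    (Fbd : ∀ᵐ r ∂(volume.restrict (Ioi (0 : ℝ))), ∀ y ∈ A, |F r y| ≤ g r * ‖y‖)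
    (Fint : ∀ y ∈ A, ∀ T, 0 < T → IntervalIntegrable (fun r => F r y) volume 0 T)
    (FW : ∀ T, 0 < T → IntervalIntegrable (fun r => F r (W r)) volume 0 T)
    (heq : ∀ y ∈ A, ∀ t, 0 ≤ t → inner ℝ (w t) (J y) - inner ℝ (w 0) (J y) = ∫ r in 0..t, F r y)
    {a b : ℝ} (ha : 0 ≤ a) (hab : a ≤ b) :
    ‖w b‖ ^ 2 - ‖w a‖ ^ 2 = 2 * ∫ r in a..b, F r (W r) := by
  set T := b + 1
  have hT : 0 < T := by linarith
  set W' := (Ioo 0 T).indicator ((hW T hT).1.mk W)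
  set g' := (Ioo 0 T).indicator ((hg T hT).1.mk g)
  have hWW : ∀ᵐ t, t ∈ Ioo 0 T → W' t = W t := by
    filter_upwards [(ae_restrict_iff' measurableSet_Ioo).1 (hW T hT).1.ae_eq_mk] with t h1 h2
    simp only [W', indicator_of_mem h2]
    exact (h1 h2).symm
  have hgg : ∀ᵐ t, t ∈ Ioo 0 T → g' t = g t := by
    filter_upwards [(ae_restrict_iff' measurableSet_Ioo).1 (hg T hT).1.ae_eq_mk] with t h1 h2
    simp only [g', indicator_of_mem h2]
    exact (h1 h2).symm
  rw [ae_restrict_iff' measurableSet_Ioi] at hWA Fadd Fbd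
  have hFWW : ∀ᵐ r, r ∈ Ioo 0 T → F r (W' r) = F r (W r) := by
    filter_upwards [hWW] with r h1 h2
    rw [h1 h2]
  have hFWi : IntervalIntegrable (fun r => F r (W' r)) volume 0 T := by
    rw [intervalIntegrable_iff_integrableOn_Ioo_of_le hT.le]
    refine ((intervalIntegrable_iff_integrableOn_Ioo_of_le hT.le).1 (FW T hT)).congr ?_
    rw [EventuallyEq, ae_restrict_iff' measurableSet_Ioo]
    filter_upwards [hFWW] with r h1 h2
    exact (h1 h2).symm
  rw [energy_identity_of_memLp J A (T := T) (hw.mono Icc_subset_Ici_self) (W := W') (g := g')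
    ((memLp_indicator_iff_restrict measurableSet_Ioo).2
      ((memLp_congr_ae (hW T hT).1.ae_eq_mk).1 (hW T hT)))
    ((hW T hT).1.stronglyMeasurable_mk.indicator measurableSet_Ioo)
    ((memLp_indicator_iff_restrict measurableSet_Ioo).2
      ((memLp_congr_ae (hg T hT).1.ae_eq_mk).1 (hg T hT)))
    ((hg T hT).1.stronglyMeasurable_mk.indicator measurableSet_Ioo)
    ?_ ?_ ?_ (fun y hy => Fint y hy T hT) hFWi (fun y hy t ht => heq y hy t ht.1) ha hab
    (lt_add_one b)]
  · congr 1
    rw [intervalIntegral.integral_of_le hab, intervalIntegral.integral_of_le hab]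
    refine setIntegral_congr_ae measurableSet_Ioc ?_
    filter_upwards [hFWW] with r h1 h2
    exact h1 ⟨lt_of_le_of_lt ha h2.1, lt_of_le_of_lt h2.2 (lt_add_one b)⟩
  · filter_upwards [hWW, hWA] with t h1 h2 h3
    rw [h1 h3]
    exact h2 h3.1
  · filter_upwards [Fadd] with t h1 h3
    exact h1 h3.1
  · filter_upwards [Fbd, hgg] with t h1 h2 h3
    rw [h2 h3]
    exact h1 h3.1

/-! ### Translations of the torus and derivatives along them -/

instance fact_zero_lt_one_real : Fact ((0 : ℝ) < 1) := ⟨zero_lt_one⟩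

instance fact_zero_lt_two_real : Fact ((0 : ℝ) < 2) := ⟨zero_lt_two⟩

/-- The torus `ℝ/ℤ × ℝ/2ℤ`: the double of the channel across its walls. -/
abbrev Torus : Type := AddCircle (1 : ℝ) × AddCircle (2 : ℝ)

/-- The real space `L²` of the torus. -/
abbrev L2T : Type := Lp ℝ 2 (volume : Measure Torus)

instance isAddHaarMeasure_torus : (volume : Measure Torus).IsAddHaarMeasure :=
  Measure.prod.instIsAddHaarMeasure _ _

/-- Translation of `L²` functions, `f ↦ f (· + a)`. -/
def tshift (a : Torus) : L2T →ₗᵢ[ℝ] L2T :=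
  Lp.compMeasurePreservingₗᵢ ℝ (fun z => z + a) (measurePreserving_add_right volume a)

theorem tshift_ae (a : Torus) (f : L2T) : tshift a f =ᵐ[volume] fun z => f (z + a) :=
  Lp.coeFn_compMeasurePreserving f (measurePreserving_add_right volume a)

theorem tshift_tshift (a b : Torus) (f : L2T) :
    tshift a (tshift b f) = tshift (a + b) f := by
  apply Lp.ext
  have h1 := (measurePreserving_add_right (volume : Measure Torus) a).quasiMeasurePreserving.ae
    (tshift_ae b f)
  filter_upwards [tshift_ae a (tshift b f), tshift_ae (a + b) f, h1] with z h1 h2 h3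
  rw [h1, h2, h3, add_assoc]

@[simp]
theorem tshift_zero (f : L2T) : tshift 0 f = f := by
  apply Lp.ext
  filter_upwards [tshift_ae 0 f] with z h
  rw [h, add_zero]

theorem continuous_tshift (f : L2T) : Continuous fun a => tshift a f := by
  have h1 : Continuous fun a : Torus => (ContinuousMap.mk (fun z => z + a) : C(Torus, Torus)) :=
    ContinuousMap.continuous_of_continuous_uncurry _ (by
      change Continuous fun p : Torus × Torus => p.2 + p.1
      fun_prop)
  exact continuous_const.compMeasurePreservingLp h1
    (fun a => measurePreserving_add_right volume a) (by simp)

theorem inner_tshift (a : Torus) (f g : L2T) :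
    inner ℝ (tshift a f) g = inner ℝ f (tshift (-a) g) := by
  rw [← (tshift a).inner_map_map f (tshift (-a) g), tshift_tshift]
  simp

/-- `g` is the derivative of `f` along the one-parameter subgroup `e` of the torus, as the strong
`L²` derivative of the orbit `s ↦ f (· + e s)`. -/
def HasOrbitDeriv (e : ℝ →+ Torus) (f g : L2T) : Prop :=
  HasDerivAt (fun s => tshift (e s) f) g 0

namespace HasOrbitDeriv

variable {e : ℝ →+ Torus} {f g f' g' : L2T}

theorem zero : HasOrbitDeriv e 0 0 := by
  simpa [HasOrbitDeriv] using hasDerivAt_const (0 : ℝ) (0 : L2T)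

theorem add (h : HasOrbitDeriv e f g) (h' : HasOrbitDeriv e f' g') :
    HasOrbitDeriv e (f + f') (g + g') := by
  simpa [HasOrbitDeriv] using HasDerivAt.fun_add h h'

theorem sub (h : HasOrbitDeriv e f g) (h' : HasOrbitDeriv e f' g') :
    HasOrbitDeriv e (f - f') (g - g') := by
  simpa [HasOrbitDeriv] using HasDerivAt.fun_sub h h'

theorem neg (h : HasOrbitDeriv e f g) : HasOrbitDeriv e (-f) (-g) := by
  simpa [HasOrbitDeriv] using HasDerivAt.fun_neg h

theorem smul (c : ℝ) (h : HasOrbitDeriv e f g) : HasOrbitDeriv e (c • f) (c • g) := by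
  simpa [HasOrbitDeriv] using HasDerivAt.fun_const_smul c h

/-- Bounded operators that commute with translations commute with derivatives. -/
theorem map_of_commute (L : L2T →L[ℝ] L2T) (hL : ∀ s f, L (tshift (e s) f) = tshift (e s) (L f))
    (h : HasOrbitDeriv e f g) : HasOrbitDeriv e (L f) (L g) := by
  have := L.hasFDerivAt.comp_hasDerivAt (0 : ℝ) h
  refine this.congr_of_eventuallyEq (Eventually.of_forall fun s => ?_)
  exact (hL s f).symm

theorem comp_tshift (a : Torus) (h : HasOrbitDeriv e f g) :
    HasOrbitDeriv e (tshift a f) (tshift a g) := by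
  refine h.map_of_commute (tshift a).toContinuousLinearMap fun s f => ?_
  simp [tshift_tshift, add_comm]

/-- By the group law the orbit is differentiable at every time once it is at `0`. -/
theorem hasDerivAt (h : HasOrbitDeriv e f g) (s : ℝ) :
    HasDerivAt (fun s => tshift (e s) f) (tshift (e s) g) s := by
  have h1 : HasDerivAt (fun r => tshift (e r) (tshift (e s) f))
      (tshift (e s) g) (s - s) := by
    rw [sub_self]
    exact h.comp_tshift (e s)
  have h2 := HasDerivAt.scomp (h := fun x => x - s) s h1 ((hasDerivAt_id' s).sub_const s)
  rw [one_smul] at h2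
  refine h2.congr_of_eventuallyEq (Eventually.of_forall fun r => ?_)
  simp [tshift_tshift, ← map_add]

theorem norm_tshift_sub_le (h : HasOrbitDeriv e f g) (s : ℝ) :
    ‖tshift (e s) f - f‖ ≤ |s| * ‖g‖ := by
  have := (convex_univ (𝕜 := ℝ) (E := ℝ)).norm_image_sub_le_of_norm_hasDerivWithin_le
    (fun r _ => (h.hasDerivAt r).hasDerivWithinAt) (C := ‖g‖)
    (fun r _ => by rw [LinearIsometry.norm_map]) (mem_univ 0) (mem_univ s)
  simpa [mul_comm] using this

theorem tendsto_diffQuot (h : HasOrbitDeriv e f g) :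
    Tendsto (fun s : ℝ => s⁻¹ • (tshift (e s) f - f)) (𝓝[≠] 0) (𝓝 g) := by
  have := hasDerivAt_iff_tendsto_slope_zero.1 h
  simpa using this

theorem norm_diffQuot_le (h : HasOrbitDeriv e f g) (s : ℝ) :
    ‖s⁻¹ • (tshift (e s) f - f)‖ ≤ ‖g‖ := by
  rw [norm_smul, norm_inv, Real.norm_eq_abs]
  rcases eq_or_ne s 0 with rfl | hs
  · simp
  · rw [inv_mul_le_iff₀ (abs_pos.2 hs)]
    exact h.norm_tshift_sub_le s

/-- Integration by parts. -/
theorem inner_right (h : HasOrbitDeriv e f g) (h' : HasOrbitDeriv e f' g') :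
    inner ℝ g f' = - inner ℝ f g' := by
  have h1 := HasDerivAt.inner ℝ h h'
  have h2 : HasDerivAt (fun s => inner ℝ (tshift (e s) f) (tshift (e s) f'))
      0 0 := by
    simpa using hasDerivAt_const (0 : ℝ) (inner ℝ f f')
  have := h1.unique h2
  simp only [map_zero, tshift_zero] at this
  linarith

variable (he : Continuous e)
include he

theorem continuous_orbit (g : L2T) : Continuous fun s => tshift (e s) g :=
  (continuous_tshift g).comp he

theorem of_forall_eq_integral (h : ∀ s : ℝ, tshift (e s) f - f =
    ∫ r in (0 : ℝ)..s, tshift (e r) g) : HasOrbitDeriv e f g := by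
  have h1 := ((continuous_orbit he g).integral_hasStrictDerivAt 0 0).hasDerivAt.const_add f
  simp only [map_zero, tshift_zero] at h1
  refine h1.congr_of_eventuallyEq (Eventually.of_forall fun s => ?_)
  simp only [← h s]
  abel

/-- Averages along the orbit lie in the domain of the generator; they are the test elements of
`of_forall_inner`. -/
theorem orbit_integral (φ : L2T) (s : ℝ) :
    HasOrbitDeriv e (∫ r in (0 : ℝ)..s, tshift (e (-r)) φ)
      (φ - tshift (e (-s)) φ) := by
  have hc : Continuous fun r => tshift (e (-r)) φ :=
    (continuous_orbit he φ).comp continuous_neg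
  have h1 : ∀ u, HasDerivAt (fun u => ∫ r in (0 : ℝ)..u, tshift (e (-r)) φ)
      (tshift (e (-u)) φ) u := fun u => (hc.integral_hasStrictDerivAt 0 u).hasDerivAt
  have h2 : HasDerivAt (fun h => (∫ r in (0 : ℝ)..(s - h), tshift (e (-r)) φ) -
      ∫ r in (0 : ℝ)..(0 - h), tshift (e (-r)) φ)
      (φ - tshift (e (-s)) φ) 0 := by
    have k1 := HasDerivAt.scomp (0 : ℝ) (by simpa using h1 s : HasDerivAt _ _ (s - 0))
      ((hasDerivAt_id (0 : ℝ)).const_sub s)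
    have k2 := HasDerivAt.scomp (0 : ℝ) (by simpa using h1 0 : HasDerivAt _ _ ((0 : ℝ) - 0))
      ((hasDerivAt_id (0 : ℝ)).const_sub 0)
    have := k1.fun_sub k2
    simpa [Function.comp_def, neg_add_eq_sub] using this
  refine h2.congr_of_eventuallyEq (Eventually.of_forall fun h => ?_)
  have hi : ∀ a b, IntervalIntegrable (fun r => tshift (e (-r)) φ) volume a b :=
    fun a b => hc.intervalIntegrable a b
  have e1 : tshift (e h) (∫ r in (0 : ℝ)..s, tshift (e (-r)) φ) =
      ∫ r in (0 : ℝ)..s, tshift (e (-(r - h))) φ := by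
    have := ((tshift (e h)).toContinuousLinearMap).intervalIntegral_comp_comm (hi 0 s)
    rw [LinearIsometry.coe_toContinuousLinearMap] at this
    rw [← this]
    refine intervalIntegral.integral_congr fun r _ => ?_
    simp only [tshift_tshift, ← map_add]
    congr 3
    ring
  simp only
  rw [e1, intervalIntegral.integral_comp_sub_right (fun r => tshift (e (-r)) φ),
    intervalIntegral.integral_interval_sub_left (hi _ _) (hi _ _)]

/-- The generator of translations is skew-adjoint: a weak derivative, tested against the domain of
the generator, is a strong one. -/
theorem of_forall_inner (h : ∀ χ χ' : L2T, HasOrbitDeriv e χ χ' →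
    inner ℝ g χ = - inner ℝ f χ') : HasOrbitDeriv e f g := by
  refine of_forall_eq_integral he fun s => ?_
  refine ext_inner_right ℝ fun φ => ?_
  have h1 := h _ _ (orbit_integral he φ s)
  have hc : Continuous fun r => tshift (e (-r)) φ :=
    (continuous_orbit he φ).comp continuous_neg
  have e1 := (innerSL ℝ g : L2T →L[ℝ] ℝ).intervalIntegral_comp_comm (hc.intervalIntegrable (μ := volume) 0 s)
  have e2 := (innerSL ℝ φ : L2T →L[ℝ] ℝ).intervalIntegral_comp_comm
    ((continuous_orbit he g).intervalIntegrable (μ := volume) 0 s)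
  simp only [innerSL_apply_apply] at e1 e2
  rw [real_inner_comm φ (∫ r in (0 : ℝ)..s, tshift (e r) g), ← e2]
  rw [← e1] at h1
  have e3 : ∫ r in (0 : ℝ)..s, inner ℝ φ (tshift (e r) g) =
      ∫ r in (0 : ℝ)..s, inner ℝ g (tshift (e (-r)) φ) := by
    refine intervalIntegral.integral_congr fun r _ => ?_
    rw [real_inner_comm, inner_tshift, map_neg]
  rw [e3, h1, inner_sub_left, inner_sub_right, inner_tshift, map_neg, real_inner_comm φ f]
  ring

/-- Bounded difference quotients along some step sizes tending to zero yield a derivative. -/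
theorem exists_of_bounded_diffQuot {ι : Type*} {l : Filter ι} [NeBot l] {h : ι → ℝ}
    (hh : Tendsto h l (𝓝[≠] 0)) {C : ℝ}
    (hC : ∃ᶠ i in l, ‖(h i)⁻¹ • (tshift (e (h i)) f - f)‖ ≤ C) :
    ∃ g, HasOrbitDeriv e f g := by
  set S := {i | ‖(h i)⁻¹ • (tshift (e (h i)) f - f)‖ ≤ C}
  have hne : NeBot (l ⊓ 𝓟 S) := frequently_mem_iff_neBot.1 hC
  obtain ⟨𝒰, h𝒰, g, -, hg⟩ := exists_weak_cluster (l ⊓ 𝓟 S)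
    (fun i => (h i)⁻¹ • (tshift (e (h i)) f - f)) C (mem_inf_of_right (mem_principal_self S))
  refine ⟨g, of_forall_inner he fun χ χ' hχ => ?_⟩
  have h1 := hχ.tendsto_diffQuot
  have h2 : Tendsto (fun i => -h i) 𝒰 (𝓝[≠] 0) := by
    have h3 := hh.mono_left (h𝒰.trans inf_le_left)
    rw [tendsto_nhdsWithin_iff] at h3 ⊢
    refine ⟨by simpa using h3.1.neg, ?_⟩
    filter_upwards [h3.2] with i hi
    simpa using hi
  have h4 : Tendsto (fun i => - inner ℝ f ((-h i)⁻¹ • (tshift (e (-h i)) χ - χ))) 𝒰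
      (𝓝 (- inner ℝ f χ')) := ((continuous_const.inner continuous_id).tendsto χ').comp
        (h1.comp h2) |>.neg
  refine tendsto_nhds_unique (hg χ) (h4.congr fun i => ?_)
  rw [inner_smul_left, inner_smul_right, inner_sub_left, inner_sub_right, inner_tshift, map_neg]
  simp [inv_neg]

end HasOrbitDeriv

/-- The horizontal one-parameter subgroup. -/
def dirX : ℝ →+ Torus where
  toFun s := ((s : AddCircle (1 : ℝ)), 0)
  map_zero' := by simp
  map_add' := by simp

/-- The vertical one-parameter subgroup. -/
def dirY : ℝ →+ Torus where
  toFun s := (0, (s : AddCircle (2 : ℝ)))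
  map_zero' := by simp
  map_add' := by simp

theorem dirX_apply (s : ℝ) : dirX s = ((s : AddCircle (1 : ℝ)), 0) := rfl

theorem dirY_apply (s : ℝ) : dirY s = (0, (s : AddCircle (2 : ℝ))) := rfl

theorem continuous_dirX : Continuous dirX :=
  (AddCircle.continuous_mk' 1).prodMk continuous_const

theorem continuous_dirY : Continuous dirY :=
  continuous_const.prodMk (AddCircle.continuous_mk' 2)

/-! ### The anisotropic product estimate -/

theorem ENNReal.add_sq_le_two_mul (a b : ENNReal) : (a + b) ^ 2 ≤ 2 * (a ^ 2 + b ^ 2) := by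
  have := ENNReal.rpow_add_le_mul_rpow_add_rpow a b (p := 2) one_le_two
  norm_num at this
  exact_mod_cast this

theorem lintegral_sq_le {α : Type*} [MeasurableSpace α] {μ : Measure α} {k : α → ENNReal}
    (hk : AEMeasurable k μ) : (∫⁻ x, k x ∂μ) ^ 2 ≤ μ univ * ∫⁻ x, k x ^ 2 ∂μ := by
  have h := ENNReal.lintegral_mul_le_Lp_mul_Lq μ Real.HolderConjugate.two_two
    (aemeasurable_const (b := (1 : ENNReal))) hk
  have h2 := pow_le_pow_left₀ zero_le h 2
  simp only [Pi.mul_apply, one_mul, ENNReal.one_rpow, lintegral_const, mul_pow] at h2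
  have h3 : ∀ x : ENNReal, (x ^ (1 / 2 : ℝ)) ^ 2 = x := fun x => by
    rw [← ENNReal.rpow_natCast, ← ENNReal.rpow_mul]
    norm_num
  rw [h3, h3] at h2
  exact_mod_cast h2

theorem enorm_sq_eq_lintegral {α : Type*} [MeasurableSpace α] {μ : Measure α} (f : Lp ℝ 2 μ) :
    ‖f‖ₑ ^ 2 = ∫⁻ x, ‖f x‖ₑ ^ 2 ∂μ := by
  have := eLpNorm_nnreal_pow_eq_lintegral (μ := μ) (f := f) (p := 2) two_ne_zero
  simp only [ENNReal.coe_ofNat, NNReal.coe_ofNat, ENNReal.rpow_ofNat] at this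
  rw [Lp.enorm_def, this]

theorem real_inner_eq_integral_mul {α : Type*} [MeasurableSpace α] {μ : Measure α}
    (f g : Lp ℝ 2 μ) : inner ℝ f g = ∫ x, f x * g x ∂μ := by
  rw [L2.inner_def]
  refine integral_congr_ae (Eventually.of_forall fun x => ?_)
  simp [mul_comm]

namespace HasOrbitDeriv

variable {e : ℝ →+ Torus} {f g : L2T}

theorem enorm_inner_tshift_le (a : Torus) (f φ : L2T) :
    ‖inner ℝ (tshift a f) φ‖ₑ ≤ ∫⁻ z, ‖f (z + a)‖ₑ * ‖φ z‖ₑ := by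
  rw [real_inner_eq_integral_mul]
  refine (enorm_integral_le_lintegral_enorm _).trans (lintegral_mono_ae ?_)
  filter_upwards [tshift_ae a f] with z hz
  rw [enorm_mul, hz]

/-- Pointwise control of a function by averages of it and of its derivative along the orbits. -/
theorem ae_enorm_le (he : Continuous e) (h : HasOrbitDeriv e f g) {δ : ℝ} (hδ : 0 < δ) :
    ∀ᵐ z, ‖f z‖ₑ ≤ (ENNReal.ofReal δ)⁻¹ * (∫⁻ s in Ioc 0 δ, ‖f (z + e s)‖ₑ) +
      ∫⁻ s in Ioc 0 δ, ‖g (z + e s)‖ₑ := by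
  have hfm := (Lp.stronglyMeasurable f).measurable
  have hgm := (Lp.stronglyMeasurable g).measurable
  have hem : Measurable e := he.measurable
  have m1 : ∀ k : Torus → ℝ, Measurable k →
      Measurable (fun p : Torus × ℝ => ‖k (p.1 + e p.2)‖ₑ) := by
    intro k hk; fun_prop
  -- duality: integrate over a set `S` against the sign of `f`
  refine ae_le_of_forall_setLIntegral_le_of_sigmaFinite hfm.enorm fun S hS _ => ?_
  set sg : Torus → ℝ := fun z => if 0 ≤ f z then 1 else -1 with hsg
  have hsgm : Measurable sg := Measurable.ite (measurableSet_le measurable_const hfm)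
    measurable_const measurable_const
  have hsgn : ∀ z, ‖sg z‖ₑ = 1 := by
    intro z; simp only [hsg]; split_ifs <;> simp
  have hmem : MemLp (S.indicator sg) 2 (volume : Measure Torus) := by
    refine MemLp.indicator hS (MemLp.of_bound hsgm.aestronglyMeasurable 1 ?_)
    refine Eventually.of_forall fun z => ?_
    simp only [hsg]; split_ifs <;> simp
  set φ : L2T := hmem.toLp _
  have hφ : φ =ᵐ[volume] S.indicator sg := hmem.coeFn_toLp
  have hφn : ∀ k : Torus → ENNReal, ∫⁻ z, k z * ‖φ z‖ₑ = ∫⁻ z in S, k z := by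
    intro k
    rw [← lintegral_indicator hS]
    refine lintegral_congr_ae ?_
    filter_upwards [hφ] with z hz
    rw [hz]
    by_cases hzS : z ∈ S <;> simp [hzS, hsgn]
  have hI : ∫⁻ z in S, ‖f z‖ₑ = ‖inner ℝ f φ‖ₑ := by
    have h1 : ∀ᵐ z, f z * φ z = S.indicator (fun z => ‖f z‖) z := by
      filter_upwards [hφ] with z hz
      rw [hz]
      by_cases hzS : z ∈ S
      · simp only [hzS, indicator_of_mem, hsg, Real.norm_eq_abs]
        split_ifs with h0
        · rw [abs_of_nonneg h0, mul_one]
        · rw [abs_of_neg (not_le.1 h0)]; ring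
      · simp [hzS]
    rw [real_inner_eq_integral_mul, integral_congr_ae h1, integral_indicator hS]
    have h2 : Integrable (fun z => f z) (volume.restrict S) :=
      ((Lp.memLp f).integrable one_le_two).restrict
    rw [← ofReal_integral_norm_eq_lintegral_enorm h2, Real.enorm_of_nonneg]
    exact integral_nonneg fun z => norm_nonneg _
  -- the fundamental theorem of calculus along the orbit, then an average over `s ∈ (0, δ]`
  have hstep : ∀ s ∈ Ioc 0 δ, ‖inner ℝ f φ‖ₑ ≤ (∫⁻ z in S, ‖f (z + e s)‖ₑ) +
      ∫⁻ r in Ioc 0 δ, ∫⁻ z in S, ‖g (z + e r)‖ₑ := by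
    intro s hs
    have hder : ∀ r ∈ uIcc 0 s, HasDerivAt (fun r => inner ℝ (tshift (e r) f) φ)
        (inner ℝ (tshift (e r) g) φ) r := by
      intro r _
      simpa using HasDerivAt.inner ℝ (h.hasDerivAt r) (hasDerivAt_const r φ)
    have hftc := intervalIntegral.integral_eq_sub_of_hasDerivAt hder
      (((continuous_orbit he g).inner continuous_const).intervalIntegrable 0 s)
    simp only [map_zero, tshift_zero] at hftc
    have h1 : inner ℝ f φ = inner ℝ (tshift (e s) f) φ - ∫ r in 0..s, inner ℝ (tshift (e r) g) φ := by
      rw [hftc]; ring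
    rw [h1]
    refine enorm_sub_le.trans (add_le_add ?_ ?_)
    · refine (enorm_inner_tshift_le _ _ _).trans_eq (hφn _)
    · rw [intervalIntegral.integral_of_le hs.1.le]
      refine (enorm_integral_le_lintegral_enorm _).trans ?_
      refine (lintegral_mono_set (Ioc_subset_Ioc_right hs.2)).trans (lintegral_mono fun r => ?_)
      exact (enorm_inner_tshift_le _ _ _).trans_eq (hφn _)
  have hδ0 : ENNReal.ofReal δ ≠ 0 := (ENNReal.ofReal_pos.2 hδ).ne'
  have hδv : (volume.restrict (Ioc 0 δ)) univ = ENNReal.ofReal δ := by simp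
  have havg : ‖inner ℝ f φ‖ₑ ≤ (ENNReal.ofReal δ)⁻¹ * (∫⁻ s in Ioc 0 δ, ∫⁻ z in S, ‖f (z + e s)‖ₑ) +
      ∫⁻ r in Ioc 0 δ, ∫⁻ z in S, ‖g (z + e r)‖ₑ := by
    have h1 := setLIntegral_mono' (μ := volume) measurableSet_Ioc hstep
    rw [lintegral_const, hδv, lintegral_add_right _ measurable_const, lintegral_const, hδv] at h1
    have h2 := mul_le_mul_right h1 (ENNReal.ofReal δ)⁻¹
    rw [mul_comm (‖inner ℝ f φ‖ₑ), ← mul_assoc, ENNReal.inv_mul_cancel hδ0 (by simp), one_mul,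
      mul_add, mul_comm _ (ENNReal.ofReal δ), ← mul_assoc (ENNReal.ofReal δ)⁻¹ (ENNReal.ofReal δ),
      ENNReal.inv_mul_cancel hδ0 (by simp), one_mul] at h2
    exact h2
  rw [hI]
  refine havg.trans_eq ?_
  have mm : ∀ k : Torus → ℝ, Measurable k → Measurable fun z => ∫⁻ s in Ioc 0 δ, ‖k (z + e s)‖ₑ :=
    fun k hk => (m1 k hk).lintegral_prod_right'
  rw [lintegral_add_left ((mm f hfm).const_mul _), lintegral_const_mul _ (mm f hfm),
    lintegral_lintegral_swap (f := fun z s => ‖f (z + e s)‖ₑ) (m1 f hfm).aemeasurable,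
    lintegral_lintegral_swap (f := fun z s => ‖g (z + e s)‖ₑ) (m1 g hgm).aemeasurable]

end HasOrbitDeriv

theorem lintegral_Ioc_sq_le (L : ℝ) [Fact (0 < L)] {δ : ℝ} (hδ : δ ≤ L) {k : AddCircle L → ℝ}
    (hk : Measurable k) (c : AddCircle L) :
    (∫⁻ s in Ioc 0 δ, ‖k (c + (s : AddCircle L))‖ₑ) ^ 2 ≤
      ENNReal.ofReal δ * ∫⁻ x, ‖k x‖ₑ ^ 2 := by
  have hm : Measurable fun s : ℝ => ‖k (c + (s : AddCircle L))‖ₑ := by fun_prop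
  refine (lintegral_sq_le hm.aemeasurable).trans ?_
  rw [show (volume.restrict (Ioc 0 δ)) univ = ENNReal.ofReal δ by simp]
  refine mul_le_mul_right ?_ _
  calc ∫⁻ s in Ioc 0 δ, ‖k (c + (s : AddCircle L))‖ₑ ^ 2
      ≤ ∫⁻ s in Ioc 0 (0 + L), ‖k (c + (s : AddCircle L))‖ₑ ^ 2 :=
        lintegral_mono_set (Ioc_subset_Ioc_right (by linarith))
    _ = ∫⁻ x, ‖k (c + x)‖ₑ ^ 2 := AddCircle.lintegral_preimage L 0 (fun x => ‖k (c + x)‖ₑ ^ 2)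
    _ = ∫⁻ x, ‖k x‖ₑ ^ 2 := lintegral_add_left_eq_self (fun x => ‖k x‖ₑ ^ 2) c

theorem sq_inv_mul_add_le {d A B SA SB : ENNReal} (hd0 : d ≠ 0) (hd : d ≠ ⊤)
    (hA : A ^ 2 ≤ d * SA) (hB : B ^ 2 ≤ d * SB) :
    (d⁻¹ * A + B) ^ 2 ≤ 2 * (d⁻¹ * SA + d * SB) := by
  refine (ENNReal.add_sq_le_two_mul _ _).trans (mul_le_mul_right (add_le_add ?_ hB) _)
  rw [mul_pow]
  refine (mul_le_mul_right hA _).trans_eq ?_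
  rw [sq, mul_assoc, ← mul_assoc _ d, ENNReal.inv_mul_cancel hd0 hd, one_mul]

theorem HasOrbitDeriv.ae_enorm_sq_le_dirX {f g : L2T} (h : HasOrbitDeriv dirX f g) {δ : ℝ}
    (hδ : 0 < δ) (hδ1 : δ ≤ 1) : ∀ᵐ z : Torus, ‖f z‖ₑ ^ 2 ≤
      2 * ((ENNReal.ofReal δ)⁻¹ * (∫⁻ x, ‖f (x, z.2)‖ₑ ^ 2) +
        ENNReal.ofReal δ * ∫⁻ x, ‖g (x, z.2)‖ₑ ^ 2) := by
  filter_upwards [h.ae_enorm_le continuous_dirX hδ] with z hz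
  refine (pow_le_pow_left₀ zero_le hz 2).trans ?_
  have hm : ∀ f : L2T, Measurable fun x => f (x, z.2) := fun f =>
    (Lp.stronglyMeasurable f).measurable.comp measurable_prodMk_right
  have := fun f : L2T => lintegral_Ioc_sq_le 1 hδ1 (hm f) z.1
  refine sq_inv_mul_add_le (ENNReal.ofReal_pos.2 hδ).ne' (by simp) ?_ ?_
  · simpa [dirX_apply, Prod.add_def] using this f
  · simpa [dirX_apply, Prod.add_def] using this g

theorem HasOrbitDeriv.ae_enorm_sq_le_dirY {f g : L2T} (h : HasOrbitDeriv dirY f g) {δ : ℝ}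
    (hδ : 0 < δ) (hδ1 : δ ≤ 1) : ∀ᵐ z : Torus, ‖f z‖ₑ ^ 2 ≤
      2 * ((ENNReal.ofReal δ)⁻¹ * (∫⁻ y, ‖f (z.1, y)‖ₑ ^ 2) +
        ENNReal.ofReal δ * ∫⁻ y, ‖g (z.1, y)‖ₑ ^ 2) := by
  filter_upwards [h.ae_enorm_le continuous_dirY hδ] with z hz
  refine (pow_le_pow_left₀ zero_le hz 2).trans ?_
  have hm : ∀ f : L2T, Measurable fun y => f (z.1, y) := fun f =>
    (Lp.stronglyMeasurable f).measurable.comp measurable_prodMk_left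
  have := fun f : L2T => lintegral_Ioc_sq_le 2 (hδ1.trans one_le_two) (hm f) z.2
  refine sq_inv_mul_add_le (ENNReal.ofReal_pos.2 hδ).ne' (by simp) ?_ ?_
  · simpa [dirY_apply, Prod.add_def] using this f
  · simpa [dirY_apply, Prod.add_def] using this g

/-- Anisotropic product estimate: if `f` has a `y`-derivative and `h` an `x`-derivative, `f h` is
square integrable. Pointwise, `|f|²` is controlled by a function of `x` alone and `|h|²` by a
function of `y` alone, so the integral of the product of the bounds factors. -/
theorem lintegral_sq_mul_sq_le {f fy h hx : L2T} (hf : HasOrbitDeriv dirY f fy)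
    (hh : HasOrbitDeriv dirX h hx) {δ : ℝ} (hδ : 0 < δ) (hδ1 : δ ≤ 1) :
    ∫⁻ z, ‖f z‖ₑ ^ 2 * ‖h z‖ₑ ^ 2 ≤
      (2 * ((ENNReal.ofReal δ)⁻¹ * ‖f‖ₑ ^ 2 + ENNReal.ofReal δ * ‖fy‖ₑ ^ 2)) *
      (2 * ((ENNReal.ofReal δ)⁻¹ * ‖h‖ₑ ^ 2 + ENNReal.ofReal δ * ‖hx‖ₑ ^ 2)) := by
  have hm : ∀ f : L2T, Measurable fun z : Torus => ‖f z‖ₑ ^ 2 := fun f =>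
    (Lp.stronglyMeasurable f).measurable.enorm.pow_const 2
  have hX : ∀ f : L2T, Measurable fun y => ∫⁻ x, ‖f (x, y)‖ₑ ^ 2 := fun f =>
    (hm f).lintegral_prod_left'
  have hY : ∀ f : L2T, Measurable fun x => ∫⁻ y, ‖f (x, y)‖ₑ ^ 2 := fun f =>
    (hm f).lintegral_prod_right'
  have hIY : ∀ f : L2T, ∫⁻ x, ∫⁻ y, ‖f (x, y)‖ₑ ^ 2 = ‖f‖ₑ ^ 2 := fun f => by
    rw [enorm_sq_eq_lintegral]
    exact (lintegral_prod (μ := volume) (ν := volume) _ (hm f).aemeasurable).symm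
  have hIX : ∀ f : L2T, ∫⁻ y, ∫⁻ x, ‖f (x, y)‖ₑ ^ 2 = ‖f‖ₑ ^ 2 := fun f => by
    rw [enorm_sq_eq_lintegral]
    exact (lintegral_prod_symm (μ := volume) (ν := volume) _ (hm f).aemeasurable).symm
  calc ∫⁻ z, ‖f z‖ₑ ^ 2 * ‖h z‖ₑ ^ 2
      ≤ ∫⁻ z : Torus, (2 * ((ENNReal.ofReal δ)⁻¹ * (∫⁻ y, ‖f (z.1, y)‖ₑ ^ 2) +
          ENNReal.ofReal δ * ∫⁻ y, ‖fy (z.1, y)‖ₑ ^ 2)) *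
        (2 * ((ENNReal.ofReal δ)⁻¹ * (∫⁻ x, ‖h (x, z.2)‖ₑ ^ 2) +
          ENNReal.ofReal δ * ∫⁻ x, ‖hx (x, z.2)‖ₑ ^ 2)) := by
        refine lintegral_mono_ae ?_
        filter_upwards [hf.ae_enorm_sq_le_dirY hδ hδ1, hh.ae_enorm_sq_le_dirX hδ hδ1] with z h1 h2
        exact mul_le_mul' h1 h2
    _ = _ := by
        refine (lintegral_prod_mul (μ := volume) (ν := volume)
          (f := fun a => 2 * ((ENNReal.ofReal δ)⁻¹ * (∫⁻ y, ‖f (a, y)‖ₑ ^ 2) +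
            ENNReal.ofReal δ * ∫⁻ y, ‖fy (a, y)‖ₑ ^ 2))
          (g := fun b => 2 * ((ENNReal.ofReal δ)⁻¹ * (∫⁻ x, ‖h (x, b)‖ₑ ^ 2) +
            ENNReal.ofReal δ * ∫⁻ x, ‖hx (x, b)‖ₑ ^ 2)) ?_ ?_).trans ?_
        · have := hY f; have := hY fy; fun_prop
        · have := hX h; have := hX hx; fun_prop
        · rw [lintegral_const_mul _ (by have := hY f; have := hY fy; fun_prop),
            lintegral_const_mul _ (by have := hX h; have := hX hx; fun_prop),
            lintegral_add_left ((hY f).const_mul _), lintegral_add_left ((hX h).const_mul _),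
            lintegral_const_mul _ (hY f), lintegral_const_mul _ (hY fy),
            lintegral_const_mul _ (hX h), lintegral_const_mul _ (hX hx), hIY, hIY, hIX, hIX]

/-! ### The trilinear form -/

/-- The trilinear form `∫ f g h` on the torus. -/
def tri (f g h : L2T) : ℝ := ∫ z, f z * g z * h z

/-- Integrability of the product `f g h`. -/
def TriInt (f g h : L2T) : Prop := Integrable (fun z => f z * g z * h z) (volume : Measure Torus)

theorem tri_comm₁₂ (f g h : L2T) : tri f g h = tri g f h := by simp only [tri, mul_comm]

theorem tri_comm₂₃ (f g h : L2T) : tri f g h = tri f h g := by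
  simp only [tri, mul_assoc, mul_comm (g _)]

namespace TriInt

variable {f f' g g' h h' : L2T}

theorem comm₁₂ (H : TriInt f g h) : TriInt g f h := by
  simpa only [TriInt, mul_comm] using H

theorem comm₂₃ (H : TriInt f g h) : TriInt f h g := by
  simpa only [TriInt, mul_assoc, mul_comm (g _)] using H

theorem smul₁ (c : ℝ) (H : TriInt f g h) : TriInt (c • f) g h := by
  refine (Integrable.const_mul H c).congr ?_
  filter_upwards [Lp.coeFn_smul c f] with z hz
  simp only [Pi.smul_apply, hz, smul_eq_mul]; ring

theorem neg₁ (H : TriInt f g h) : TriInt (-f) g h := by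
  simpa using H.smul₁ (-1)

end TriInt

section linear

variable {f f' g g' h h' : L2T}

theorem tri_add₁ (H : TriInt f g h) (H' : TriInt f' g h) :
    tri (f + f') g h = tri f g h + tri f' g h := by
  rw [tri, tri, tri, ← integral_add H H']
  refine integral_congr_ae ?_
  filter_upwards [Lp.coeFn_add f f'] with z hz
  simp only [hz, Pi.add_apply]; ring

theorem tri_smul₁ (c : ℝ) : tri (c • f) g h = c * tri f g h := by
  rw [tri, tri, ← integral_const_mul]
  refine integral_congr_ae ?_
  filter_upwards [Lp.coeFn_smul c f] with z hz
  simp only [hz, Pi.smul_apply, smul_eq_mul]; ring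

theorem tri_neg₁ : tri (-f) g h = - tri f g h := by
  simpa using tri_smul₁ (f := f) (g := g) (h := h) (-1)

theorem tri_sub₁ (H : TriInt f g h) (H' : TriInt f' g h) :
    tri (f - f') g h = tri f g h - tri f' g h := by
  rw [sub_eq_add_neg, tri_add₁ H H'.neg₁, tri_neg₁, sub_eq_add_neg]

theorem tri_add₂ (H : TriInt f g h) (H' : TriInt f g' h) :
    tri f (g + g') h = tri f g h + tri f g' h := by
  rw [tri_comm₁₂, tri_add₁ H.comm₁₂ H'.comm₁₂, tri_comm₁₂, tri_comm₁₂ g']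

theorem tri_sub₂ (H : TriInt f g h) (H' : TriInt f g' h) :
    tri f (g - g') h = tri f g h - tri f g' h := by
  rw [tri_comm₁₂, tri_sub₁ H.comm₁₂ H'.comm₁₂, tri_comm₁₂, tri_comm₁₂ g']

theorem tri_smul₂ (c : ℝ) : tri f (c • g) h = c * tri f g h := by
  rw [tri_comm₁₂, tri_smul₁, tri_comm₁₂]

theorem tri_neg₂ : tri f (-g) h = - tri f g h := by
  rw [tri_comm₁₂, tri_neg₁, tri_comm₁₂]

theorem tri_add₃ (H : TriInt f g h) (H' : TriInt f g h') :
    tri f g (h + h') = tri f g h + tri f g h' := by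
  rw [tri_comm₂₃, tri_add₂ H.comm₂₃ H'.comm₂₃, tri_comm₂₃, tri_comm₂₃ f h']

theorem tri_sub₃ (H : TriInt f g h) (H' : TriInt f g h') :
    tri f g (h - h') = tri f g h - tri f g h' := by
  rw [tri_comm₂₃, tri_sub₂ H.comm₂₃ H'.comm₂₃, tri_comm₂₃, tri_comm₂₃ f h']

theorem tri_smul₃ (c : ℝ) : tri f g (c • h) = c * tri f g h := by
  rw [tri_comm₂₃, tri_smul₂, tri_comm₂₃]

theorem tri_neg₃ : tri f g (-h) = - tri f g h := by
  rw [tri_comm₂₃, tri_neg₂, tri_comm₂₃]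

end linear

theorem tri_tshift (a : Torus) (f g h : L2T) :
    tri (tshift a f) (tshift a g) (tshift a h) = tri f g h := by
  rw [tri, tri, ← integral_add_right_eq_self (fun z => f z * g z * h z) a]
  refine integral_congr_ae ?_
  filter_upwards [tshift_ae a f, tshift_ae a g, tshift_ae a h] with z h1 h2 h3
  rw [h1, h2, h3]

section estimate

variable {f fy g h hx : L2T}

theorem memLp_mul_of_hasOrbitDeriv (hf : HasOrbitDeriv dirY f fy) (hh : HasOrbitDeriv dirX h hx) :
    MemLp (fun z => f z * h z) 2 volume := by
  refine ⟨((Lp.stronglyMeasurable f).mul (Lp.stronglyMeasurable h)).aestronglyMeasurable, ?_⟩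
  rw [eLpNorm_lt_top_iff_lintegral_rpow_enorm_lt_top two_ne_zero (by simp)]
  simp only [ENNReal.toReal_ofNat, ENNReal.rpow_ofNat, enorm_mul, mul_pow]
  refine (lintegral_sq_mul_sq_le hf hh one_pos le_rfl).trans_lt ?_
  simp [ENNReal.mul_lt_top_iff]

theorem triInt_of_hasOrbitDeriv (hf : HasOrbitDeriv dirY f fy) (g : L2T)
    (hh : HasOrbitDeriv dirX h hx) : TriInt f g h := by
  have := (memLp_mul_of_hasOrbitDeriv hf hh).integrable_mul (Lp.memLp g)
  refine this.congr (Eventually.of_forall fun z => ?_)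
  simp only [Pi.mul_apply]; ring

/-- The product of a function with a `y`-derivative and a function with an `x`-derivative is square
integrable; `δ` balances the functions against their derivatives. -/
theorem sq_tri_le (hf : HasOrbitDeriv dirY f fy) (g : L2T) (hh : HasOrbitDeriv dirX h hx)
    {δ : ℝ} (hδ : 0 < δ) (hδ1 : δ ≤ 1) :
    (tri f g h) ^ 2 ≤ (2 * (δ⁻¹ * ‖f‖ ^ 2 + δ * ‖fy‖ ^ 2)) *
      (2 * (δ⁻¹ * ‖h‖ ^ 2 + δ * ‖hx‖ ^ 2)) * ‖g‖ ^ 2 := by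
  set p : L2T := (memLp_mul_of_hasOrbitDeriv hf hh).toLp _
  have hp : p =ᵐ[volume] fun z => f z * h z := (memLp_mul_of_hasOrbitDeriv hf hh).coeFn_toLp
  have h1 : tri f g h = inner ℝ p g := by
    rw [tri, real_inner_eq_integral_mul]
    refine integral_congr_ae ?_
    filter_upwards [hp] with z hz
    rw [hz]; ring
  have h2 : ‖p‖ₑ ^ 2 ≤ (2 * ((ENNReal.ofReal δ)⁻¹ * ‖f‖ₑ ^ 2 + ENNReal.ofReal δ * ‖fy‖ₑ ^ 2)) *
      (2 * ((ENNReal.ofReal δ)⁻¹ * ‖h‖ₑ ^ 2 + ENNReal.ofReal δ * ‖hx‖ₑ ^ 2)) := by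
    rw [enorm_sq_eq_lintegral]
    refine le_trans (le_of_eq ?_) (lintegral_sq_mul_sq_le hf hh hδ hδ1)
    refine lintegral_congr_ae ?_
    filter_upwards [hp] with z hz
    rw [hz, enorm_mul, mul_pow]
  have h3 : ∀ k k' : L2T, 2 * ((ENNReal.ofReal δ)⁻¹ * ‖k‖ₑ ^ 2 + ENNReal.ofReal δ * ‖k'‖ₑ ^ 2) =
      ENNReal.ofReal (2 * (δ⁻¹ * ‖k‖ ^ 2 + δ * ‖k'‖ ^ 2)) := by
    intro k k'
    rw [ENNReal.ofReal_mul zero_le_two, ENNReal.ofReal_add (by positivity) (by positivity),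
      ENNReal.ofReal_mul (by positivity), ENNReal.ofReal_mul (by positivity),
      ENNReal.ofReal_inv_of_pos hδ, ENNReal.ofReal_pow (norm_nonneg _),
      ENNReal.ofReal_pow (norm_nonneg _), ofReal_norm, ofReal_norm, ENNReal.ofReal_ofNat]
  rw [h3, h3, ← ENNReal.ofReal_mul (by positivity), ← ofReal_norm, ← ENNReal.ofReal_pow
    (norm_nonneg _), ENNReal.ofReal_le_ofReal_iff (by positivity)] at h2
  rw [h1]
  calc (inner ℝ p g) ^ 2 ≤ (‖p‖ * ‖g‖) ^ 2 := by
        rw [sq_le_sq, abs_of_nonneg (by positivity : 0 ≤ ‖p‖ * ‖g‖)]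
        exact abs_real_inner_le_norm p g
    _ = ‖p‖ ^ 2 * ‖g‖ ^ 2 := mul_pow _ _ _
    _ ≤ _ := mul_le_mul_of_nonneg_right h2 (by positivity)

theorem abs_tri_le (hf : HasOrbitDeriv dirY f fy) (g : L2T) (hh : HasOrbitDeriv dirX h hx) :
    |tri f g h| ≤ 2 * (‖f‖ + ‖fy‖) * ‖g‖ * (‖h‖ + ‖hx‖) := by
  refine abs_le_of_sq_le_sq ?_ (by positivity)
  refine (sq_tri_le hf g hh one_pos le_rfl).trans ?_
  have e : (2 * (‖f‖ + ‖fy‖) * ‖g‖ * (‖h‖ + ‖hx‖)) ^ 2 =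
      (2 * (‖f‖ + ‖fy‖) ^ 2) * (2 * (‖h‖ + ‖hx‖) ^ 2) * ‖g‖ ^ 2 := by ring
  rw [e]
  have k1 : 0 ≤ ‖f‖ * ‖fy‖ := by positivity
  have k2 : 0 ≤ ‖h‖ * ‖hx‖ := by positivity
  gcongr <;> nlinarith

/-- Anisotropic Ladyzhenskaya inequality with a free scale `δ`. -/
theorem abs_tri_le_scale (hf : HasOrbitDeriv dirY f fy) (g : L2T) (hh : HasOrbitDeriv dirX h hx)
    {δ : ℝ} (hδ : 0 < δ) (hδ1 : δ ≤ 1) :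
    |tri f g h| ≤ ‖g‖ * ((δ⁻¹ * ‖f‖ ^ 2 + δ * ‖fy‖ ^ 2) + (δ⁻¹ * ‖h‖ ^ 2 + δ * ‖hx‖ ^ 2)) := by
  refine abs_le_of_sq_le_sq ?_ (by positivity)
  refine (sq_tri_le hf g hh hδ hδ1).trans ?_
  rw [mul_pow, mul_comm]
  refine mul_le_mul_of_nonneg_left ?_ (by positivity)
  nlinarith [sq_nonneg ((δ⁻¹ * ‖f‖ ^ 2 + δ * ‖fy‖ ^ 2) - (δ⁻¹ * ‖h‖ ^ 2 + δ * ‖hx‖ ^ 2))]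

/-- The trilinear form is continuous along strong convergence of the factors and of the two
derivatives that `abs_tri_le` uses. -/
theorem tendsto_tri {ι : Type*} {l : Filter ι} {F Fy G K Kx : ι → L2T}
    (hF : ∀ i, HasOrbitDeriv dirY (F i) (Fy i)) (hK : ∀ i, HasOrbitDeriv dirX (K i) (Kx i))
    (hf : HasOrbitDeriv dirY f fy) (hh : HasOrbitDeriv dirX h hx)
    (lF : Tendsto F l (𝓝 f)) (lFy : Tendsto Fy l (𝓝 fy)) (lG : Tendsto G l (𝓝 g))
    (lK : Tendsto K l (𝓝 h)) (lKx : Tendsto Kx l (𝓝 hx)) :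
    Tendsto (fun i => tri (F i) (G i) (K i)) l (𝓝 (tri f g h)) := by
  rw [tendsto_iff_norm_sub_tendsto_zero]
  refine squeeze_zero (fun i => norm_nonneg _) (fun i => ?_) (g := fun i =>
    2 * (‖F i - f‖ + ‖Fy i - fy‖) * ‖G i‖ * (‖K i‖ + ‖Kx i‖) +
    2 * (‖f‖ + ‖fy‖) * ‖G i - g‖ * (‖K i‖ + ‖Kx i‖) +
    2 * (‖f‖ + ‖fy‖) * ‖g‖ * (‖K i - h‖ + ‖Kx i - hx‖)) ?_
  · have e : tri (F i) (G i) (K i) - tri f g h = tri (F i - f) (G i) (K i) +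
        tri f (G i - g) (K i) + tri f g (K i - h) := by
      have t1 := fun g => triInt_of_hasOrbitDeriv (hF i) g (hK i)
      have t2 := fun g => triInt_of_hasOrbitDeriv hf g (hK i)
      have t3 := fun g => triInt_of_hasOrbitDeriv hf g hh
      rw [tri_sub₁ (t1 _) (t2 _), tri_sub₂ (t2 _) (t2 _), tri_sub₃ (t2 _) (t3 _)]
      ring
    rw [e]
    refine (norm_add_le _ _).trans (add_le_add ((norm_add_le _ _).trans (add_le_add ?_ ?_)) ?_)
    · exact abs_tri_le ((hF i).sub hf) _ (hK i)
    · exact abs_tri_le hf _ (hK i)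
    · exact abs_tri_le hf _ ((hK i).sub hh)
  · have a1 := (tendsto_iff_norm_sub_tendsto_zero.1 lF)
    have a2 := (tendsto_iff_norm_sub_tendsto_zero.1 lFy)
    have a3 := (tendsto_iff_norm_sub_tendsto_zero.1 lG)
    have a4 := (tendsto_iff_norm_sub_tendsto_zero.1 lK)
    have a5 := (tendsto_iff_norm_sub_tendsto_zero.1 lKx)
    have := ((((a1.add a2).const_mul 2).mul lG.norm).mul (lK.norm.add lKx.norm)).add
      (((a3.const_mul (2 * (‖f‖ + ‖fy‖))).mul (lK.norm.add lKx.norm)))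
    have := this.add ((a4.add a5).const_mul (2 * (‖f‖ + ‖fy‖) * ‖g‖))
    simpa using this

end estimate

/-- Both partial derivatives of an `L²` function on the torus. -/
structure HasGrad (f fx fy : L2T) : Prop where
  dx : HasOrbitDeriv dirX f fx
  dy : HasOrbitDeriv dirY f fy

/-- Leibniz rule: the integral of a derivative of a product of three functions vanishes. -/
theorem tri_leibniz {e : ℝ →+ Torus} (he : Continuous e) {f fx fy g gx gy h hx hy f' g' h' : L2T}
    (hf : HasGrad f fx fy) (hg : HasGrad g gx gy) (hh : HasGrad h hx hy)
    (hf' : HasOrbitDeriv e f f') (hg' : HasOrbitDeriv e g g') (hh' : HasOrbitDeriv e h h') :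
    tri f' g h + tri f g' h + tri f g h' = 0 := by
  have htr : ∀ k : L2T, Tendsto (fun s => tshift (e s) k) (𝓝[≠] 0) (𝓝 k) := by
    intro k
    have := ((continuous_tshift k).comp he).tendsto 0
    simp only [Function.comp_apply, map_zero, tshift_zero] at this
    exact this.mono_left nhdsWithin_le_nhds
  -- the difference quotient of the translation-invariant integral `∫ f g h`, one factor at a time;
  -- the factor in the middle slot of `tri` carries the quotient, as it needs no derivative
  have c1 := tendsto_tri (fun s => hg.dy.comp_tshift (e s)) (fun s => hh.dx.comp_tshift (e s))
    hg.dy hh.dx (htr _) (htr _) hf'.tendsto_diffQuot (htr _) (htr _)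
  have c2 := tendsto_tri (fun s => hf.dy) (fun s => hh.dx.comp_tshift (e s))
    hf.dy hh.dx tendsto_const_nhds tendsto_const_nhds hg'.tendsto_diffQuot (htr _) (htr _)
  have c3 := tendsto_tri (fun s => hf.dy) (fun s => hg.dx)
    hf.dy hg.dx tendsto_const_nhds tendsto_const_nhds hh'.tendsto_diffQuot tendsto_const_nhds
      tendsto_const_nhds
  have hsum := (c1.add c2).add c3
  rw [tri_comm₁₂ g f' h, tri_comm₂₃ f h' g] at hsum
  refine tendsto_nhds_unique hsum (tendsto_const_nhds.congr fun s => ?_)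
  have t1 := triInt_of_hasOrbitDeriv (hg.dy.comp_tshift (e s)) (tshift (e s) f)
    (hh.dx.comp_tshift (e s))
  have t2 := triInt_of_hasOrbitDeriv (hg.dy.comp_tshift (e s)) f (hh.dx.comp_tshift (e s))
  have t4 := triInt_of_hasOrbitDeriv hf.dy g (hh.dx.comp_tshift (e s))
  have t5 := triInt_of_hasOrbitDeriv hf.dy (tshift (e s) h) hg.dx
  have t6 := triInt_of_hasOrbitDeriv hf.dy h hg.dx
  rw [tri_smul₂, tri_smul₂, tri_smul₂, tri_sub₂ t1 t2, tri_sub₂ t2.comm₁₂ t4, tri_sub₂ t5 t6,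
    tri_comm₁₂ _ (tshift (e s) f), tri_tshift, tri_comm₁₂ _ f, tri_comm₂₃ f (tshift (e s) h) g,
    tri_comm₂₃ f h g]
  ring

/-- Truncation of a real number to `[-n, n]`. -/
def clamp (n : ℕ) (x : ℝ) : ℝ := max (-n) (min n x)

theorem abs_clamp_le (n : ℕ) (x : ℝ) : |clamp n x| ≤ n :=
  abs_le.2 ⟨le_max_left _ _, max_le (by simp) (min_le_left _ _)⟩

theorem abs_clamp_le_abs (n : ℕ) (x : ℝ) : |clamp n x| ≤ |x| := by
  have hn : (0 : ℝ) ≤ n := n.cast_nonneg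
  rw [clamp, abs_le]
  constructor
  · rcases le_total (n : ℝ) x with h | h
    · rw [min_eq_left h]; exact (neg_nonpos.2 (abs_nonneg x)).trans (hn.trans (le_max_right _ _))
    · rw [min_eq_right h]; exact (neg_abs_le x).trans (le_max_right _ _)
  · exact max_le ((neg_nonpos.2 hn).trans (abs_nonneg x)) ((min_le_right _ _).trans (le_abs_self x))

theorem abs_clamp_sub_le (n : ℕ) (x y : ℝ) : |clamp n x - clamp n y| ≤ |x - y| := by
  have h1 := abs_max_sub_max_le_abs (min (n : ℝ) x) (min (n : ℝ) y) (-n)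
  have h2 := abs_min_sub_min_le_max (n : ℝ) x n y
  simp only [sub_self, abs_zero, abs_nonneg, max_eq_right] at h2
  rw [clamp, clamp, max_comm, max_comm (-(n : ℝ))]
  exact h1.trans h2

theorem tendsto_clamp (x : ℝ) : Tendsto (fun n => clamp n x) atTop (𝓝 x) := by
  obtain ⟨N, hN⟩ := exists_nat_ge |x|
  refine tendsto_const_nhds.congr' ?_
  filter_upwards [eventually_ge_atTop N] with n hn
  have h : |x| ≤ n := hN.trans (by exact_mod_cast hn)
  rw [abs_le] at h
  rw [clamp, min_eq_right h.2, max_eq_right h.1]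

theorem measurable_clamp (n : ℕ) : Measurable (clamp n) := by
  unfold clamp; fun_prop

/-- The truncated trilinear form is continuous on `L² × L² × L²` without any derivatives; it serves
to prove measurability. -/
theorem continuous_integral_clamp (n : ℕ) : Continuous fun p : L2T × L2T × L2T =>
    ∫ z, clamp n (p.1 z) * clamp n (p.2.1 z) * clamp n (p.2.2 z) := by
  have hint : ∀ a b c : L2T, Integrable (fun z => clamp n (a z) * clamp n (b z) * clamp n (c z))
      (volume : Measure Torus) := by
    intro a b c
    have hm := fun a : L2T => (measurable_clamp n).comp (Lp.stronglyMeasurable a).measurable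
    refine Integrable.of_bound (C := n * n * n)
      (((hm a).mul (hm b)).mul (hm c)).aestronglyMeasurable (Eventually.of_forall fun z => ?_)
    rw [norm_mul, norm_mul]
    have := fun x => abs_clamp_le n x
    simp only [Real.norm_eq_abs]
    gcongr <;> exact this _
  set o : L2T := (memLp_const (1 : ℝ)).toLp (fun _ => (1 : ℝ))
  have hnorm : ∀ a : L2T, ∫ z, |a z| ≤ ‖a‖ * ‖o‖ := by
    intro a
    have h1 : ∫ z, |a z| = inner ℝ |a| o := by
      rw [real_inner_eq_integral_mul]
      refine integral_congr_ae ?_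
      filter_upwards [Lp.coeFn_abs a, (memLp_const (1 : ℝ)).coeFn_toLp (μ := (volume : Measure Torus)) (p := 2)]
        with z h1 h2
      rw [h1, h2, mul_one]
    rw [h1, ← norm_abs_eq_norm a]
    exact real_inner_le_norm _ _
  have habs : ∀ a a' : L2T, Integrable (fun z => |a z - a' z|) (volume : Measure Torus) :=
    fun a a' => (((Lp.memLp a).sub (Lp.memLp a')).integrable one_le_two).abs
  have habs2 : ∀ a a' : L2T, ∫ z, |a z - a' z| ≤ ‖a - a'‖ * ‖o‖ := by
    intro a a'
    refine le_trans (le_of_eq ?_) (hnorm (a - a'))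
    refine integral_congr_ae ?_
    filter_upwards [Lp.coeFn_sub a a'] with z hz
    rw [hz, Pi.sub_apply]
  rw [continuous_iff_continuousAt]
  rintro ⟨a, b, c⟩
  rw [ContinuousAt, tendsto_iff_norm_sub_tendsto_zero]
  refine squeeze_zero (fun p => norm_nonneg _) (fun p => ?_) (g := fun p : L2T × L2T × L2T =>
    n * n * (‖p.1 - a‖ * ‖o‖ + ‖p.2.1 - b‖ * ‖o‖ + ‖p.2.2 - c‖ * ‖o‖)) ?_
  · rw [← integral_sub (hint _ _ _) (hint _ _ _)]
    refine (norm_integral_le_integral_norm _).trans ?_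
    have hi := ((habs p.1 a).add (habs p.2.1 b)).add (habs p.2.2 c)
    refine (integral_mono (((hint _ _ _).sub (hint _ _ _)).norm) (hi.const_mul (n * n))
      (fun z => ?_)).trans ?_
    · simp only [Pi.sub_apply, Pi.add_apply, Real.norm_eq_abs]
      set x := clamp n (p.1 z); set x' := clamp n (a z)
      set y := clamp n (p.2.1 z); set y' := clamp n (b z)
      set w := clamp n (p.2.2 z); set w' := clamp n (c z)
      have e : x * y * w - x' * y' * w' = (x - x') * (y * w) + (x' * w) * (y - y') +
        (x' * y') * (w - w') := by ring
      have hn : (0 : ℝ) ≤ n := n.cast_nonneg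
      have k := fun x => abs_clamp_le n x
      have b1 : |(x - x') * (y * w)| ≤ |p.1 z - a z| * (n * n) := by
        rw [abs_mul, abs_mul]
        exact mul_le_mul (abs_clamp_sub_le _ _ _) (mul_le_mul (k _) (k _) (abs_nonneg _) hn)
          (by positivity) (abs_nonneg _)
      have b2 : |(x' * w) * (y - y')| ≤ (n * n) * |p.2.1 z - b z| := by
        rw [abs_mul, abs_mul]
        exact mul_le_mul (mul_le_mul (k _) (k _) (abs_nonneg _) hn) (abs_clamp_sub_le _ _ _)
          (abs_nonneg _) (by positivity)
      have b3 : |(x' * y') * (w - w')| ≤ (n * n) * |p.2.2 z - c z| := by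
        rw [abs_mul, abs_mul]
        exact mul_le_mul (mul_le_mul (k _) (k _) (abs_nonneg _) hn) (abs_clamp_sub_le _ _ _)
          (abs_nonneg _) (by positivity)
      rw [e]
      refine (abs_add_three _ _ _).trans ?_
      linarith
    · rw [integral_const_mul, integral_add' ((habs p.1 a).add (habs p.2.1 b)) (habs p.2.2 c),
        integral_add' (habs p.1 a) (habs p.2.1 b)]
      gcongr <;> exact habs2 _ _
  · have : Continuous fun p : L2T × L2T × L2T =>
      (n : ℝ) * n * (‖p.1 - a‖ * ‖o‖ + ‖p.2.1 - b‖ * ‖o‖ + ‖p.2.2 - c‖ * ‖o‖) := by fun_prop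
    have := this.tendsto (a, b, c)
    simpa using this

/-- The trilinear form of measurable curves is measurable in time: it is the pointwise limit of its
truncations, which are continuous in the three arguments. -/
theorem aestronglyMeasurable_tri {μ : Measure ℝ} {a b c : ℝ → L2T} (ha : AEStronglyMeasurable a μ)
    (hb : AEStronglyMeasurable b μ) (hc : AEStronglyMeasurable c μ)
    (h : ∀ᵐ s ∂μ, TriInt (a s) (b s) (c s)) :
    AEStronglyMeasurable (fun s => tri (a s) (b s) (c s)) μ := by
  refine aestronglyMeasurable_of_tendsto_ae atTop (f := fun n s =>
    ∫ z, clamp n (a s z) * clamp n (b s z) * clamp n (c s z)) (fun n => ?_) ?_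
  · exact (continuous_integral_clamp n).comp_aestronglyMeasurable (ha.prodMk (hb.prodMk hc))
  · filter_upwards [h] with s hs
    refine tendsto_integral_of_dominated_convergence (fun z => ‖a s z * b s z * c s z‖)
      (fun n => ?_) hs.norm (fun n => ?_) ?_
    · have hm := fun a : L2T => (measurable_clamp n).comp (Lp.stronglyMeasurable a).measurable
      exact (((hm (a s)).mul (hm (b s))).mul (hm (c s))).aestronglyMeasurable
    · refine Eventually.of_forall fun z => ?_
      simp only [norm_mul, Real.norm_eq_abs]
      have k := fun x => abs_clamp_le_abs n x
      exact mul_le_mul (mul_le_mul (k _) (k _) (abs_nonneg _) (abs_nonneg _)) (k _) (abs_nonneg _)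
        (by positivity)
    · refine Eventually.of_forall fun z => ?_
      exact ((tendsto_clamp _).mul (tendsto_clamp _)).mul (tendsto_clamp _)

/-! ### The horizontal mean on the torus -/

theorem dirX_add_one (s : ℝ) : dirX (s + 1) = dirX s := by
  simp [dirX_apply]

/-- The horizontal mean, as the average of the horizontal translates. -/
def meanX (f : L2T) : L2T := ∫ s in (0 : ℝ)..1, tshift (dirX s) f

theorem continuous_tshift_dirX (f : L2T) : Continuous fun s => tshift (dirX s) f :=
  HasOrbitDeriv.continuous_orbit continuous_dirX f

theorem tshift_dirX_meanX (r : ℝ) (f : L2T) : tshift (dirX r) (meanX f) = meanX f := by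
  have hp : Function.Periodic (fun s => tshift (dirX s) f) 1 := fun s => by
    simp only [dirX_add_one]
  have h1 := ((tshift (dirX r)).toContinuousLinearMap).intervalIntegral_comp_comm
    ((continuous_tshift_dirX f).intervalIntegrable (μ := volume) 0 1)
  rw [LinearIsometry.coe_toContinuousLinearMap] at h1
  rw [meanX, ← h1]
  have h2 : ∀ s, tshift (dirX r) (tshift (dirX s) f) = tshift (dirX (s + r)) f := fun s => by
    rw [tshift_tshift, ← map_add, add_comm]
  simp only [h2]
  rw [intervalIntegral.integral_comp_add_right (fun s => tshift (dirX s) f)]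
  have := hp.intervalIntegral_add_eq r 0
  simpa [add_comm] using this

theorem norm_meanX_le (f : L2T) : ‖meanX f‖ ≤ ‖f‖ := by
  have := intervalIntegral.norm_integral_le_of_norm_le_const (a := 0) (b := 1) (C := ‖f‖)
    (f := fun s => tshift (dirX s) f) (fun s _ => by simp)
  simpa [meanX] using this

/-- `meanX` as a bounded operator. -/
def meanXL : L2T →L[ℝ] L2T :=
  LinearMap.mkContinuous
    { toFun := meanX
      map_add' := fun f g => by
        simp only [meanX, map_add]
        exact intervalIntegral.integral_add ((continuous_tshift_dirX f).intervalIntegrable 0 1)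
          ((continuous_tshift_dirX g).intervalIntegrable 0 1)
      map_smul' := fun c f => by
        simp only [meanX, map_smul, RingHom.id_apply]
        exact intervalIntegral.integral_smul c _ } 1 (fun f => by simpa using norm_meanX_le f)

theorem meanX_sub (f g : L2T) : meanX (f - g) = meanX f - meanX g := meanXL.map_sub f g

theorem continuous_meanX : Continuous meanX := meanXL.continuous

theorem meanX_tshift (a : Torus) (f : L2T) : meanX (tshift a f) = tshift a (meanX f) := by
  have h1 := ((tshift a).toContinuousLinearMap).intervalIntegral_comp_comm
    ((continuous_tshift_dirX f).intervalIntegrable (μ := volume) 0 1)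
  rw [LinearIsometry.coe_toContinuousLinearMap] at h1
  simp only [meanX, ← h1, tshift_tshift, add_comm]

theorem HasOrbitDeriv.meanX {e : ℝ →+ Torus} {f g : L2T} (h : HasOrbitDeriv e f g) :
    HasOrbitDeriv e (meanX f) (meanX g) :=
  h.map_of_commute meanXL fun s f => meanX_tshift (e s) f

theorem hasOrbitDeriv_of_invariant {f : L2T} (h : ∀ r, tshift (dirX r) f = f) :
    HasOrbitDeriv dirX f 0 := by
  simpa [HasOrbitDeriv, h] using hasDerivAt_const (0 : ℝ) f

theorem hasOrbitDeriv_dirX_meanX (f : L2T) : HasOrbitDeriv dirX (meanX f) 0 :=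
  hasOrbitDeriv_of_invariant fun r => tshift_dirX_meanX r f

/-- Poincaré inequality in `x`. -/
theorem norm_sub_meanX_le {f g : L2T} (h : HasOrbitDeriv dirX f g) : ‖f - meanX f‖ ≤ ‖g‖ := by
  have h1 : meanX f - f = ∫ s in (0 : ℝ)..1, (tshift (dirX s) f - f) := by
    rw [intervalIntegral.integral_sub ((continuous_tshift_dirX f).intervalIntegrable 0 1)
      (by simp)]
    simp [meanX]
  rw [norm_sub_rev, h1]
  have := intervalIntegral.norm_integral_le_of_norm_le_const (a := 0) (b := 1) (C := ‖g‖)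
    (f := fun s => tshift (dirX s) f - f) (fun s hs => by
      refine (h.norm_tshift_sub_le s).trans ?_
      rw [uIoc_of_le zero_le_one] at hs
      rw [abs_of_pos hs.1]
      exact mul_le_of_le_one_left (norm_nonneg _) hs.2)
  simpa using this

theorem inner_meanX_left {f g : L2T} (hf : ∀ r, tshift (dirX r) f = f) :
    inner ℝ f (meanX g) = inner ℝ f g := by
  have h1 := (innerSL ℝ f : L2T →L[ℝ] ℝ).intervalIntegral_comp_comm
    ((continuous_tshift_dirX g).intervalIntegrable (μ := volume) 0 1)
  simp only [innerSL_apply_apply] at h1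
  rw [meanX, ← h1]
  have : ∀ s, inner ℝ f (tshift (dirX s) g) = inner ℝ f g := fun s => by
    conv_lhs => rw [← hf s]
    exact (tshift (dirX s)).inner_map_map f g
  simp [this]

/-- The mean and the oscillation are orthogonal. -/
theorem norm_sq_eq_meanX_add (f : L2T) : ‖f‖ ^ 2 = ‖meanX f‖ ^ 2 + ‖f - meanX f‖ ^ 2 := by
  have h := inner_meanX_left (g := f) (fun r => tshift_dirX_meanX r f)
  rw [real_inner_self_eq_norm_sq] at h
  have h2 := norm_sub_sq_real f (meanX f)
  rw [real_inner_comm] at h2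
  linarith

/-- The average of the translates is the fibre integral. -/
theorem meanX_ae (f : L2T) : meanX f =ᵐ[volume] fun z => ∫ x : AddCircle (1 : ℝ), f (x, z.2) := by
  have hfm := (Lp.stronglyMeasurable f).measurable
  have hfi : Integrable f (volume : Measure Torus) := (Lp.memLp f).integrable one_le_two
  have hmi : Integrable (fun z : Torus => ∫ x : AddCircle (1 : ℝ), f (x, z.2)) volume := by
    have h1 : Integrable (fun y => ∫ x : AddCircle (1 : ℝ), f (x, y)) volume :=
      Integrable.integral_prod_right (μ := volume) (ν := volume) hfi
    exact h1.comp_snd volume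
  refine Integrable.ae_eq_of_forall_setIntegral_eq _ _ ((Lp.memLp _).integrable one_le_two) hmi ?_
  intro S hS _
  have hmem : MemLp (S.indicator fun _ => (1 : ℝ)) 2 (volume : Measure Torus) :=
    (memLp_const 1).indicator hS
  set φ : L2T := hmem.toLp _
  have hφ : ∀ g : L2T, inner ℝ φ g = ∫ z in S, g z := by
    intro g
    rw [real_inner_eq_integral_mul, ← integral_indicator hS]
    refine integral_congr_ae ?_
    filter_upwards [hmem.coeFn_toLp] with z hz
    rw [hz]
    by_cases hzS : z ∈ S <;> simp [hzS]
  have h1 := (innerSL ℝ φ : L2T →L[ℝ] ℝ).intervalIntegral_comp_comm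
    ((continuous_tshift_dirX f).intervalIntegrable (μ := volume) 0 1)
  simp only [innerSL_apply_apply, hφ] at h1
  rw [meanX, ← h1]
  have h2 : ∀ s : ℝ, ∫ z in S, tshift (dirX s) f z = ∫ z in S, f (z + dirX s) := fun s =>
    integral_congr_ae (ae_restrict_of_ae (tshift_ae _ _))
  simp only [h2]
  rw [intervalIntegral.integral_of_le zero_le_one, integral_integral_swap]
  · refine integral_congr_ae (Eventually.of_forall fun z => ?_)
    have h3 := AddCircle.integral_preimage 1 0 (fun x => f (z.1 + x, z.2))
    rw [integral_add_left_eq_self (fun x => f (x, z.2)) z.1, zero_add] at h3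
    simpa [dirX_apply, Prod.add_def] using h3
  · have hm : Measurable fun p : ℝ × Torus => f (p.2 + dirX p.1) := by
      have := continuous_dirX.measurable
      fun_prop
    have hK : ∀ s : ℝ, ∫⁻ z in S, ‖f (z + dirX s)‖ₑ ≤ ∫⁻ z, ‖f z‖ₑ := fun s =>
      (setLIntegral_le_lintegral _ _).trans_eq
        (lintegral_add_right_eq_self (fun z => ‖f z‖ₑ) (dirX s))
    refine ⟨hm.aestronglyMeasurable, ?_⟩
    rw [hasFiniteIntegral_iff_enorm]
    refine (lintegral_prod _ hm.enorm.aemeasurable).trans_lt ?_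
    refine (lintegral_mono fun s => hK s).trans_lt ?_
    rw [lintegral_const]
    exact ENNReal.mul_lt_top hfi.2 (by simp)

theorem integral_fibre_eq_zero_of_meanX_eq_zero {f : L2T} (h : meanX f = 0) :
    ∀ᵐ y : AddCircle (2 : ℝ), ∫ x : AddCircle (1 : ℝ), f (x, y) = 0 := by
  have h1 : ∀ᵐ z : Torus, ∫ x : AddCircle (1 : ℝ), f (x, z.2) = 0 := by
    have h0 : meanX f =ᵐ[volume] 0 := by rw [h]; exact Lp.coeFn_zero _ _ _
    filter_upwards [meanX_ae f, h0] with z h1 h2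
    rw [← h1, h2]; rfl
  have h2 := Measure.ae_ae_of_ae_prod (μ := volume) (ν := volume) h1
  exact h2.exists.choose_spec

/-- A function without horizontal mean is orthogonal to products of functions of `y` alone. -/
theorem tri_meanX_meanX_eq_zero {f g h : L2T} (hf : meanX f = 0)
    (hi : TriInt f (meanX g) (meanX h)) : tri f (meanX g) (meanX h) = 0 := by
  set G : AddCircle (2 : ℝ) → ℝ := fun y => ∫ x : AddCircle (1 : ℝ), g (x, y)
  set K : AddCircle (2 : ℝ) → ℝ := fun y => ∫ x : AddCircle (1 : ℝ), h (x, y)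
  have h1 : (fun z => f z * meanX g z * meanX h z) =ᵐ[volume]
      fun z : Torus => f z * G z.2 * K z.2 := by
    filter_upwards [meanX_ae g, meanX_ae h] with z h1 h2
    rw [h1, h2]
  have hi' : Integrable (fun z : Torus => f z * G z.2 * K z.2) (volume.prod volume) :=
    Integrable.congr hi h1
  rw [tri, integral_congr_ae h1]
  refine (integral_prod_symm (μ := volume) (ν := volume) _ hi').trans ?_
  refine integral_eq_zero_of_ae ?_
  filter_upwards [integral_fibre_eq_zero_of_meanX_eq_zero hf] with y hy
  simp only [Pi.zero_apply, mul_assoc]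
  rw [integral_mul_const, hy, zero_mul]

/-! ### Reflection: from the channel to the torus -/

/-- The plane covers the torus. -/
def toTorus (w : ℝ × ℝ) : Torus := ((w.1 : AddCircle (1 : ℝ)), (w.2 : AddCircle (2 : ℝ)))

/-- Reflection of the plane across the wall `y = 0`. -/
def reflY (w : ℝ × ℝ) : ℝ × ℝ := (w.1, -w.2)

theorem continuous_toTorus : Continuous toTorus :=
  ((AddCircle.continuous_mk' 1).comp continuous_fst).prodMk
    ((AddCircle.continuous_mk' 2).comp continuous_snd)

theorem continuous_reflY : Continuous reflY := by unfold reflY; fun_prop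

theorem toTorus_add (w w' : ℝ × ℝ) : toTorus (w + w') = toTorus w + toTorus w' := by
  simp [toTorus]

/-- The torus is the union of the channel and of its mirror image. -/
theorem volume_torus_eq : (volume : Measure Torus) =
    volOmega.map toTorus + volOmega.map (toTorus ∘ reflY) := by
  have h1 : (volume : Measure (AddCircle (1 : ℝ))) =
      (volume.restrict (Ioc (0 : ℝ) 1)).map ((↑) : ℝ → AddCircle (1 : ℝ)) := by
    have := (AddCircle.measurePreserving_mk 1 0).map_eq
    rw [zero_add] at this
    exact this.symm
  have hneg : (volume.restrict (Ioo (0 : ℝ) 1)).map (fun y => -y) =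
      volume.restrict (Ioo (-1 : ℝ) 0) := by
    have := ((Measure.measurePreserving_neg (volume : Measure ℝ)).restrict_preimage
      (measurableSet_Ioo (a := (-1 : ℝ)) (b := 0))).map_eq
    rw [show Neg.neg ⁻¹' Ioo (-1 : ℝ) 0 = Ioo 0 1 by ext x; simp] at this
    exact this
  have hm2 : Measurable ((↑) : ℝ → AddCircle (2 : ℝ)) := AddCircle.measurable_mk'
  have h2 : (volume : Measure (AddCircle (2 : ℝ))) =
      (volume.restrict (Ioo (0 : ℝ) 1)).map ((↑) : ℝ → AddCircle (2 : ℝ)) +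
      (volume.restrict (Ioo (0 : ℝ) 1)).map (fun y : ℝ => ((-y : ℝ) : AddCircle (2 : ℝ))) := by
    have h3 := (AddCircle.measurePreserving_mk 2 (-1)).map_eq
    have h4 : volume.restrict (Ioc (-1 : ℝ) (-1 + 2)) =
        volume.restrict (Ioo (0 : ℝ) 1) + volume.restrict (Ioo (-1 : ℝ) 0) := by
      rw [show (-1 : ℝ) + 2 = 1 by norm_num, ← Ioc_union_Ioc_eq_Ioc (a := (-1 : ℝ)) (b := 0) (by simp)
        (by simp), Measure.restrict_union (by
          rw [Set.disjoint_left]; intro x h1 h2; exact absurd h1.2 (not_le.2 h2.1)) measurableSet_Ioc,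
        add_comm]
      congr 1
      · exact Measure.restrict_congr_set Ioo_ae_eq_Ioc.symm
      · exact Measure.restrict_congr_set Ioo_ae_eq_Ioc.symm
    rw [← h3, h4, Measure.map_add _ _ hm2, ← hneg, Measure.map_map hm2 measurable_neg]
    rfl
  have e1 : (volume : Measure Torus) =
      (volume : Measure (AddCircle (1 : ℝ))).prod (volume : Measure (AddCircle (2 : ℝ))) := rfl
  have hm1 : Measurable ((↑) : ℝ → AddCircle (1 : ℝ)) := AddCircle.measurable_mk'
  have hm3 : Measurable (fun y : ℝ => ((-y : ℝ) : AddCircle (2 : ℝ))) := hm2.comp measurable_neg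
  rw [e1, h2, Measure.prod_add, h1, Measure.map_prod_map _ _ hm1 hm2,
    Measure.map_prod_map _ _ hm1 hm3]
  rfl

theorem measurable_toTorus : Measurable toTorus := continuous_toTorus.measurable

theorem measurable_toTorus_reflY : Measurable (toTorus ∘ reflY) :=
  (continuous_toTorus.comp continuous_reflY).measurable

theorem map_toTorus_le : volOmega.map toTorus ≤ volume := by
  rw [volume_torus_eq]; exact Measure.le_add_right le_rfl

theorem map_toTorus_reflY_le : volOmega.map (toTorus ∘ reflY) ≤ volume := by
  rw [volume_torus_eq]; exact Measure.le_add_left le_rfl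

theorem ae_toTorus {p : Torus → Prop} (h : ∀ᵐ z, p z) : ∀ᵐ w ∂volOmega, p (toTorus w) :=
  ae_of_ae_map measurable_toTorus.aemeasurable (h.filter_mono (ae_mono map_toTorus_le))

theorem ae_toTorus_reflY {p : Torus → Prop} (h : ∀ᵐ z, p z) :
    ∀ᵐ w ∂volOmega, p (toTorus (reflY w)) :=
  ae_of_ae_map measurable_toTorus_reflY.aemeasurable
    (h.filter_mono (ae_mono map_toTorus_reflY_le))

theorem ae_eq_torus {F G : Torus → ℝ} (hF : Measurable F) (hG : Measurable G)
    (h1 : ∀ᵐ w ∂volOmega, F (toTorus w) = G (toTorus w))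
    (h2 : ∀ᵐ w ∂volOmega, F (toTorus (reflY w)) = G (toTorus (reflY w))) : F =ᵐ[volume] G := by
  have hS := measurableSet_eq_fun hF hG
  rw [volume_torus_eq, EventuallyEq, ae_add_measure_iff]
  exact ⟨(ae_map_iff measurable_toTorus.aemeasurable hS).2 h1,
    (ae_map_iff measurable_toTorus_reflY.aemeasurable hS).2 h2⟩

theorem lintegral_torus {F : Torus → ENNReal} (hF : Measurable F) : ∫⁻ z, F z =
    (∫⁻ w, F (toTorus w) ∂volOmega) + ∫⁻ w, F (toTorus (reflY w)) ∂volOmega := by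
  conv_lhs => rw [volume_torus_eq]
  rw [lintegral_add_measure, lintegral_map hF measurable_toTorus,
    lintegral_map hF measurable_toTorus_reflY]
  rfl

theorem MeasureTheory.Integrable.comp_toTorus {F : Torus → ℝ} (hF : Integrable F) :
    Integrable (fun w => F (toTorus w)) volOmega :=
  (hF.mono_measure map_toTorus_le).comp_measurable measurable_toTorus

theorem MeasureTheory.Integrable.comp_toTorus_reflY {F : Torus → ℝ} (hF : Integrable F) :
    Integrable (fun w => F (toTorus (reflY w))) volOmega :=
  (hF.mono_measure map_toTorus_reflY_le).comp_measurable measurable_toTorus_reflY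

theorem integral_torus {F : Torus → ℝ} (hF : Integrable F) : ∫ z, F z =
    ∫ w, (F (toTorus w) + F (toTorus (reflY w))) ∂volOmega := by
  rw [integral_add hF.comp_toTorus hF.comp_toTorus_reflY]
  conv_lhs => rw [volume_torus_eq]
  rw [integral_add_measure (hF.mono_measure map_toTorus_le) (hF.mono_measure map_toTorus_reflY_le),
    integral_map measurable_toTorus.aemeasurable (hF.1.mono_measure map_toTorus_le),
    integral_map measurable_toTorus_reflY.aemeasurable (hF.1.mono_measure map_toTorus_reflY_le)]
  rfl

instance isFiniteMeasure_volOmega : IsFiniteMeasure volOmega := by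
  unfold volOmega; infer_instance

theorem ae_mem_volOmega : ∀ᵐ w ∂volOmega, w ∈ Ioc (0 : ℝ) 1 ×ˢ Ioo (0 : ℝ) 1 := by
  unfold volOmega
  rw [Measure.prod_restrict]
  exact ae_restrict_mem (measurableSet_Ioc.prod measurableSet_Ioo)

/-- The representative of a point of the torus in `(0,1] × (-1,1]`. -/
def torusRep (z : Torus) : ℝ × ℝ :=
  ((AddCircle.measurableEquivIoc 1 0 z.1 : ℝ), (AddCircle.measurableEquivIoc 2 (-1) z.2 : ℝ))

theorem measurable_torusRep : Measurable torusRep := by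
  refine Measurable.prodMk ?_ ?_
  · exact measurable_subtype_coe.comp
      ((AddCircle.measurableEquivIoc 1 0).measurable.comp measurable_fst)
  · exact measurable_subtype_coe.comp
      ((AddCircle.measurableEquivIoc 2 (-1)).measurable.comp measurable_snd)

theorem torusRep_toTorus {w : ℝ × ℝ} (h1 : w.1 ∈ Ioc (0 : ℝ) 1) (h2 : w.2 ∈ Ioc (-1 : ℝ) 1) :
    torusRep (toTorus w) = w := by
  refine Prod.ext ?_ ?_
  · exact (AddCircle.equivIoc_coe_of_mem (p := (1 : ℝ)) (a := (0 : ℝ))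
      (hy := by simpa using h1))
  · exact (AddCircle.equivIoc_coe_of_mem (p := (2 : ℝ)) (a := (-1 : ℝ))
      (hy := ⟨h2.1, h2.2.trans (by norm_num)⟩))

/-- The extension of a function on the channel to the torus, multiplied by `σ` on the mirror
image: even for `σ = 1`, odd for `σ = -1`. -/
def extFun (σ : ℝ) (f : ℝ × ℝ → ℝ) (z : Torus) : ℝ :=
  (if 0 < (torusRep z).2 then 1 else σ) * f ((torusRep z).1, |(torusRep z).2|)

theorem measurable_extFun (σ : ℝ) {f : ℝ × ℝ → ℝ} (hf : Measurable f) :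
    Measurable (extFun σ f) := by
  have h1 := measurable_torusRep.fst
  have h2 := measurable_torusRep.snd
  refine Measurable.mul (Measurable.ite (measurableSet_lt measurable_const h2)
    measurable_const measurable_const) (hf.comp (h1.prodMk ?_))
  exact measurable_norm.comp h2

theorem extFun_toTorus (σ : ℝ) (f : ℝ × ℝ → ℝ) {w : ℝ × ℝ}
    (hw : w ∈ Ioc (0 : ℝ) 1 ×ˢ Ioo (0 : ℝ) 1) : extFun σ f (toTorus w) = f w := by
  have := torusRep_toTorus hw.1 ⟨by linarith [hw.2.1], hw.2.2.le⟩
  rw [extFun, this, if_pos hw.2.1, abs_of_pos hw.2.1, one_mul]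

theorem extFun_toTorus_reflY (σ : ℝ) (f : ℝ × ℝ → ℝ) {w : ℝ × ℝ}
    (hw : w ∈ Ioc (0 : ℝ) 1 ×ˢ Ioo (0 : ℝ) 1) : extFun σ f (toTorus (reflY w)) = σ * f w := by
  have := torusRep_toTorus (w := reflY w) hw.1
    ⟨by simp only [reflY]; linarith [hw.2.2], by simp only [reflY]; linarith [hw.2.1]⟩
  have h : ¬ 0 < (reflY w).2 := not_lt.2 (neg_nonpos.2 hw.2.1.le)
  rw [extFun, this, if_neg h]
  change σ * f (w.1, |-w.2|) = _
  rw [abs_neg, abs_of_pos hw.2.1]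

theorem lintegral_extFun_sq (σ : ℝ) (f : L2Omega) :
    ∫⁻ z, ‖extFun σ f z‖ₑ ^ 2 = (1 + ‖σ‖ₑ ^ 2) * ‖f‖ₑ ^ 2 := by
  have hf := (Lp.stronglyMeasurable f).measurable
  rw [lintegral_torus ((measurable_extFun σ hf).enorm.pow_const 2), add_mul, one_mul]
  congr 1
  · rw [enorm_sq_eq_lintegral]
    refine lintegral_congr_ae ?_
    filter_upwards [ae_mem_volOmega] with w hw
    rw [extFun_toTorus σ f hw]
  · rw [enorm_sq_eq_lintegral, ← lintegral_const_mul _ (hf.enorm.pow_const 2)]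
    refine lintegral_congr_ae ?_
    filter_upwards [ae_mem_volOmega] with w hw
    rw [extFun_toTorus_reflY σ f hw, enorm_mul, mul_pow]

theorem memLp_extFun (σ : ℝ) (f : L2Omega) : MemLp (extFun σ f) 2 volume := by
  refine ⟨(measurable_extFun σ (Lp.stronglyMeasurable f).measurable).aestronglyMeasurable, ?_⟩
  rw [eLpNorm_lt_top_iff_lintegral_rpow_enorm_lt_top two_ne_zero (by simp)]
  simp only [ENNReal.toReal_ofNat, ENNReal.rpow_ofNat]
  rw [lintegral_extFun_sq]
  simp [ENNReal.mul_lt_top_iff]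

/-- Extension to the torus as an element of `L²`. -/
def extLp (σ : ℝ) (f : L2Omega) : L2T := (memLp_extFun σ f).toLp _

theorem extLp_ae (σ : ℝ) (f : L2Omega) : extLp σ f =ᵐ[volume] extFun σ f :=
  (memLp_extFun σ f).coeFn_toLp

theorem extLp_toTorus (σ : ℝ) (f : L2Omega) : ∀ᵐ w ∂volOmega, extLp σ f (toTorus w) = f w := by
  filter_upwards [ae_toTorus (extLp_ae σ f), ae_mem_volOmega] with w h1 h2
  rw [h1, extFun_toTorus σ f h2]

theorem extLp_toTorus_reflY (σ : ℝ) (f : L2Omega) :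
    ∀ᵐ w ∂volOmega, extLp σ f (toTorus (reflY w)) = σ * f w := by
  filter_upwards [ae_toTorus_reflY (extLp_ae σ f), ae_mem_volOmega] with w h1 h2
  rw [h1, extFun_toTorus_reflY σ f h2]

theorem Lp_ext_torus {F G : L2T} (h1 : ∀ᵐ w ∂volOmega, F (toTorus w) = G (toTorus w))
    (h2 : ∀ᵐ w ∂volOmega, F (toTorus (reflY w)) = G (toTorus (reflY w))) : F = G :=
  Lp.ext (ae_eq_torus (Lp.stronglyMeasurable F).measurable (Lp.stronglyMeasurable G).measurable
    h1 h2)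

theorem norm_extLp_sq (σ : ℝ) (f : L2Omega) : ‖extLp σ f‖ ^ 2 = (1 + σ ^ 2) * ‖f‖ ^ 2 := by
  have h1 : ‖extLp σ f‖ₑ ^ 2 = (1 + ‖σ‖ₑ ^ 2) * ‖f‖ₑ ^ 2 := by
    rw [enorm_sq_eq_lintegral, ← lintegral_extFun_sq]
    refine lintegral_congr_ae ?_
    filter_upwards [extLp_ae σ f] with z hz
    rw [hz]
  have h2 := congrArg ENNReal.toReal h1
  rw [ENNReal.toReal_mul, ENNReal.toReal_add (by simp) (by simp)] at h2
  simpa [ENNReal.toReal_pow] using h2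

/-- Extension to the torus as a bounded operator. -/
def extL (σ : ℝ) : L2Omega →L[ℝ] L2T :=
  LinearMap.mkContinuous
    { toFun := extLp σ
      map_add' := fun f g => by
        refine Lp_ext_torus ?_ ?_
        · filter_upwards [extLp_toTorus σ f, extLp_toTorus σ g, extLp_toTorus σ (f + g),
            ae_toTorus (Lp.coeFn_add (extLp σ f) (extLp σ g)), Lp.coeFn_add f g]
            with w h1 h2 h3 h4 h5
          rw [h3, h4, h5, Pi.add_apply, Pi.add_apply, h1, h2]
        · filter_upwards [extLp_toTorus_reflY σ f, extLp_toTorus_reflY σ g,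
            extLp_toTorus_reflY σ (f + g),
            ae_toTorus_reflY (Lp.coeFn_add (extLp σ f) (extLp σ g)), Lp.coeFn_add f g]
            with w h1 h2 h3 h4 h5
          rw [h3, h4, h5, Pi.add_apply, Pi.add_apply, h1, h2, mul_add]
      map_smul' := fun c f => by
        refine Lp_ext_torus ?_ ?_
        · filter_upwards [extLp_toTorus σ f, extLp_toTorus σ (c • f),
            ae_toTorus (Lp.coeFn_smul c (extLp σ f)), Lp.coeFn_smul c f] with w h1 h3 h4 h5
          rw [h3, RingHom.id_apply, h4, h5, Pi.smul_apply, Pi.smul_apply, h1]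
        · filter_upwards [extLp_toTorus_reflY σ f, extLp_toTorus_reflY σ (c • f),
            ae_toTorus_reflY (Lp.coeFn_smul c (extLp σ f)), Lp.coeFn_smul c f] with w h1 h3 h4 h5
          rw [h3, RingHom.id_apply, h4, h5, Pi.smul_apply, Pi.smul_apply, h1, smul_eq_mul,
            smul_eq_mul]
          ring } (1 + |σ|) (fun f => by
      refine abs_le_of_sq_le_sq' ?_ (by positivity) |>.2
      change ‖extLp σ f‖ ^ 2 ≤ _
      rw [norm_extLp_sq, mul_pow]
      refine mul_le_mul_of_nonneg_right ?_ (by positivity)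
      nlinarith [abs_nonneg σ, sq_abs σ])

theorem norm_extL_sq (σ : ℝ) (f : L2Omega) : ‖extL σ f‖ ^ 2 = (1 + σ ^ 2) * ‖f‖ ^ 2 :=
  norm_extLp_sq σ f

theorem extL_toTorus (σ : ℝ) (f : L2Omega) : ∀ᵐ w ∂volOmega, extL σ f (toTorus w) = f w :=
  extLp_toTorus σ f

theorem extL_toTorus_reflY (σ : ℝ) (f : L2Omega) :
    ∀ᵐ w ∂volOmega, extL σ f (toTorus (reflY w)) = σ * f w :=
  extLp_toTorus_reflY σ f

theorem memLp_res (σ : ℝ) (F : L2T) :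
    MemLp (fun w => F (toTorus w) + σ * F (toTorus (reflY w))) 2 volOmega := by
  have h1 : MemLp (fun w => F (toTorus w)) 2 volOmega :=
    ((memLp_map_measure_iff ((Lp.aestronglyMeasurable F).mono_measure map_toTorus_le)
      measurable_toTorus.aemeasurable).1 ((Lp.memLp F).mono_measure map_toTorus_le))
  have h2 : MemLp (fun w => F (toTorus (reflY w))) 2 volOmega :=
    ((memLp_map_measure_iff ((Lp.aestronglyMeasurable F).mono_measure map_toTorus_reflY_le)
      measurable_toTorus_reflY.aemeasurable).1 ((Lp.memLp F).mono_measure map_toTorus_reflY_le))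
  exact h1.add (h2.const_mul σ)

/-- Folding a function on the torus back to the channel; the adjoint of `extL σ`. -/
def resL (σ : ℝ) (F : L2T) : L2Omega := (memLp_res σ F).toLp _

theorem resL_ae (σ : ℝ) (F : L2T) :
    resL σ F =ᵐ[volOmega] fun w => F (toTorus w) + σ * F (toTorus (reflY w)) :=
  (memLp_res σ F).coeFn_toLp

theorem inner_extL (σ : ℝ) (f : L2Omega) (F : L2T) :
    inner ℝ (extL σ f) F = inner ℝ f (resL σ F) := by
  rw [real_inner_eq_integral_mul, real_inner_eq_integral_mul,
    integral_torus (show Integrable (fun z => extL σ f z * F z) volume from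
      (Lp.memLp _).integrable_mul (Lp.memLp F))]
  refine integral_congr_ae ?_
  filter_upwards [extL_toTorus σ f, extL_toTorus_reflY σ f, resL_ae σ F] with w h1 h2 h3
  rw [h1, h2, h3]; ring

/-! ### Smooth functions on the torus and distributional derivatives -/

/-- Smoothness of a function on the torus, read off in the plane. -/
def IsSmoothTorus (F : Torus → ℝ) : Prop :=
  ContDiff ℝ ((⊤ : ℕ∞) : WithTop ℕ∞) (fun w => F (toTorus w))

theorem isOpenQuotientMap_toTorus : IsOpenQuotientMap toTorus :=
  (QuotientAddGroup.isOpenQuotientMap_mk (N := AddSubgroup.zmultiples (1 : ℝ))).prodMap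
    (QuotientAddGroup.isOpenQuotientMap_mk (N := AddSubgroup.zmultiples (2 : ℝ)))

theorem toTorus_surjective : Function.Surjective toTorus := isOpenQuotientMap_toTorus.surjective

theorem continuous_of_comp_toTorus {F : Torus → ℝ} (h : Continuous fun w => F (toTorus w)) :
    Continuous F :=
  isOpenQuotientMap_toTorus.isQuotientMap.continuous_iff.2 h

namespace IsSmoothTorus

variable {F G : Torus → ℝ}

theorem continuous (hF : IsSmoothTorus F) : Continuous F :=
  continuous_of_comp_toTorus (ContDiff.continuous hF)

theorem comp_add (hF : IsSmoothTorus F) (a : Torus) : IsSmoothTorus (fun z => F (z + a)) := by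
  obtain ⟨w, rfl⟩ := toTorus_surjective a
  have : ContDiff ℝ ((⊤ : ℕ∞) : WithTop ℕ∞) (fun w' => F (toTorus (w' + w))) :=
    ContDiff.comp (g := fun w => F (toTorus w)) hF (contDiff_id.add contDiff_const)
  unfold IsSmoothTorus
  simpa only [toTorus_add] using this

theorem exists_bound (hF : IsSmoothTorus F) : ∃ C, ∀ z, |F z| ≤ C := by
  obtain ⟨C, hC⟩ := isCompact_univ.exists_bound_of_continuousOn hF.continuous.continuousOn
  exact ⟨C, fun z => hC z (mem_univ z)⟩

theorem memLp (hF : IsSmoothTorus F) : MemLp F 2 volume := by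
  obtain ⟨C, hC⟩ := hF.exists_bound
  exact MemLp.of_bound hF.continuous.aestronglyMeasurable C (Eventually.of_forall hC)

end IsSmoothTorus

/-- A square integrable function orthogonal to all smooth functions vanishes. -/
theorem eq_zero_of_forall_smooth {k : L2T}
    (h : ∀ F, IsSmoothTorus F → ∫ z, k z * F z = 0) : k = 0 := by
  let S : Subalgebra ℝ C(Torus, ℝ) :=
    { carrier := {F | IsSmoothTorus F}
      mul_mem' := fun {a b} ha hb => by
        rw [mem_ofPred_eq] at ha hb ⊢; exact ContDiff.mul ha hb
      add_mem' := fun {a b} ha hb => by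
        rw [mem_ofPred_eq] at ha hb ⊢; exact ContDiff.add ha hb
      algebraMap_mem' := fun c => by
        rw [mem_ofPred_eq]; exact contDiff_const }
  have hmem : ∀ F : C(Torus, ℝ), F ∈ (S : Set C(Torus, ℝ)) ↔ IsSmoothTorus F := fun F =>
    mem_ofPred
  -- points are separated by the real and imaginary parts of the two characters
  have hsep : S.SeparatesPoints := by
    have key : ∀ (T : ℝ) [Fact (0 < T)] (p : Torus → AddCircle T) (l : ℝ × ℝ → ℝ),
        (∀ w, p (toTorus w) = (l w : AddCircle T)) → ContDiff ℝ ((⊤ : ℕ∞) : WithTop ℕ∞) l →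
        Continuous p → ∀ z z', p z ≠ p z' → ∃ f ∈ (fun f : C(Torus, ℝ) => (f : Torus → ℝ)) '' S,
          f z ≠ f z' := by
      intro T _ p l hp hl hpc z z' hne
      have hc : Continuous fun z => (AddCircle.toCircle (p z) : ℂ) :=
        continuous_subtype_val.comp (AddCircle.continuous_toCircle.comp hpc)
      have hval : ∀ w, (AddCircle.toCircle (p (toTorus w)) : ℂ) =
          Complex.exp ((2 * Real.pi / T * l w : ℝ) * Complex.I) := fun w => by
        rw [hp, AddCircle.toCircle_apply_mk, Circle.coe_exp]
      have h1 : (AddCircle.toCircle (p z) : ℂ) ≠ AddCircle.toCircle (p z') := fun h =>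
        hne (AddCircle.injective_toCircle (Fact.out : 0 < T).ne' (Subtype.ext h))
      by_cases hre : (AddCircle.toCircle (p z) : ℂ).re = (AddCircle.toCircle (p z') : ℂ).re
      · refine ⟨_, ⟨⟨fun z => (AddCircle.toCircle (p z) : ℂ).im, Complex.continuous_im.comp hc⟩,
          ?_, rfl⟩, fun him => h1 (Complex.ext hre him)⟩
        rw [hmem]
        change ContDiff ℝ _ fun w => (AddCircle.toCircle (p (toTorus w)) : ℂ).im
        simp only [hval, Complex.exp_ofReal_mul_I_im]
        exact Real.contDiff_sin.comp (contDiff_const.mul hl)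
      · refine ⟨_, ⟨⟨fun z => (AddCircle.toCircle (p z) : ℂ).re, Complex.continuous_re.comp hc⟩,
          ?_, rfl⟩, hre⟩
        rw [hmem]
        change ContDiff ℝ _ fun w => (AddCircle.toCircle (p (toTorus w)) : ℂ).re
        simp only [hval, Complex.exp_ofReal_mul_I_re]
        exact Real.contDiff_cos.comp (contDiff_const.mul hl)
    intro z z' hne
    by_cases h1 : z.1 = z'.1
    · have h2 : z.2 ≠ z'.2 := fun h2 => hne (Prod.ext h1 h2)
      exact key 2 Prod.snd Prod.snd (fun w => rfl) contDiff_snd continuous_snd z z' h2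
    · exact key 1 Prod.fst Prod.fst (fun w => rfl) contDiff_fst continuous_fst z z' h1
  have htop := ContinuousMap.subalgebra_topologicalClosure_eq_top_of_separatesPoints S hsep
  let Λ := ContinuousMap.toLp (E := ℝ) 2 (volume : Measure Torus) ℝ
  have hS : ∀ F : C(Torus, ℝ), F ∈ S → inner ℝ k (Λ F) = 0 := fun F hF => by
    rw [real_inner_eq_integral_mul, ← h F ((hmem F).1 hF)]
    refine integral_congr_ae ?_
    filter_upwards [ContinuousMap.coeFn_toLp (𝕜 := ℝ) (p := 2) volume F] with z hz
    rw [hz]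
  have hall : ∀ F : C(Torus, ℝ), inner ℝ k (Λ F) = 0 := fun F => by
    have hF : F ∈ closure (S : Set C(Torus, ℝ)) := by
      have : F ∈ S.topologicalClosure := htop ▸ trivial
      exact this
    have hcl : IsClosed {F : C(Torus, ℝ) | inner ℝ k (Λ F) = 0} :=
      isClosed_eq (continuous_const.inner Λ.continuous) continuous_const
    exact closure_minimal (fun F hF => hS F hF) hcl hF
  have hdense := ContinuousMap.toLp_denseRange ℝ (volume : Measure Torus) (p := 2) ℝ (by simp)
  have : inner ℝ k k = 0 := by
    have hcl : IsClosed {g : L2T | inner ℝ k g = 0} :=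
      isClosed_eq (continuous_const.inner continuous_id) continuous_const
    exact closure_minimal (range_subset_iff.2 hall) hcl (hdense k)
  exact inner_self_eq_zero.1 this

/-- The classical derivative of a function on the torus along a one-parameter subgroup. -/
def torusDeriv (e : ℝ →+ Torus) (F : Torus → ℝ) (z : Torus) : ℝ := deriv (fun s => F (z + e s)) 0

section TorusDeriv

variable {e : ℝ →+ Torus} {d : ℝ × ℝ} {F G : Torus → ℝ}

theorem IsSmoothTorus.torusDeriv_toTorus (hF : IsSmoothTorus F) (he : ∀ s, e s = toTorus (s • d))
    (w : ℝ × ℝ) : torusDeriv e F (toTorus w) = fderiv ℝ (fun w => F (toTorus w)) w d := by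
  have h1 : HasDerivAt (fun s : ℝ => w + s • d) d 0 := by
    simpa using ((hasDerivAt_id (0 : ℝ)).smul_const d).const_add w
  have h2 := (ContDiff.differentiable hF (by simp) (w + (0 : ℝ) • d)).hasFDerivAt.comp_hasDerivAt
    (0 : ℝ) h1
  have h3 : (fun s => F (toTorus w + e s)) = (fun w => F (toTorus w)) ∘ fun s => w + s • d := by
    funext s; simp [he, toTorus_add]
  rw [torusDeriv, h3, h2.deriv, zero_smul, add_zero]

theorem IsSmoothTorus.hasDerivAt (hF : IsSmoothTorus F) (he : ∀ s, e s = toTorus (s • d))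
    (z : Torus) (s : ℝ) : HasDerivAt (fun s => F (z + e s)) (torusDeriv e F (z + e s)) s := by
  obtain ⟨w, rfl⟩ := toTorus_surjective z
  have h1 : HasDerivAt (fun s : ℝ => w + s • d) d s := by
    simpa using ((hasDerivAt_id s).smul_const d).const_add w
  have h2 := (ContDiff.differentiable hF (by simp) (w + s • d)).hasFDerivAt.comp_hasDerivAt s h1
  have h3 : (fun s => F (toTorus w + e s)) = (fun w => F (toTorus w)) ∘ fun s => w + s • d := by
    funext s; simp [he, toTorus_add]
  rw [h3, he, ← toTorus_add, hF.torusDeriv_toTorus he]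
  exact h2

theorem IsSmoothTorus.torusDeriv (hF : IsSmoothTorus F) (he : ∀ s, e s = toTorus (s • d)) :
    IsSmoothTorus (torusDeriv e F) := by
  unfold IsSmoothTorus
  simp only [hF.torusDeriv_toTorus he]
  exact (ContDiff.fderiv_right hF (by simp)).clm_apply contDiff_const

theorem torusDeriv_comp_add (e : ℝ →+ Torus) (F : Torus → ℝ) (a z : Torus) :
    torusDeriv e (fun z => F (z + a)) z = torusDeriv e F (z + a) := by
  unfold torusDeriv
  congr 1; funext s; rw [add_right_comm]

/-- Differentiation of `∫ k(z) F(z + e s) dz` under the integral sign. -/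
theorem hasDerivAt_integral_mul_translate (k : L2T) (hF : IsSmoothTorus F)
    (he : ∀ s, e s = toTorus (s • d)) (s : ℝ) :
    HasDerivAt (fun s => ∫ z, k z * F (z + e s)) (∫ z, k z * torusDeriv e F (z + e s)) s := by
  obtain ⟨C, hC⟩ := (hF.torusDeriv he).exists_bound
  have hm : ∀ {H : Torus → ℝ}, IsSmoothTorus H → ∀ s, Integrable (fun z => k z * H (z + e s)) :=
    fun hH s => (Lp.memLp k).integrable_mul (hH.comp_add (e s)).memLp
  refine (hasDerivAt_integral_of_dominated_loc_of_deriv_le (bound := fun z => |k z| * C)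
    (F' := fun s z => k z * torusDeriv e F (z + e s)) univ_mem
    (Eventually.of_forall fun s => (hm hF s).1) (hm hF s) (hm (hF.torusDeriv he) s).1 ?_ ?_ ?_).2
  · refine Eventually.of_forall fun z x _ => ?_
    rw [Real.norm_eq_abs, abs_mul]
    exact mul_le_mul_of_nonneg_left (hC _) (abs_nonneg _)
  · exact (((Lp.memLp k).integrable (by norm_num)).abs).mul_const C
  · exact Eventually.of_forall fun z x _ => (hF.hasDerivAt he z x).const_mul _

/-- Distributional derivatives on the torus are derivatives of the translation orbit. -/
theorem hasOrbitDeriv_of_forall_smooth {f g : L2T} (hec : Continuous e)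
    (he : ∀ s, e s = toTorus (s • d))
    (h : ∀ F, IsSmoothTorus F → ∫ z, f z * torusDeriv e F z = -∫ z, g z * F z) :
    HasOrbitDeriv e f g := by
  refine HasOrbitDeriv.of_forall_eq_integral hec fun s => ?_
  have hcont : Continuous fun r => tshift (e r) g := (continuous_tshift g).comp hec
  rw [← sub_eq_zero]
  refine eq_zero_of_forall_smooth fun F hF => ?_
  let χ : L2T := hF.memLp.toLp F
  have hχ : χ =ᵐ[volume] F := hF.memLp.coeFn_toLp
  have hin : ∀ k : L2T, ∫ z, k z * F z = inner ℝ k χ := fun k => by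
    rw [real_inner_eq_integral_mul]
    refine integral_congr_ae ?_
    filter_upwards [hχ] with z hz
    rw [hz]
  have htr : ∀ (k : L2T) (r : ℝ), inner ℝ (tshift (e r) k) χ = ∫ z, k z * F (z + e (-r)) :=
    fun k r => by
      rw [inner_tshift, real_inner_eq_integral_mul]
      refine integral_congr_ae ?_
      have := (measurePreserving_add_right (volume : Measure Torus) (e (-r))).quasiMeasurePreserving.ae hχ
      filter_upwards [tshift_ae (-e r) χ, this] with z h1 h2
      rw [h1, ← map_neg, h2]
  have hd : ∀ r, HasDerivAt (fun r => ∫ z, f z * F (z + e (-r)))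
      (∫ z, g z * F (z + e (-r))) r := fun r => by
    have h1 := (hasDerivAt_integral_mul_translate f hF he (-r)).comp r (hasDerivAt_neg r)
    have h2 := h _ (hF.comp_add (e (-r)))
    simp only [torusDeriv_comp_add] at h2
    rw [h2] at h1
    simpa [Function.comp_def] using h1
  have hc2 : Continuous fun r => ∫ z, g z * F (z + e (-r)) := by
    have : Continuous fun r => inner ℝ (tshift (e r) g) χ := hcont.inner continuous_const
    simpa only [htr] using this
  have hftc := intervalIntegral.integral_eq_sub_of_hasDerivAt (a := 0) (b := s)
    (fun r _ => hd r) (hc2.intervalIntegrable _ _)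
  have hI : inner ℝ (∫ r in (0 : ℝ)..s, tshift (e r) g) χ =
      ∫ r in (0 : ℝ)..s, ∫ z, g z * F (z + e (-r)) := by
    have h1 := (innerSL ℝ χ).intervalIntegral_comp_comm
      (hcont.intervalIntegrable (μ := volume) 0 s)
    simp only [innerSL_apply_apply] at h1
    rw [real_inner_comm, ← h1]
    exact intervalIntegral.integral_congr fun r _ => by
      change inner ℝ χ (tshift (e r) g) = ∫ z, g z * F (z + e (-r))
      rw [← htr, real_inner_comm]
  rw [hin, inner_sub_left, inner_sub_left, hI, hftc, htr, ← hin]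
  simp

end TorusDeriv

/-! ### Integration by parts and cut-offs on the channel -/

theorem exists_bound_channel {ψ : ℝ × ℝ → ℝ} (h : Continuous ψ) :
    ∃ M, 0 ≤ M ∧ ∀ w ∈ Icc (0 : ℝ) 1 ×ˢ Icc (0 : ℝ) 1, |ψ w| ≤ M := by
  obtain ⟨M, hM⟩ := (isCompact_Icc.prod isCompact_Icc).exists_bound_of_continuousOn
    (s := Icc (0 : ℝ) 1 ×ˢ Icc (0 : ℝ) 1) h.continuousOn
  exact ⟨M, (abs_nonneg _).trans (hM (0, 0) (by simp)), hM⟩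

theorem mem_closed_channel {w : ℝ × ℝ} (hw : w ∈ Ioc (0 : ℝ) 1 ×ˢ Ioo (0 : ℝ) 1) :
    w ∈ Icc (0 : ℝ) 1 ×ˢ Icc (0 : ℝ) 1 :=
  ⟨Ioc_subset_Icc_self hw.1, Ioo_subset_Icc_self hw.2⟩

theorem memLp_channel_of_continuous {ψ : ℝ × ℝ → ℝ} (h : Continuous ψ) : MemLp ψ 2 volOmega := by
  obtain ⟨M, -, hM⟩ := exists_bound_channel h
  refine MemLp.of_bound h.aestronglyMeasurable M ?_
  filter_upwards [ae_mem_volOmega] with w hw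
  exact hM w (mem_closed_channel hw)

namespace IsSmoothPeriodic

variable {ψ η : ℝ × ℝ → ℝ}

theorem continuous (h : IsSmoothPeriodic ψ) : Continuous ψ := h.1.continuous

theorem differentiable (h : IsSmoothPeriodic ψ) : Differentiable ℝ ψ := h.1.differentiable (by simp)

theorem memLp (h : IsSmoothPeriodic ψ) : MemLp ψ 2 volOmega :=
  memLp_channel_of_continuous h.continuous

theorem fderiv_periodic (h : IsSmoothPeriodic ψ) (x y : ℝ) :
    fderiv ℝ ψ (x + 1, y) = fderiv ℝ ψ (x, y) := by
  have h1 : (fun z : ℝ × ℝ => ψ (z + (1, 0))) = ψ := by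
    funext ⟨x, y⟩; simpa using h.2 x y
  have h2 := fderiv_comp_add_right (𝕜 := ℝ) (f := ψ) (x := (x, y)) (1, 0)
  rw [h1] at h2
  simpa using h2.symm

theorem partialX (h : IsSmoothPeriodic ψ) : IsSmoothPeriodic (partialX ψ) :=
  ⟨(h.1.fderiv_right (by simp)).clm_apply contDiff_const, fun x y => by
    rw [_root_.partialX, h.fderiv_periodic]; rfl⟩

theorem partialY (h : IsSmoothPeriodic ψ) : IsSmoothPeriodic (partialY ψ) :=
  ⟨(h.1.fderiv_right (by simp)).clm_apply contDiff_const, fun x y => by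
    rw [_root_.partialY, h.fderiv_periodic]; rfl⟩

theorem mul (h : IsSmoothPeriodic ψ) (h' : IsSmoothPeriodic η) :
    IsSmoothPeriodic (fun z => ψ z * η z) :=
  ⟨h.1.mul h'.1, fun x y => by simp only [h.2, h'.2]⟩

theorem add_mul_reflY (h : IsSmoothPeriodic ψ) (σ : ℝ) :
    IsSmoothPeriodic (fun z => ψ z + σ * ψ (reflY z)) := by
  refine ⟨h.1.add (contDiff_const.mul (h.1.comp ?_)), fun x y => ?_⟩
  · exact contDiff_fst.prodMk contDiff_snd.neg
  · simp only [reflY]; rw [h.2, h.2]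

theorem hasDerivAt_fst (h : IsSmoothPeriodic ψ) (x y : ℝ) :
    HasDerivAt (fun x => ψ (x, y)) (_root_.partialX ψ (x, y)) x :=
  (h.differentiable (x, y)).hasFDerivAt.comp_hasDerivAt x
    ((hasDerivAt_id x).prodMk (hasDerivAt_const x y))

theorem hasDerivAt_snd (h : IsSmoothPeriodic ψ) (x y : ℝ) :
    HasDerivAt (fun y => ψ (x, y)) (_root_.partialY ψ (x, y)) y :=
  (h.differentiable (x, y)).hasFDerivAt.comp_hasDerivAt y
    ((hasDerivAt_const y x).prodMk (hasDerivAt_id y))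

theorem partialX_mul (h : IsSmoothPeriodic ψ) (h' : IsSmoothPeriodic η) (z : ℝ × ℝ) :
    _root_.partialX (fun z => ψ z * η z) z = _root_.partialX ψ z * η z + ψ z * _root_.partialX η z :=
  ((h.mul h').hasDerivAt_fst z.1 z.2).unique
    ((h.hasDerivAt_fst z.1 z.2).mul (h'.hasDerivAt_fst z.1 z.2))

theorem partialY_mul (h : IsSmoothPeriodic ψ) (h' : IsSmoothPeriodic η) (z : ℝ × ℝ) :
    _root_.partialY (fun z => ψ z * η z) z = _root_.partialY ψ z * η z + ψ z * _root_.partialY η z :=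
  ((h.mul h').hasDerivAt_snd z.1 z.2).unique
    ((h.hasDerivAt_snd z.1 z.2).mul (h'.hasDerivAt_snd z.1 z.2))

theorem partialX_add_mul_reflY (h : IsSmoothPeriodic ψ) (σ : ℝ) (z : ℝ × ℝ) :
    _root_.partialX (fun z => ψ z + σ * ψ (reflY z)) z =
      _root_.partialX ψ z + σ * _root_.partialX ψ (reflY z) :=
  ((h.add_mul_reflY σ).hasDerivAt_fst z.1 z.2).unique
    ((h.hasDerivAt_fst z.1 z.2).add ((h.hasDerivAt_fst z.1 (-z.2)).const_mul σ))

theorem partialY_add_mul_reflY (h : IsSmoothPeriodic ψ) (σ : ℝ) (z : ℝ × ℝ) :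
    _root_.partialY (fun z => ψ z + σ * ψ (reflY z)) z =
      _root_.partialY ψ z - σ * _root_.partialY ψ (reflY z) := by
  refine ((h.add_mul_reflY σ).hasDerivAt_snd z.1 z.2).unique ?_
  have h1 := ((h.hasDerivAt_snd z.1 (-z.2)).comp z.2 (hasDerivAt_neg z.2)).const_mul σ
  have h2 := (h.hasDerivAt_snd z.1 z.2).add h1
  convert h2 using 1
  · rfl
  · change _root_.partialY ψ (z.1, z.2) - σ * _root_.partialY ψ (z.1, -z.2) = _
    ring

theorem integral_partialX (h : IsSmoothPeriodic ψ) : ∫ z, _root_.partialX ψ z ∂volOmega = 0 := by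
  have hi : Integrable (_root_.partialX ψ) volOmega := h.partialX.memLp.integrable (by norm_num)
  unfold volOmega at hi ⊢
  rw [integral_prod_symm _ hi]
  have : ∀ y, ∫ x in Ioc (0 : ℝ) 1, _root_.partialX ψ (x, y) = 0 := fun y => by
    rw [← intervalIntegral.integral_of_le zero_le_one,
      intervalIntegral.integral_eq_sub_of_hasDerivAt (fun x _ => h.hasDerivAt_fst x y)
        ((h.partialX.continuous.comp (by fun_prop : Continuous fun x : ℝ => (x, y))).intervalIntegrable _ _)]
    have := h.2 0 y
    rw [zero_add] at this
    rw [this, sub_self]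
  simp [this]

theorem integral_partialY (h : IsSmoothPeriodic ψ) (h0 : ∀ x, ψ (x, 0) = 0)
    (h1 : ∀ x, ψ (x, 1) = 0) : ∫ z, _root_.partialY ψ z ∂volOmega = 0 := by
  have hi : Integrable (_root_.partialY ψ) volOmega := h.partialY.memLp.integrable (by norm_num)
  unfold volOmega at hi ⊢
  rw [integral_prod _ hi]
  have : ∀ x, ∫ y in Ioo (0 : ℝ) 1, _root_.partialY ψ (x, y) = 0 := fun x => by
    rw [← integral_Ioc_eq_integral_Ioo, ← intervalIntegral.integral_of_le zero_le_one,
      intervalIntegral.integral_eq_sub_of_hasDerivAt (fun y _ => h.hasDerivAt_snd x y)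
        ((h.partialY.continuous.comp (by fun_prop : Continuous fun y : ℝ => (x, y))).intervalIntegrable _ _),
      h0, h1, sub_self]
  simp [this]

/-- Integration by parts in `x`. -/
theorem integral_mul_partialX (h : IsSmoothPeriodic ψ) (h' : IsSmoothPeriodic η) :
    ∫ z, ψ z * _root_.partialX η z ∂volOmega = -∫ z, _root_.partialX ψ z * η z ∂volOmega := by
  have h0 := (h.mul h').integral_partialX
  simp only [partialX_mul h h'] at h0
  have i1 : Integrable (fun z => _root_.partialX ψ z * η z) volOmega :=
    h.partialX.memLp.integrable_mul h'.memLp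
  have i2 : Integrable (fun z => ψ z * _root_.partialX η z) volOmega :=
    h.memLp.integrable_mul h'.partialX.memLp
  rw [integral_add i1 i2] at h0
  linarith

/-- Integration by parts in `y`. -/
theorem integral_mul_partialY (h : IsSmoothPeriodic ψ) (h' : IsSmoothPeriodic η)
    (h0 : ∀ x, ψ (x, 0) * η (x, 0) = 0) (h1 : ∀ x, ψ (x, 1) * η (x, 1) = 0) :
    ∫ z, ψ z * _root_.partialY η z ∂volOmega = -∫ z, _root_.partialY ψ z * η z ∂volOmega := by
  have h2 := (h.mul h').integral_partialY h0 h1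
  simp only [partialY_mul h h'] at h2
  have i1 : Integrable (fun z => _root_.partialY ψ z * η z) volOmega :=
    h.partialY.memLp.integrable_mul h'.memLp
  have i2 : Integrable (fun z => ψ z * _root_.partialY η z) volOmega :=
    h.memLp.integrable_mul h'.partialY.memLp
  rw [integral_add i1 i2] at h2
  linarith

end IsSmoothPeriodic

theorem IsTestFunction.eq_zero_wall {ψ : ℝ × ℝ → ℝ} (h : IsTestFunction ψ) (x : ℝ) :
    ψ (x, 0) = 0 ∧ ψ (x, 1) = 0 := by
  obtain ⟨-, a, b, ha, hb, hab⟩ := h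
  constructor
  · by_contra h0; have := (hab _ h0).1; simp only at this; linarith
  · by_contra h0; have := (hab _ h0).2; simp only at this; linarith

/-- A smooth function of `y` that vanishes near the walls and tends to `1` inside the channel. -/
def wallCutoff (n : ℝ) (y : ℝ) : ℝ :=
  Real.smoothTransition (n * y - 1) * Real.smoothTransition (n * (1 - y) - 1)

theorem contDiff_wallCutoff (n : ℝ) {m : ℕ∞} : ContDiff ℝ (m : WithTop ℕ∞) (wallCutoff n) :=
  (Real.smoothTransition.contDiff.comp ((contDiff_const.mul contDiff_id).sub contDiff_const)).mul
    (Real.smoothTransition.contDiff.comp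
      ((contDiff_const.mul (contDiff_const.sub contDiff_id)).sub contDiff_const))

theorem abs_wallCutoff_le (n y : ℝ) : |wallCutoff n y| ≤ 1 := by
  unfold wallCutoff
  rw [abs_of_nonneg (mul_nonneg (Real.smoothTransition.nonneg _) (Real.smoothTransition.nonneg _))]
  exact mul_le_one₀ (Real.smoothTransition.le_one _) (Real.smoothTransition.nonneg _)
    (Real.smoothTransition.le_one _)

theorem wallCutoff_eventually {y : ℝ} (hy : y ∈ Ioo (0 : ℝ) 1) :
    ∀ᶠ n in atTop, wallCutoff n =ᶠ[𝓝 y] fun _ => 1 := by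
  set m := min y (1 - y) / 2 with hm
  have hm0 : 0 < m := half_pos (lt_min hy.1 (by linarith [hy.2]))
  filter_upwards [eventually_ge_atTop (2 / m), eventually_gt_atTop 0] with n hn hn0
  have h1 : m < y := by
    have := min_le_left y (1 - y); linarith
  have h2 : m < 1 - y := by
    have := min_le_right y (1 - y); linarith
  filter_upwards [Ioo_mem_nhds h1 (show y < 1 - m by linarith)] with z hz
  rw [div_le_iff₀ hm0] at hn
  unfold wallCutoff
  rw [Real.smoothTransition.one_of_one_le, Real.smoothTransition.one_of_one_le, one_mul]
  · nlinarith [mul_le_mul_of_nonneg_left (show m ≤ 1 - z by linarith [hz.2]) hn0.le]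
  · nlinarith [mul_le_mul_of_nonneg_left hz.1.le hn0.le]

theorem exists_bound_deriv_smoothTransition :
    ∃ C, 0 ≤ C ∧ ∀ t, |deriv Real.smoothTransition t| * |t + 1| ≤ C := by
  have hc : Continuous (fun t => |deriv Real.smoothTransition t| * |t + 1|) := by
    have : Continuous (deriv Real.smoothTransition) :=
      (Real.smoothTransition.contDiff (n := 1)).continuous_deriv (by simp)
    fun_prop
  obtain ⟨C, hC⟩ := isCompact_Icc.exists_bound_of_continuousOn (s := Icc (0 : ℝ) 1) hc.continuousOn
  refine ⟨C, (norm_nonneg _).trans (hC 0 (by simp)), fun t => ?_⟩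
  have hC0 := (norm_nonneg _).trans (hC 0 (by simp))
  by_cases ht : t ∈ Icc (0 : ℝ) 1
  · exact (le_abs_self _).trans (hC t ht)
  · have : deriv Real.smoothTransition t = 0 := by
      rw [mem_Icc, not_and_or, not_le, not_le] at ht
      rcases ht with ht | ht
      · have : Real.smoothTransition =ᶠ[𝓝 t] fun _ => 0 := by
          filter_upwards [Iio_mem_nhds ht] with s hs
          exact Real.smoothTransition.zero_of_nonpos (le_of_lt hs)
        rw [this.deriv_eq, deriv_const]
      · have : Real.smoothTransition =ᶠ[𝓝 t] fun _ => 1 := by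
          filter_upwards [Ioi_mem_nhds ht] with s hs
          exact Real.smoothTransition.one_of_one_le (le_of_lt hs)
        rw [this.deriv_eq, deriv_const]
    rw [this]; simpa using hC0

/-- The derivative of the cut-off is controlled by the inverse distance to the walls. -/
theorem exists_bound_deriv_wallCutoff : ∃ C, 0 ≤ C ∧ ∀ n > 0, ∀ y ∈ Ioo (0 : ℝ) 1,
    |deriv (wallCutoff n) y| * min y (1 - y) ≤ C := by
  obtain ⟨C, hC0, hC⟩ := exists_bound_deriv_smoothTransition
  refine ⟨C + C, by linarith, fun n hn y hy => ?_⟩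
  have hd : Differentiable ℝ Real.smoothTransition :=
    (Real.smoothTransition.contDiff (n := 1)).differentiable (by simp)
  have h1 : HasDerivAt (fun y => Real.smoothTransition (n * y - 1))
      (deriv Real.smoothTransition (n * y - 1) * n) y := by
    have := ((hasDerivAt_id' y).const_mul n).sub_const 1
    rw [mul_one] at this
    exact (hd _).hasDerivAt.comp y this
  have h2 : HasDerivAt (fun y => Real.smoothTransition (n * (1 - y) - 1))
      (deriv Real.smoothTransition (n * (1 - y) - 1) * (n * (-1))) y := by
    have := (((hasDerivAt_id' y).const_sub 1).const_mul n).sub_const 1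
    exact (hd _).hasDerivAt.comp y this
  have h3 : deriv (wallCutoff n) y = _ := (h1.mul h2).deriv
  have e1 := hC (n * y - 1)
  have e2 := hC (n * (1 - y) - 1)
  rw [sub_add_cancel, abs_of_pos (mul_pos hn hy.1)] at e1
  rw [sub_add_cancel, abs_of_pos (mul_pos hn (by linarith [hy.2]))] at e2
  set S := Real.smoothTransition
  have b1 : |S (n * y - 1)| ≤ 1 := by
    rw [abs_of_nonneg (Real.smoothTransition.nonneg _)]; exact Real.smoothTransition.le_one _
  have b2 : |S (n * (1 - y) - 1)| ≤ 1 := by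
    rw [abs_of_nonneg (Real.smoothTransition.nonneg _)]; exact Real.smoothTransition.le_one _
  have hm0 : 0 ≤ min y (1 - y) := le_min hy.1.le (by linarith [hy.2])
  calc |deriv (wallCutoff n) y| * min y (1 - y)
      ≤ (|deriv S (n * y - 1) * n * S (n * (1 - y) - 1)| +
        |S (n * y - 1) * (deriv S (n * (1 - y) - 1) * (n * (-1)))|) * min y (1 - y) := by
        rw [h3]; exact mul_le_mul_of_nonneg_right (abs_add_le _ _) hm0
    _ ≤ (|deriv S (n * y - 1)| * n + |deriv S (n * (1 - y) - 1)| * n) * min y (1 - y) := by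
        refine mul_le_mul_of_nonneg_right (add_le_add ?_ ?_) hm0
        · rw [abs_mul, abs_mul, abs_of_pos hn]
          exact mul_le_of_le_one_right (by positivity) b2
        · rw [abs_mul, abs_mul, abs_mul, abs_of_pos hn, abs_neg, abs_one, mul_one]
          exact mul_le_of_le_one_left (by positivity) b1
    _ ≤ |deriv S (n * y - 1)| * (n * y) + |deriv S (n * (1 - y) - 1)| * (n * (1 - y)) := by
        have i1 := mul_le_mul_of_nonneg_left (min_le_left y (1 - y))
          (show 0 ≤ |deriv S (n * y - 1)| * n by positivity)
        have i2 := mul_le_mul_of_nonneg_left (min_le_right y (1 - y))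
          (show 0 ≤ |deriv S (n * (1 - y) - 1)| * n by positivity)
        linarith
    _ ≤ C + C := add_le_add e1 e2

theorem isSmoothPeriodic_of_snd {χ : ℝ → ℝ} (hχ : ContDiff ℝ ((⊤ : ℕ∞) : WithTop ℕ∞) χ) :
    IsSmoothPeriodic (fun z => χ z.2) :=
  ⟨hχ.comp contDiff_snd, fun _ _ => rfl⟩

theorem isTestFunction_cutoff {ψ : ℝ × ℝ → ℝ} (h : IsSmoothPeriodic ψ) {n : ℝ} (hn : 0 < n) :
    IsTestFunction (fun z => wallCutoff n z.2 * ψ z) := by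
  refine ⟨(isSmoothPeriodic_of_snd (contDiff_wallCutoff n)).mul h, 1 / n, 1 - 1 / n, by positivity,
    by have : 0 < 1 / n := by positivity
       linarith, fun z hz => ?_⟩
  have h1 : wallCutoff n z.2 ≠ 0 := left_ne_zero_of_mul hz
  unfold wallCutoff at h1
  have h2 : 0 < n * z.2 - 1 := by
    by_contra hc
    exact left_ne_zero_of_mul h1 (Real.smoothTransition.zero_of_nonpos (not_lt.1 hc))
  have h3 : 0 < n * (1 - z.2) - 1 := by
    by_contra hc
    exact right_ne_zero_of_mul h1 (Real.smoothTransition.zero_of_nonpos (not_lt.1 hc))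
  have h4 : n * (1 / n) = 1 := by field_simp
  constructor
  · by_contra hc; nlinarith [mul_lt_mul_of_pos_left (not_le.1 hc) hn]
  · by_contra hc; nlinarith [mul_lt_mul_of_pos_left (not_le.1 hc) hn]

theorem tendsto_integral_mul_of_bounded (f : L2Omega) {a : ℝ → ℝ × ℝ → ℝ} {b : ℝ × ℝ → ℝ} (M : ℝ)
    (ha : ∀ n, Continuous (a n))
    (hM : ∀ n > 0, ∀ w ∈ Ioc (0 : ℝ) 1 ×ˢ Ioo (0 : ℝ) 1, |a n w| ≤ M)
    (hlim : ∀ w ∈ Ioc (0 : ℝ) 1 ×ˢ Ioo (0 : ℝ) 1, ∀ᶠ n in atTop, a n w = b w) :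
    Tendsto (fun n => ∫ z, f z * a n z ∂volOmega) atTop (𝓝 (∫ z, f z * b z ∂volOmega)) := by
  refine tendsto_integral_filter_of_dominated_convergence (fun z => |f z| * M) ?_ ?_ ?_ ?_
  · exact Eventually.of_forall fun n =>
      (Lp.aestronglyMeasurable f).mul (ha n).aestronglyMeasurable
  · filter_upwards [eventually_gt_atTop 0] with n hn
    filter_upwards [ae_mem_volOmega] with w hw
    rw [Real.norm_eq_abs, abs_mul]
    exact mul_le_mul_of_nonneg_left (hM n hn w hw) (abs_nonneg _)
  · exact (((Lp.memLp f).integrable (by norm_num)).abs).mul_const M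
  · filter_upwards [ae_mem_volOmega] with w hw
    refine tendsto_const_nhds.congr' ?_
    filter_upwards [hlim w hw] with n hn
    rw [hn]

theorem tendsto_integral_mul_cutoff (f : L2Omega) {ψ : ℝ × ℝ → ℝ} (h : IsSmoothPeriodic ψ) :
    Tendsto (fun n => ∫ z, f z * (wallCutoff n z.2 * ψ z) ∂volOmega) atTop
      (𝓝 (∫ z, f z * ψ z ∂volOmega)) := by
  obtain ⟨M, hM0, hM⟩ := exists_bound_channel h.continuous
  refine tendsto_integral_mul_of_bounded f M (fun n => ?_) (fun n hn w hw => ?_) (fun w hw => ?_)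
  · exact ((contDiff_wallCutoff n (m := 0)).continuous.comp continuous_snd).mul h.continuous
  · rw [abs_mul]
    exact (mul_le_of_le_one_left (abs_nonneg _) (abs_wallCutoff_le _ _)).trans
      (hM w (mem_closed_channel hw))
  · filter_upwards [wallCutoff_eventually hw.2] with n hn
    rw [hn.eq_of_nhds, one_mul]

/-- No condition at the walls is needed to test an `x`-derivative. -/
theorem HasWeakDerivX.integral_eq {f g : L2Omega} (h : HasWeakDerivX f g) {ψ : ℝ × ℝ → ℝ}
    (hψ : IsSmoothPeriodic ψ) :
    ∫ z, f z * partialX ψ z ∂volOmega = -∫ z, g z * ψ z ∂volOmega := by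
  refine tendsto_nhds_unique_of_eventuallyEq (tendsto_integral_mul_cutoff f hψ.partialX)
    (tendsto_integral_mul_cutoff g hψ).neg ?_
  filter_upwards [eventually_gt_atTop 0] with n hn
  rw [← h _ (isTestFunction_cutoff hψ hn)]
  refine integral_congr_ae (Eventually.of_forall fun z => ?_)
  have h1 := (isSmoothPeriodic_of_snd (contDiff_wallCutoff n)).partialX_mul hψ z
  have h2 : partialX (fun z : ℝ × ℝ => wallCutoff n z.2) z = 0 :=
    ((isSmoothPeriodic_of_snd (contDiff_wallCutoff n)).hasDerivAt_fst z.1 z.2).unique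
      (hasDerivAt_const z.1 (wallCutoff n z.2))
  simp only [h1, h2, zero_mul, zero_add]

/-- A `y`-derivative may be tested with functions that vanish at the walls, not only near them: there
the cut-off has a derivative of the order of the inverse distance to the wall, which the zero of
`ψ` compensates. -/
theorem HasWeakDerivY.integral_eq {f g : L2Omega} (h : HasWeakDerivY f g) {ψ : ℝ × ℝ → ℝ}
    (hψ : IsSmoothPeriodic ψ) (hw : ∀ x, ψ (x, 0) = 0 ∧ ψ (x, 1) = 0) :
    ∫ z, f z * partialY ψ z ∂volOmega = -∫ z, g z * ψ z ∂volOmega := by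
  obtain ⟨C, hC0, hC⟩ := exists_bound_deriv_wallCutoff
  obtain ⟨M, hM0, hM⟩ := exists_bound_channel hψ.partialY.continuous
  have hχ := fun n => isSmoothPeriodic_of_snd (contDiff_wallCutoff n)
  have hp : ∀ n z, partialY (fun z : ℝ × ℝ => wallCutoff n z.2) z = deriv (wallCutoff n) z.2 :=
    fun n z => ((hχ n).hasDerivAt_snd z.1 z.2).deriv.symm
  -- mean value inequality from the nearest wall
  have key : ∀ w ∈ Ioc (0 : ℝ) 1 ×ˢ Ioo (0 : ℝ) 1, |ψ w| ≤ M * min w.2 (1 - w.2) := by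
    rintro ⟨x, y⟩ ⟨hx, hy⟩
    have hx' := Ioc_subset_Icc_self hx
    have mv : ∀ a ∈ Icc (0 : ℝ) 1, |ψ (x, y) - ψ (x, a)| ≤ M * |y - a| := fun a ha =>
      (convex_Icc (0 : ℝ) 1).norm_image_sub_le_of_norm_hasDerivWithin_le
        (f := fun y => ψ (x, y)) (fun b hb => (hψ.hasDerivAt_snd x b).hasDerivWithinAt)
        (fun b hb => hM (x, b) ⟨hx', hb⟩) ha (Ioo_subset_Icc_self hy)
    have m0 := mv 0 (by simp)
    have m1 := mv 1 (by simp)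
    rw [(hw x).1, sub_zero, sub_zero, abs_of_pos hy.1] at m0
    rw [(hw x).2, sub_zero, abs_sub_comm y, abs_of_pos (sub_pos.2 hy.2)] at m1
    rcases min_choice y (1 - y) with h | h <;> simp only [h] <;> assumption
  refine tendsto_nhds_unique_of_eventuallyEq
    (tendsto_integral_mul_of_bounded f (b := partialY ψ)
      (a := fun n => partialY (fun z => wallCutoff n z.2 * ψ z)) (C * M + M)
      (fun n => ((hχ n).mul hψ).partialY.continuous) (fun n hn w hw => ?_) (fun w hw => ?_))
    (tendsto_integral_mul_cutoff g hψ).neg ?_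
  · rw [(hχ n).partialY_mul hψ, hp]
    refine (abs_add_le _ _).trans (add_le_add ?_ ?_)
    · rw [abs_mul]
      have hm0 : 0 ≤ min w.2 (1 - w.2) := le_min hw.2.1.le (by linarith [hw.2.2])
      calc |deriv (wallCutoff n) w.2| * |ψ w|
          ≤ |deriv (wallCutoff n) w.2| * (M * min w.2 (1 - w.2)) :=
            mul_le_mul_of_nonneg_left (key w hw) (abs_nonneg _)
        _ = (|deriv (wallCutoff n) w.2| * min w.2 (1 - w.2)) * M := by ring
        _ ≤ C * M := mul_le_mul_of_nonneg_right (hC n hn w.2 hw.2) hM0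
    · rw [abs_mul]
      exact (mul_le_of_le_one_left (abs_nonneg _) (abs_wallCutoff_le _ _)).trans
        (hM w (mem_closed_channel hw))
  · filter_upwards [wallCutoff_eventually hw.2] with n hn
    rw [(hχ n).partialY_mul hψ, hp, hn.deriv_eq, deriv_const, hn.eq_of_nhds]
    ring
  · filter_upwards [eventually_gt_atTop 0] with n hn
    exact h _ (isTestFunction_cutoff hψ hn)

/-! ### Weak derivatives on the channel as orbit derivatives on the torus -/

theorem dirX_eq_toTorus (s : ℝ) : dirX s = toTorus (s • ((1 : ℝ), (0 : ℝ))) := by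
  simp [dirX_apply, toTorus]

theorem dirY_eq_toTorus (s : ℝ) : dirY s = toTorus (s • ((0 : ℝ), (1 : ℝ))) := by
  simp [dirY_apply, toTorus]

theorem integral_extL_mul (σ : ℝ) (f : L2Omega) {H : Torus → ℝ} (hH : MemLp H 2 volume) :
    ∫ z, extL σ f z * H z =
      ∫ w, f w * (H (toTorus w) + σ * H (toTorus (reflY w))) ∂volOmega := by
  have hi : Integrable (fun z => extL σ f z * H z) := (Lp.memLp _).integrable_mul hH
  rw [integral_torus hi]
  refine integral_congr_ae ?_
  filter_upwards [extL_toTorus σ f, extL_toTorus_reflY σ f] with w h1 h2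
  rw [h1, h2]; ring

namespace IsSmoothTorus

variable {F : Torus → ℝ}

theorem isSmoothPeriodic (hF : IsSmoothTorus F) : IsSmoothPeriodic (fun w => F (toTorus w)) :=
  ⟨hF, fun x y => by
    have : toTorus (x + 1, y) = toTorus (x, y) := by
      simp only [toTorus]; rw [AddCircle.coe_add_period]
    simp only [this]⟩

theorem torusDeriv_dirX (hF : IsSmoothTorus F) (w : ℝ × ℝ) :
    _root_.torusDeriv dirX F (toTorus w) = partialX (fun w => F (toTorus w)) w :=
  hF.torusDeriv_toTorus dirX_eq_toTorus w

theorem torusDeriv_dirY (hF : IsSmoothTorus F) (w : ℝ × ℝ) :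
    _root_.torusDeriv dirY F (toTorus w) = partialY (fun w => F (toTorus w)) w :=
  hF.torusDeriv_toTorus dirY_eq_toTorus w

end IsSmoothTorus

/-- Testing the extension of `f` against `F` on the torus amounts to testing `f` against `F` folded
back onto the channel. -/
theorem hasOrbitDeriv_dirX_extL {f g : L2Omega} (σ : ℝ)
    (h : ∀ η, IsSmoothPeriodic η → ∫ z, f z * partialX η z ∂volOmega = -∫ z, g z * η z ∂volOmega) :
    HasOrbitDeriv dirX (extL σ f) (extL σ g) := by
  refine hasOrbitDeriv_of_forall_smooth continuous_dirX dirX_eq_toTorus fun F hF => ?_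
  rw [integral_extL_mul σ f (hF.torusDeriv dirX_eq_toTorus).memLp, integral_extL_mul σ g hF.memLp]
  have := h _ (hF.isSmoothPeriodic.add_mul_reflY σ)
  simp only [hF.isSmoothPeriodic.partialX_add_mul_reflY] at this
  simpa only [hF.torusDeriv_dirX] using this

/-- The `y`-derivative exchanges even and odd extensions. For the even extension the folded test
function is odd across the walls, so it vanishes there; for the odd extension it need not, and the
hypothesis has to hold for all test functions. -/
theorem hasOrbitDeriv_dirY_extL {f g : L2Omega} {σ : ℝ}
    (h : ∀ η, IsSmoothPeriodic η → (σ = 1 → ∀ x, η (x, 0) = 0 ∧ η (x, 1) = 0) →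
      ∫ z, f z * partialY η z ∂volOmega = -∫ z, g z * η z ∂volOmega) :
    HasOrbitDeriv dirY (extL σ f) (extL (-σ) g) := by
  refine hasOrbitDeriv_of_forall_smooth continuous_dirY dirY_eq_toTorus fun F hF => ?_
  rw [integral_extL_mul σ f (hF.torusDeriv dirY_eq_toTorus).memLp,
    integral_extL_mul (-σ) g hF.memLp]
  have := h _ (hF.isSmoothPeriodic.add_mul_reflY (-σ)) (fun hσ x => ?_)
  · simp only [hF.isSmoothPeriodic.partialY_add_mul_reflY] at this
    simp only [hF.torusDeriv_dirY]
    simpa only [sub_neg_eq_add, neg_mul] using this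
  · have h1 : toTorus (x, -1) = toTorus (x, 1) := by
      have := AddCircle.coe_add_period (2 : ℝ) (-1)
      norm_num at this
      simp only [toTorus]; rw [this]; simp
    simp only [reflY, hσ, neg_zero, h1]
    constructor <;> ring

theorem HasWeakDerivX.hasOrbitDeriv {f g : L2Omega} (h : HasWeakDerivX f g) (σ : ℝ) :
    HasOrbitDeriv dirX (extL σ f) (extL σ g) :=
  hasOrbitDeriv_dirX_extL σ fun _ hη => h.integral_eq hη

/-- The even extension creates no jump at the walls. -/
theorem HasWeakDerivY.hasOrbitDeriv {f g : L2Omega} (h : HasWeakDerivY f g) :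
    HasOrbitDeriv dirY (extL 1 f) (extL (-1) g) :=
  hasOrbitDeriv_dirY_extL fun _ hη hw => h.integral_eq hη (hw rfl)

theorem integral_neg_mul (f : L2Omega) (η : ℝ × ℝ → ℝ) :
    ∫ z, (-f : L2Omega) z * η z ∂volOmega = -∫ z, f z * η z ∂volOmega := by
  rw [← integral_neg]
  refine integral_congr_ae ?_
  filter_upwards [Lp.coeFn_neg f] with z hz
  rw [hz, Pi.neg_apply, neg_mul]

theorem MemH.integral_add_integral {u v : L2Omega} (h : MemH u v) {η : ℝ × ℝ → ℝ}
    (hη : IsSmoothPeriodic η) :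
    (∫ z, u z * partialX η z ∂volOmega) + ∫ z, v z * partialY η z ∂volOmega = 0 := by
  have i1 : Integrable (fun z => u z * partialX η z) volOmega := h.1.integrable_mul hη.partialX.memLp
  have i2 : Integrable (fun z => v z * partialY η z) volOmega :=
    h.2.1.integrable_mul hη.partialY.memLp
  rw [← integral_add i1 i2]
  exact h.2.2 η hη

/-- The wall condition makes the odd extension of `v` differentiable in `y` on the torus, with
`v_y = -u_x`. -/
theorem MemH.hasOrbitDeriv {u v ux : L2Omega} (h : MemH u v) (hx : HasWeakDerivX u ux) :
    HasOrbitDeriv dirY (extL (-1) v) (-extL 1 ux) := by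
  have h1 : HasOrbitDeriv dirY (extL (-1) v) (extL (-(-1)) (-ux)) := by
    refine hasOrbitDeriv_dirY_extL fun η hη _ => ?_
    have := h.integral_add_integral hη
    rw [hx.integral_eq hη] at this
    rw [integral_neg_mul]
    linarith
  rwa [neg_neg, map_neg] at h1

/-- The fundamental lemma of the calculus of variations on the channel. -/
theorem eq_zero_of_forall_test {f : L2Omega}
    (h : ∀ ψ, IsTestFunction ψ → ∫ z, f z * ψ z ∂volOmega = 0) : f = 0 := by
  have h1 : ∀ ψ, IsSmoothPeriodic ψ → ∫ z, f z * ψ z ∂volOmega = 0 := fun ψ hψ => by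
    refine tendsto_nhds_unique_of_eventuallyEq (tendsto_integral_mul_cutoff f hψ)
      tendsto_const_nhds ?_
    filter_upwards [eventually_gt_atTop 0] with n hn
    exact h _ (isTestFunction_cutoff hψ hn)
  have h2 : extL 1 f = 0 := eq_zero_of_forall_smooth fun F hF => by
    rw [integral_extL_mul 1 f hF.memLp]
    exact h1 _ (hF.isSmoothPeriodic.add_mul_reflY 1)
  have h3 := norm_extL_sq 1 f
  rw [h2, norm_zero] at h3
  have : ‖f‖ ^ 2 = 0 := by linarith
  exact norm_eq_zero.1 (pow_eq_zero_iff two_ne_zero |>.1 this)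

theorem MemH.weakDerivY_eq {u v ux vy : L2Omega} (h : MemH u v) (hx : HasWeakDerivX u ux)
    (hy : HasWeakDerivY v vy) : vy = -ux := by
  rw [← sub_eq_zero]
  refine eq_zero_of_forall_test fun ψ hψ => ?_
  have h1 := h.integral_add_integral hψ.1
  rw [hx ψ hψ, hy ψ hψ] at h1
  have i1 : Integrable (fun z => vy z * ψ z) volOmega := (Lp.memLp vy).integrable_mul hψ.1.memLp
  have i2 : Integrable (fun z => (-ux : L2Omega) z * ψ z) volOmega :=
    (Lp.memLp _).integrable_mul hψ.1.memLp
  have h2 : ∫ z, (vy - -ux : L2Omega) z * ψ z ∂volOmega =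
      (∫ z, vy z * ψ z ∂volOmega) - ∫ z, (-ux : L2Omega) z * ψ z ∂volOmega := by
    rw [← integral_sub i1 i2]
    refine integral_congr_ae ?_
    filter_upwards [Lp.coeFn_sub vy (-ux)] with z hz
    rw [hz, Pi.sub_apply, sub_mul]
  rw [h2, integral_neg_mul]; linarith

/-! ### From the torus back to the channel -/

theorem inner_toLp_eq (f : L2Omega) {η : ℝ × ℝ → ℝ} (hη : MemLp η 2 volOmega) :
    inner ℝ f (hη.toLp η) = ∫ z, f z * η z ∂volOmega := by
  rw [real_inner_eq_integral_mul]
  refine integral_congr_ae ?_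
  filter_upwards [hη.coeFn_toLp] with z hz
  rw [hz]

theorem integral_toLp_mul {η : ℝ × ℝ → ℝ} (hη : MemLp η 2 volOmega) (ψ : ℝ × ℝ → ℝ) :
    ∫ z, (hη.toLp η) z * ψ z ∂volOmega = ∫ z, η z * ψ z ∂volOmega := by
  refine integral_congr_ae ?_
  filter_upwards [hη.coeFn_toLp] with z hz
  rw [hz]

theorem IsSmoothPeriodic.hasOrbitDeriv_dirX {ψ : ℝ × ℝ → ℝ} (h : IsSmoothPeriodic ψ) (σ : ℝ) :
    HasOrbitDeriv dirX (extL σ (h.memLp.toLp ψ)) (extL σ (h.partialX.memLp.toLp _)) := by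
  refine hasOrbitDeriv_dirX_extL σ fun η hη => ?_
  rw [integral_toLp_mul, integral_toLp_mul, h.integral_mul_partialX hη]

theorem IsSmoothPeriodic.hasOrbitDeriv_dirY {ψ : ℝ × ℝ → ℝ} (h : IsSmoothPeriodic ψ) :
    HasOrbitDeriv dirY (extL 1 (h.memLp.toLp ψ)) (extL (-1) (h.partialY.memLp.toLp _)) := by
  refine hasOrbitDeriv_dirY_extL fun η hη hw => ?_
  rw [integral_toLp_mul, integral_toLp_mul, h.integral_mul_partialY hη]
  · intro x; rw [(hw rfl x).1, mul_zero]
  · intro x; rw [(hw rfl x).2, mul_zero]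

theorem IsTestFunction.hasOrbitDeriv_dirY {ψ : ℝ × ℝ → ℝ} (h : IsTestFunction ψ) (σ : ℝ) :
    HasOrbitDeriv dirY (extL σ (h.1.memLp.toLp ψ)) (extL (-σ) (h.1.partialY.memLp.toLp _)) := by
  refine hasOrbitDeriv_dirY_extL fun η hη _ => ?_
  rw [integral_toLp_mul, integral_toLp_mul, h.1.integral_mul_partialY hη]
  · intro x; rw [(h.eq_zero_wall x).1, zero_mul]
  · intro x; rw [(h.eq_zero_wall x).2, zero_mul]

theorem inner_resL (σ : ℝ) (F : L2T) (f : L2Omega) :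
    inner ℝ (resL σ F) f = inner ℝ F (extL σ f) := by
  rw [real_inner_comm, ← inner_extL, real_inner_comm]

theorem HasOrbitDeriv.hasWeakDerivX_resL {W W' : L2T} (h : HasOrbitDeriv dirX W W') (σ : ℝ) :
    HasWeakDerivX (resL σ W) (resL σ W') := fun ψ hψ => by
  rw [← inner_toLp_eq _ hψ.1.partialX.memLp, ← inner_toLp_eq _ hψ.1.memLp, inner_resL, inner_resL,
    h.inner_right (hψ.1.hasOrbitDeriv_dirX σ), neg_neg]

theorem HasOrbitDeriv.hasWeakDerivY_resL {W W' : L2T} (h : HasOrbitDeriv dirY W W') (σ : ℝ) :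
    HasWeakDerivY (resL σ W) (resL (-σ) W') := fun ψ hψ => by
  have h1 := hψ.hasOrbitDeriv_dirY (-σ)
  rw [neg_neg] at h1
  rw [← inner_toLp_eq _ hψ.1.partialY.memLp, ← inner_toLp_eq _ hψ.1.memLp, inner_resL, inner_resL,
    h.inner_right h1, neg_neg]

/-- Folding an even and an odd component back yields a field with the wall condition of `𝓗`. -/
theorem memH_resL {W₁ W₂ W' : L2T} (h₁ : HasOrbitDeriv dirX W₁ W') (h₂ : HasOrbitDeriv dirY W₂ (-W')) :
    MemH (resL 1 W₁) (resL (-1) W₂) := by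
  refine ⟨Lp.memLp _, Lp.memLp _, fun ψ hψ => ?_⟩
  have i1 : Integrable (fun z => resL 1 W₁ z * partialX ψ z) volOmega :=
    (Lp.memLp _).integrable_mul hψ.partialX.memLp
  have i2 : Integrable (fun z => resL (-1) W₂ z * partialY ψ z) volOmega :=
    (Lp.memLp _).integrable_mul hψ.partialY.memLp
  rw [integral_add i1 i2, ← inner_toLp_eq _ hψ.partialX.memLp, ← inner_toLp_eq _ hψ.partialY.memLp,
    inner_resL, inner_resL]
  have e1 := h₁.inner_right (hψ.hasOrbitDeriv_dirX 1)
  have e2 := h₂.inner_right hψ.hasOrbitDeriv_dirY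
  rw [inner_neg_left] at e2
  linarith

/-- The test fields on the torus become admissible test fields on the channel. -/
theorem memV_resL {W₁ W₂ W₁x W₁y W₂x : L2T} (h₁ : HasOrbitDeriv dirX W₁ W₁x)
    (h₁' : HasOrbitDeriv dirY W₁ W₁y) (h₂ : HasOrbitDeriv dirX W₂ W₂x)
    (h₂' : HasOrbitDeriv dirY W₂ (-W₁x)) : MemV (resL 1 W₁) (resL (-1) W₂) :=
  ⟨memH_resL h₁ h₂', ⟨⟨_, h₁.hasWeakDerivX_resL 1⟩, ⟨_, h₁'.hasWeakDerivY_resL 1⟩⟩,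
    ⟨_, h₂.hasWeakDerivX_resL (-1)⟩, ⟨_, h₂'.hasWeakDerivY_resL (-1)⟩⟩

/-! ### The horizontal mean on the channel -/

instance isFiniteMeasure_volI : IsFiniteMeasure volI := by
  unfold volI; infer_instance

theorem ae_volOmega_of_ae_volI {p : ℝ → Prop} (h : ∀ᵐ y ∂volI, p y) : ∀ᵐ w ∂volOmega, p w.2 :=
  measurePreserving_snd_volOmega.quasiMeasurePreserving.ae h

theorem ae_volI_of_ae_volOmega {p : ℝ × ℝ → Prop} (h : ∀ᵐ w ∂volOmega, p w) :
    ∀ᵐ y ∂volI, ∀ᵐ x ∂(volume.restrict (Ioc (0 : ℝ) 1)), p (x, y) := by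
  have h1 := (Measure.measurePreserving_swap (μ := volI)
    (ν := volume.restrict (Ioc (0 : ℝ) 1))).quasiMeasurePreserving.ae (p := p) h
  exact Measure.ae_ae_of_ae_prod h1

theorem hmean_eq_integral (f : ℝ × ℝ → ℝ) (y : ℝ) :
    hmean f y = ∫ x in Ioc (0 : ℝ) 1, f (x, y) := by
  rw [hmean, intervalIntegral.integral_of_le zero_le_one]

theorem aestronglyMeasurable_hmean (f : L2Omega) : AEStronglyMeasurable (hmean f) volI := by
  have h := (Lp.stronglyMeasurable f)
  have h1 : StronglyMeasurable fun y => ∫ x in Ioc (0 : ℝ) 1, f (x, y) :=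
    h.integral_prod_left'
  rw [show hmean f = fun y => ∫ x in Ioc (0 : ℝ) 1, f (x, y) from funext (hmean_eq_integral f)]
  exact h1.aestronglyMeasurable

theorem meanX_toTorus {F : L2T} {f : ℝ × ℝ → ℝ} (h : ∀ᵐ w ∂volOmega, F (toTorus w) = f w) :
    ∀ᵐ w ∂volOmega, meanX F (toTorus w) = hmean f w.2 := by
  filter_upwards [ae_toTorus (meanX_ae F), ae_volOmega_of_ae_volI (ae_volI_of_ae_volOmega h)]
    with w h1 h2
  have h3 := AddCircle.integral_preimage 1 0 (fun x => F (x, (w.2 : AddCircle (2 : ℝ))))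
  rw [zero_add] at h3
  rw [h1, hmean_eq_integral]
  exact h3.symm.trans (integral_congr_ae h2)

theorem meanX_toTorus_reflY {F : L2T} {f : ℝ × ℝ → ℝ}
    (h : ∀ᵐ w ∂volOmega, F (toTorus (reflY w)) = f w) :
    ∀ᵐ w ∂volOmega, meanX F (toTorus (reflY w)) = hmean f w.2 := by
  filter_upwards [ae_toTorus_reflY (meanX_ae F),
    ae_volOmega_of_ae_volI (ae_volI_of_ae_volOmega h)] with w h1 h2
  have h3 := AddCircle.integral_preimage 1 0 (fun x => F (x, ((-w.2 : ℝ) : AddCircle (2 : ℝ))))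
  rw [zero_add] at h3
  rw [h1, hmean_eq_integral]
  exact h3.symm.trans (integral_congr_ae h2)

theorem memLp_hmean (f : L2Omega) : MemLp (hmean f) 2 volI := by
  have h1 : MemLp (fun w => meanX (extL 1 f) (toTorus w)) 2 volOmega :=
    ((memLp_map_measure_iff ((Lp.aestronglyMeasurable _).mono_measure map_toTorus_le)
      measurable_toTorus.aemeasurable).1 ((Lp.memLp _).mono_measure map_toTorus_le))
  have h2 : MemLp (fun w : ℝ × ℝ => hmean f w.2) 2 volOmega :=
    h1.ae_eq (meanX_toTorus (extL_toTorus 1 f))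
  rw [← measurePreserving_snd_volOmega.map_eq]
  refine (memLp_map_measure_iff ?_ measurable_snd.aemeasurable).2 h2
  rw [measurePreserving_snd_volOmega.map_eq]
  exact aestronglyMeasurable_hmean f

/-- The horizontal mean as an element of `L²(0,1)`. -/
def hmeanLp (f : L2Omega) : L2I := (memLp_hmean f).toLp _

theorem hmeanLp_ae (f : L2Omega) : hmeanLp f =ᵐ[volI] hmean f := (memLp_hmean f).coeFn_toLp

theorem liftY_ae (φ : L2I) : liftY φ =ᵐ[volOmega] fun w => φ w.2 :=
  Lp.coeFn_compMeasurePreserving φ measurePreserving_snd_volOmega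

theorem liftY_hmeanLp_ae (f : L2Omega) : liftY (hmeanLp f) =ᵐ[volOmega] fun w => hmean f w.2 := by
  filter_upwards [liftY_ae (hmeanLp f), ae_volOmega_of_ae_volI (hmeanLp_ae f)] with w h1 h2
  rw [h1, h2]

theorem liftY_sub (φ χ : L2I) : liftY (φ - χ) = liftY φ - liftY χ := map_sub _ _ _

theorem norm_liftY (φ : L2I) : ‖liftY φ‖ = ‖φ‖ := Lp.norm_compMeasurePreserving φ _

/-- The horizontal mean commutes with the extension to the torus. -/
theorem meanX_extL (σ : ℝ) (f : L2Omega) : meanX (extL σ f) = extL σ (liftY (hmeanLp f)) := by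
  refine Lp_ext_torus ?_ ?_
  · filter_upwards [meanX_toTorus (extL_toTorus σ f), extL_toTorus σ (liftY (hmeanLp f)),
      liftY_hmeanLp_ae f] with w h1 h2 h3
    rw [h1, h2, h3]
  · filter_upwards [meanX_toTorus_reflY (extL_toTorus_reflY σ f),
      extL_toTorus_reflY σ (liftY (hmeanLp f)), liftY_hmeanLp_ae f] with w h1 h2 h3
    rw [h1, h2, h3]
    exact intervalIntegral.integral_const_mul _ _

theorem osc_ae (f : L2Omega) : osc f =ᵐ[volOmega] (f - liftY (hmeanLp f) : L2Omega) := by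
  filter_upwards [liftY_hmeanLp_ae f, Lp.coeFn_sub f (liftY (hmeanLp f))] with w h1 h2
  rw [h2, Pi.sub_apply, h1, osc]

/-- A primitive of a smooth function is smooth. -/
theorem exists_smooth_primitive {η : ℝ → ℝ} (hη : ContDiff ℝ ((⊤ : ℕ∞) : WithTop ℕ∞) η) :
    ∃ Φ : ℝ → ℝ, ContDiff ℝ ((⊤ : ℕ∞) : WithTop ℕ∞) Φ ∧ ∀ y, HasDerivAt Φ (η y) y := by
  have hd : ∀ y, HasDerivAt (fun y => ∫ s in (0 : ℝ)..y, η s) (η y) y := fun y =>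
    (hη.continuous.integral_hasStrictDerivAt 0 y).hasDerivAt
  refine ⟨_, contDiff_infty_iff_deriv.2 ⟨fun y => (hd y).differentiableAt, ?_⟩, hd⟩
  rwa [show deriv (fun y => ∫ s in (0 : ℝ)..y, η s) = η from funext fun y => (hd y).deriv]

theorem integral_liftY_mul (φ : L2I) {H : ℝ × ℝ → ℝ} (hH : MemLp H 2 volOmega) :
    ∫ z, liftY φ z * H z ∂volOmega = ∫ y, φ y * (∫ x in Ioc (0 : ℝ) 1, H (x, y)) ∂volI := by
  have e1 : (fun z => liftY φ z * H z) =ᵐ[volOmega] fun z => φ z.2 * H z := by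
    filter_upwards [liftY_ae φ] with z hz
    rw [hz]
  have hi : Integrable (fun z => φ z.2 * H z) volOmega :=
    (show Integrable (fun z => liftY φ z * H z) volOmega from
      (Lp.memLp (liftY φ)).integrable_mul hH).congr e1
  rw [integral_congr_ae e1]
  refine (integral_prod_symm (μ := volume.restrict (Ioc (0 : ℝ) 1))
    (ν := volume.restrict (Ioo (0 : ℝ) 1)) _ hi).trans ?_
  refine integral_congr_ae (Eventually.of_forall fun y => ?_)
  exact integral_const_mul (φ y) fun x => H (x, y)

theorem hasWeakDerivX_liftY (φ : L2I) : HasWeakDerivX (liftY φ) 0 := fun ψ hψ => by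
  have h0 : ∀ y, ∫ x in Ioc (0 : ℝ) 1, partialX ψ (x, y) = 0 := fun y => by
    rw [← intervalIntegral.integral_of_le zero_le_one,
      intervalIntegral.integral_eq_sub_of_hasDerivAt (fun x _ => hψ.1.hasDerivAt_fst x y)
        ((hψ.1.partialX.continuous.comp
          (by fun_prop : Continuous fun x : ℝ => (x, y))).intervalIntegrable _ _)]
    have := hψ.1.2 0 y
    rw [zero_add] at this
    rw [this, sub_self]
  rw [integral_liftY_mul φ hψ.1.partialX.memLp]
  have h1 : ∫ z, (0 : L2Omega) z * ψ z ∂volOmega = 0 := by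
    refine integral_eq_zero_of_ae ?_
    filter_upwards [Lp.coeFn_zero ℝ 2 volOmega] with z hz
    rw [hz]; simp
  rw [h1]
  simp [h0]

/-- The wall-normal velocity of a field in `𝓗` has zero flux through every horizontal line. -/
theorem MemH.hmean_eq_zero {u v : L2Omega} (h : MemH u v) : hmeanLp v = 0 := by
  have key : ∀ η : ℝ → ℝ, ContDiff ℝ ((⊤ : ℕ∞) : WithTop ℕ∞) η →
      ∫ y, η y * hmean v y ∂volI = 0 := fun η hη => by
    obtain ⟨Φ, hΦ, hd⟩ := exists_smooth_primitive hη
    have hs := isSmoothPeriodic_of_snd hΦ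
    have hy : ∀ z, partialY (fun z : ℝ × ℝ => Φ z.2) z = η z.2 := fun z =>
      (hs.hasDerivAt_snd z.1 z.2).unique (hd z.2)
    have hx : ∀ z, partialX (fun z : ℝ × ℝ => Φ z.2) z = 0 := fun z =>
      (hs.hasDerivAt_fst z.1 z.2).unique (hasDerivAt_const z.1 (Φ z.2))
    have h1 := h.2.2 _ hs
    simp only [hx, hy, mul_zero, zero_add] at h1
    have hi : Integrable (fun z : ℝ × ℝ => v z * η z.2) volOmega :=
      (Lp.memLp v).integrable_mul (isSmoothPeriodic_of_snd hη).memLp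
    have h2 := integral_prod_symm (μ := volume.restrict (Ioc (0 : ℝ) 1))
      (ν := volume.restrict (Ioo (0 : ℝ) 1)) _ hi
    rw [← h1]
    refine Eq.trans ?_ h2.symm
    refine integral_congr_ae (Eventually.of_forall fun y => ?_)
    simp only
    rw [integral_mul_const, hmean_eq_integral, mul_comm]
  have hz : ∀ᵐ y ∂volume, y ∈ Ioo (0 : ℝ) 1 → hmean v y = 0 := by
    refine isOpen_Ioo.ae_eq_zero_of_integral_contDiff_smul_eq_zero ?_ fun η hη _ hsupp => ?_
    · refine IntegrableOn.locallyIntegrableOn ?_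
      exact (memLp_hmean v).integrable (by norm_num)
    · rw [← key η hη, volI, setIntegral_eq_integral_of_forall_compl_eq_zero]
      · rfl
      · intro y hy
        rw [image_eq_zero_of_notMem_tsupport (fun h => hy (hsupp h)), zero_mul]
  refine Lp.ext ?_
  have hz' : ∀ᵐ y ∂volI, hmean v y = 0 := (ae_restrict_iff' measurableSet_Ioo).2 hz
  filter_upwards [hmeanLp_ae v, hz', Lp.coeFn_zero ℝ 2 volI] with y h1 h2 h3
  rw [h1, h2, h3]; rfl

theorem liftY_zero : liftY 0 = 0 := map_zero _

theorem MemH.meanX_eq_zero {u v : L2Omega} (h : MemH u v) (σ : ℝ) : meanX (extL σ v) = 0 := by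
  rw [meanX_extL, h.hmean_eq_zero, liftY_zero, map_zero]

theorem MemH.osc {u v : L2Omega} (h : MemH u v) : MemH (osc u) v := by
  have hu : MemLp (_root_.osc u) 2 volOmega := (Lp.memLp _).ae_eq (osc_ae u).symm
  refine ⟨hu, h.2.1, fun ψ hψ => ?_⟩
  have i1 : Integrable (fun z => u z * partialX ψ z + v z * partialY ψ z) volOmega :=
    (show Integrable (fun z => u z * partialX ψ z) volOmega from
      h.1.integrable_mul hψ.partialX.memLp).add
    (show Integrable (fun z => v z * partialY ψ z) volOmega from
      h.2.1.integrable_mul hψ.partialY.memLp)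
  have i2 : Integrable (fun z => liftY (hmeanLp u) z * partialX ψ z) volOmega :=
    (Lp.memLp _).integrable_mul hψ.partialX.memLp
  have h1 := (hasWeakDerivX_liftY (hmeanLp u)).integral_eq hψ
  have h2 : ∫ z, (0 : L2Omega) z * ψ z ∂volOmega = 0 := by
    refine integral_eq_zero_of_ae ?_
    filter_upwards [Lp.coeFn_zero ℝ 2 volOmega] with z hz
    rw [hz]; simp
  rw [h2, neg_zero] at h1
  have h3 := integral_sub i1 i2
  rw [h.2.2 ψ hψ, h1, sub_zero] at h3
  rw [← h3]
  refine integral_congr_ae ?_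
  filter_upwards [liftY_hmeanLp_ae u] with z hz
  rw [hz, _root_.osc]; ring

/-! ### Divergence-free fields on the torus and the convection form -/

/-- A velocity field together with the derivatives that matter: `(u, v, u_x, u_y, v_x)`. -/
abbrev Jet : Type := Fin 5 → L2T

/-- The five entries are the velocity and its derivatives, and `v_y = -u_x`. -/
structure IsDivFree (y : Jet) : Prop where
  grad₁ : HasGrad (y 0) (y 2) (y 3)
  grad₂ : HasGrad (y 1) (y 4) (-(y 2))

/-- The space of jets of divergence-free fields. -/
def divFree : Submodule ℝ Jet where
  carrier := {y | IsDivFree y}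
  zero_mem' := by
    rw [mem_ofPred_eq]
    have h : ∀ e, HasOrbitDeriv e 0 0 := fun e => HasOrbitDeriv.zero
    exact ⟨⟨h _, h _⟩, ⟨h _, by simpa using h dirY⟩⟩
  add_mem' := fun {a b} ha hb => by
    rw [mem_ofPred_eq] at *
    refine ⟨⟨ha.1.1.add hb.1.1, ha.1.2.add hb.1.2⟩, ⟨ha.2.1.add hb.2.1, ?_⟩⟩
    have := ha.2.2.add hb.2.2
    rwa [← neg_add] at this
  smul_mem' := fun c a ha => by
    rw [mem_ofPred_eq] at *
    refine ⟨⟨ha.1.1.smul c, ha.1.2.smul c⟩, ⟨ha.2.1.smul c, ?_⟩⟩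
    have := ha.2.2.smul c
    rwa [smul_neg] at this

/-- Translation of a jet. -/
def jetShift (a : Torus) (y : Jet) : Jet := fun i => tshift a (y i)

theorem IsDivFree.jetShift {y : Jet} (h : IsDivFree y) (a : Torus) : IsDivFree (jetShift a y) :=
  ⟨⟨h.1.1.comp_tshift a, h.1.2.comp_tshift a⟩, ⟨h.2.1.comp_tshift a, by
    have := h.2.2.comp_tshift a
    rwa [map_neg] at this⟩⟩

theorem IsDivFree.sub {y z : Jet} (hy : IsDivFree y) (hz : IsDivFree z) : IsDivFree (y - z) :=
  divFree.sub_mem hy hz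

/-- The convection form `∫ [(a·∇)b]·c`. -/
def convForm (a b c : Jet) : ℝ :=
  tri (a 0) (b 2) (c 0) + tri (a 1) (b 3) (c 0) + (tri (a 0) (b 4) (c 1) - tri (a 1) (b 2) (c 1))

section Conv

variable {a a' b b' c c' : Jet}

theorem IsDivFree.triInt₀₀ (ha : IsDivFree a) (hc : IsDivFree c) (g : L2T) :
    TriInt (a 0) g (c 0) := triInt_of_hasOrbitDeriv ha.1.2 g hc.1.1
theorem IsDivFree.triInt₁₀ (ha : IsDivFree a) (hc : IsDivFree c) (g : L2T) :
    TriInt (a 1) g (c 0) := triInt_of_hasOrbitDeriv ha.2.2 g hc.1.1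
theorem IsDivFree.triInt₀₁ (ha : IsDivFree a) (hc : IsDivFree c) (g : L2T) :
    TriInt (a 0) g (c 1) := triInt_of_hasOrbitDeriv ha.1.2 g hc.2.1
theorem IsDivFree.triInt₁₁ (ha : IsDivFree a) (hc : IsDivFree c) (g : L2T) :
    TriInt (a 1) g (c 1) := triInt_of_hasOrbitDeriv ha.2.2 g hc.2.1

theorem convForm_sub₁ (ha : IsDivFree a) (ha' : IsDivFree a') (b : Jet) (hc : IsDivFree c) :
    convForm (a - a') b c = convForm a b c - convForm a' b c := by
  simp only [convForm, Pi.sub_apply]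
  rw [tri_sub₁ (ha.triInt₀₀ hc _) (ha'.triInt₀₀ hc _), tri_sub₁ (ha.triInt₁₀ hc _) (ha'.triInt₁₀ hc _),
    tri_sub₁ (ha.triInt₀₁ hc _) (ha'.triInt₀₁ hc _), tri_sub₁ (ha.triInt₁₁ hc _) (ha'.triInt₁₁ hc _)]
  ring

theorem convForm_sub₂ (ha : IsDivFree a) (b b' : Jet) (hc : IsDivFree c) :
    convForm a (b - b') c = convForm a b c - convForm a b' c := by
  simp only [convForm, Pi.sub_apply]
  rw [tri_sub₂ (ha.triInt₀₀ hc _) (ha.triInt₀₀ hc _), tri_sub₂ (ha.triInt₁₀ hc _) (ha.triInt₁₀ hc _),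
    tri_sub₂ (ha.triInt₀₁ hc _) (ha.triInt₀₁ hc _), tri_sub₂ (ha.triInt₁₁ hc _) (ha.triInt₁₁ hc _)]
  ring

theorem convForm_add₃ (ha : IsDivFree a) (b : Jet) (hc : IsDivFree c) (hc' : IsDivFree c') :
    convForm a b (c + c') = convForm a b c + convForm a b c' := by
  simp only [convForm, Pi.add_apply]
  rw [tri_add₃ (ha.triInt₀₀ hc _) (ha.triInt₀₀ hc' _), tri_add₃ (ha.triInt₁₀ hc _) (ha.triInt₁₀ hc' _),
    tri_add₃ (ha.triInt₀₁ hc _) (ha.triInt₀₁ hc' _), tri_add₃ (ha.triInt₁₁ hc _) (ha.triInt₁₁ hc' _)]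
  ring

theorem convForm_smul_smul (s : ℝ) (a b c : Jet) :
    convForm (s • a) b (s • c) = s ^ 2 * convForm a b c := by
  simp only [convForm, Pi.smul_apply, tri_smul₁, tri_smul₃]; ring

theorem convForm_jetShift (z : Torus) (a b c : Jet) :
    convForm (jetShift z a) (jetShift z b) (jetShift z c) = convForm a b c := by
  simp only [convForm, jetShift, tri_tshift]

/-- Convection by a divergence-free field does no work. -/
theorem convForm_self (ha : IsDivFree a) (hc : IsDivFree c) : convForm a c c = 0 := by
  have h1 := tri_leibniz continuous_dirX ha.1 hc.1 hc.1 ha.1.1 hc.1.1 hc.1.1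
  have h2 := tri_leibniz continuous_dirY ha.2 hc.1 hc.1 ha.2.2 hc.1.2 hc.1.2
  have h3 := tri_leibniz continuous_dirX ha.1 hc.2 hc.2 ha.1.1 hc.2.1 hc.2.1
  have h4 := tri_leibniz continuous_dirY ha.2 hc.2 hc.2 ha.2.2 hc.2.2 hc.2.2
  simp only [tri_neg₁, tri_neg₂, tri_neg₃] at h2 h4
  rw [tri_comm₂₃ _ _ (c 2)] at h1
  rw [tri_comm₂₃ _ _ (c 3)] at h2
  rw [tri_comm₂₃ _ _ (c 4)] at h3
  rw [tri_comm₂₃ (a 1) _ (c 2)] at h4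
  unfold convForm
  linarith

end Conv

/-- The right-hand side of the weak equation for the velocity jet `U`, tested with `y`. -/
def weakRhs (U y : Jet) : ℝ := -(inner ℝ (U 2) (y 2) + inner ℝ (U 4) (y 4)) - convForm U U y

theorem weakRhs_add {U y y' : Jet} (hU : IsDivFree U) (hy : IsDivFree y) (hy' : IsDivFree y') :
    weakRhs U (y + y') = weakRhs U y + weakRhs U y' := by
  rw [weakRhs, convForm_add₃ hU U hy hy', Pi.add_apply, Pi.add_apply, inner_add_right,
    inner_add_right, weakRhs, weakRhs]
  ring

theorem weakRhs_jetShift (z : Torus) (U y : Jet) :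
    weakRhs (jetShift z U) y = weakRhs U (jetShift (-z) y) := by
  have h : jetShift z (jetShift (-z) y) = y := by
    funext i; simp [jetShift, tshift_tshift, tshift_zero]
  have h1 := convForm_jetShift z U U (jetShift (-z) y)
  rw [h] at h1
  rw [weakRhs, weakRhs, ← h1]
  simp only [jetShift, inner_tshift]

/-- The weak equation makes sense with every divergence-free test jet. The bound
is linear in the quantities that are only square integrable in time. -/
theorem abs_weakRhs_le {U y : Jet} {q : L2T} (hU : IsDivFree U) (hq : HasOrbitDeriv dirY (U 2) q)
    (hy : IsDivFree y) : |weakRhs U y| ≤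
      8 * ((1 + ‖U 0‖ + ‖U 1‖ + ‖U 3‖) * (‖U 1‖ + ‖U 2‖ + ‖U 4‖ + ‖q‖)) * ‖y‖ := by
  have h0 := norm_le_pi_norm y 0
  have h1 := norm_le_pi_norm y 1
  have h2 := norm_le_pi_norm y 2
  have h4 := norm_le_pi_norm y 4
  have i2 := (abs_real_inner_le_norm (U 2) (y 2)).trans (mul_le_mul_of_nonneg_left h2 (norm_nonneg _))
  have i4 := (abs_real_inner_le_norm (U 4) (y 4)).trans (mul_le_mul_of_nonneg_left h4 (norm_nonneg _))
  have t1 := abs_tri_le hU.1.2 (U 2) hy.1.1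
  have t2 := abs_tri_le hU.2.2 (U 3) hy.1.1
  have t3 := abs_tri_le hU.1.2 (U 4) hy.2.1
  -- `u_x` and not `v` carries the `y`-derivative: `∂_y v = -u_x` would make the bound quadratic in
  -- `‖u_x‖`, hence only integrable in time
  have t4 := abs_tri_le hq (U 1) hy.2.1
  rw [tri_comm₁₂] at t4
  rw [norm_neg] at t2
  have s1 : ‖y 0‖ + ‖y 2‖ ≤ 2 * ‖y‖ := by linarith
  have s2 : ‖y 1‖ + ‖y 4‖ ≤ 2 * ‖y‖ := by linarith
  replace t1 := t1.trans (mul_le_mul_of_nonneg_left s1 (by positivity))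
  replace t2 := t2.trans (mul_le_mul_of_nonneg_left s1 (by positivity))
  replace t3 := t3.trans (mul_le_mul_of_nonneg_left s2 (by positivity))
  replace t4 := t4.trans (mul_le_mul_of_nonneg_left s2 (by positivity))
  have key : |weakRhs U y| ≤ ‖U 2‖ * ‖y‖ + ‖U 4‖ * ‖y‖ +
      (2 * (‖U 0‖ + ‖U 3‖) * ‖U 2‖ * (2 * ‖y‖) + 2 * (‖U 1‖ + ‖U 2‖) * ‖U 3‖ * (2 * ‖y‖) +
      (2 * (‖U 0‖ + ‖U 3‖) * ‖U 4‖ * (2 * ‖y‖) + 2 * (‖U 2‖ + ‖q‖) * ‖U 1‖ * (2 * ‖y‖))) := by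
    rw [weakRhs, convForm]
    rw [abs_le] at *
    constructor <;> linarith [i2.1, i2.2, i4.1, i4.2, t1.1, t1.2, t2.1, t2.2, t3.1, t3.2, t4.1, t4.2]
  refine key.trans ?_
  have : 0 ≤ ‖y‖ * (8 * ‖U 1‖ + 7 * ‖U 2‖ + 7 * ‖U 4‖ + 8 * ‖q‖ +
      ‖U 0‖ * (8 * ‖U 1‖ + 4 * ‖U 2‖ + 4 * ‖U 4‖ + 8 * ‖q‖) +
      ‖U 1‖ * (8 * ‖U 1‖ + 4 * ‖U 2‖ + 8 * ‖U 4‖ + 4 * ‖q‖) +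
      ‖U 3‖ * (4 * ‖U 1‖ + 4 * ‖U 4‖ + 8 * ‖q‖)) := by positivity
  linarith

/-- The difference of two solutions loses energy by viscosity and exchanges it only with the
second solution. -/
theorem weakRhs_sub_self {U U' : Jet} (hU : IsDivFree U) (hU' : IsDivFree U') :
    weakRhs U' (U' - U) - weakRhs U (U' - U) =
      -(‖(U' - U) 2‖ ^ 2 + ‖(U' - U) 4‖ ^ 2) - convForm (U' - U) U (U' - U) := by
  have hW := hU'.sub hU
  have h1 := convForm_self hU' hW
  rw [convForm_sub₂ hU' U' U hW] at h1
  have h2 := convForm_sub₁ hU' hU U hW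
  rw [h2, weakRhs, weakRhs]
  have e : ∀ i, ‖(U' - U) i‖ ^ 2 = inner ℝ (U' i) ((U' - U) i) - inner ℝ (U i) ((U' - U) i) :=
    fun i => by rw [← inner_sub_left, ← Pi.sub_apply, real_inner_self_eq_norm_sq]
  rw [e, e]
  linarith

/-- The trilinear estimate with the derivatives of two factors absorbed by viscosity. -/
theorem abs_tri_le_of_dissipation {f fy h hx : L2T} (hf : HasOrbitDeriv dirY f fy) (g : L2T)
    (hh : HasOrbitDeriv dirX h hx) :
    |tri f g h| ≤ (‖g‖ + 16 * ‖g‖ ^ 2) * (‖f‖ ^ 2 + ‖h‖ ^ 2) +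
      1 / 16 * (‖fy‖ ^ 2 + ‖hx‖ ^ 2) := by
  -- the scale balances the derivative part against a fixed fraction of the dissipation
  set δ : ℝ := (1 + 16 * ‖g‖)⁻¹ with hδ
  have hp : 0 < 1 + 16 * ‖g‖ := by positivity
  have h1 := abs_tri_le_scale hf g hh (δ := δ) (inv_pos.2 hp)
    (inv_le_one_of_one_le₀ (by linarith [norm_nonneg g]))
  have h2 : ‖g‖ * δ ≤ 1 / 16 := by
    rw [hδ, ← div_eq_mul_inv, div_le_iff₀ hp]; linarith
  have h3 : ‖g‖ * δ⁻¹ = ‖g‖ + 16 * ‖g‖ ^ 2 := by rw [hδ, inv_inv]; ring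
  calc |tri f g h| ≤ _ := h1
    _ = (‖g‖ * δ⁻¹) * (‖f‖ ^ 2 + ‖h‖ ^ 2) + (‖g‖ * δ) * (‖fy‖ ^ 2 + ‖hx‖ ^ 2) := by ring
    _ ≤ _ := by
      rw [h3]
      exact add_le_add le_rfl (mul_le_mul_of_nonneg_right h2 (by positivity))

/-- Kinetic energy of a jet, without the factor `1 / 2`. -/
def energy (y : Jet) : ℝ := ‖y 0‖ ^ 2 + ‖y 1‖ ^ 2

theorem energy_nonneg (y : Jet) : 0 ≤ energy y := by unfold energy; positivity

/-- The coefficient in the Gronwall estimate for differences of solutions. -/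
def gronwallCoeff (U : Jet) (q : L2T) : ℝ :=
  100 * (1 + ‖U 2‖ ^ 2 + ‖U 3‖ ^ 2 + ‖U 4‖ ^ 2 + ‖q‖ ^ 2)

theorem gronwallCoeff_nonneg (U : Jet) (q : L2T) : 0 ≤ gronwallCoeff U q := by
  unfold gronwallCoeff; positivity

/-- The difference of two solutions, transported along the first, is controlled by its energy and by
half of its own dissipation. In `w₀ u_x w₀`, the `y`-derivative falls on `u_x`, because `w` has no
controlled `∂_y w₀`. -/
theorem abs_convForm_le {U w : Jet} {q : L2T} (hq : HasOrbitDeriv dirY (U 2) q)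
    (hw : IsDivFree w) :
    |convForm w U w| ≤ gronwallCoeff U q * energy w + 1 / 2 * (‖w 2‖ ^ 2 + ‖w 4‖ ^ 2) := by
  have t1 := abs_tri_le hq (w 0) hw.1.1
  rw [tri_comm₁₂] at t1
  have t2 := abs_tri_le_of_dissipation hw.2.2 (U 3) hw.1.1
  have t3 := abs_tri_le_of_dissipation hw.2.2 (U 4) hw.1.1
  have t4 := abs_tri_le_of_dissipation hw.2.2 (U 2) hw.2.1
  rw [tri_comm₁₂, tri_comm₂₃, tri_comm₁₂] at t3
  rw [tri_comm₁₂, tri_comm₁₂] at t4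
  rw [norm_neg] at t2 t3 t4
  have s1 : 2 * (‖U 2‖ + ‖q‖) * ‖w 0‖ * (‖w 0‖ + ‖w 2‖) ≤
      (1 + 18 * (‖U 2‖ ^ 2 + ‖q‖ ^ 2)) * ‖w 0‖ ^ 2 + 1 / 8 * ‖w 2‖ ^ 2 := by
    set m := ‖U 2‖ + ‖q‖
    have hm : m ^ 2 ≤ 2 * (‖U 2‖ ^ 2 + ‖q‖ ^ 2) := by
      simp only [m]; nlinarith [sq_nonneg (‖U 2‖ - ‖q‖)]
    have a1 : 2 * m * ‖w 0‖ * ‖w 2‖ ≤ 8 * m ^ 2 * ‖w 0‖ ^ 2 + 1 / 8 * ‖w 2‖ ^ 2 := by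
      nlinarith [sq_nonneg (8 * m * ‖w 0‖ - ‖w 2‖)]
    have a2 : 2 * m * ‖w 0‖ ^ 2 ≤ (1 + m ^ 2) * ‖w 0‖ ^ 2 :=
      mul_le_mul_of_nonneg_right (by nlinarith [sq_nonneg (m - 1)]) (by positivity)
    have a3 := mul_le_mul_of_nonneg_right hm (sq_nonneg ‖w 0‖)
    nlinarith
  have lin : ∀ x : ℝ, x + 16 * x ^ 2 ≤ 1 + 17 * x ^ 2 := fun x => by nlinarith [sq_nonneg (x - 1)]
  have e1 := mul_le_mul_of_nonneg_right (lin ‖U 3‖)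
    (by positivity : 0 ≤ ‖w 1‖ ^ 2 + ‖w 0‖ ^ 2)
  have e2 := mul_le_mul_of_nonneg_right (lin ‖U 4‖)
    (by positivity : 0 ≤ ‖w 1‖ ^ 2 + ‖w 0‖ ^ 2)
  have e3 := mul_le_mul_of_nonneg_right (lin ‖U 2‖)
    (by positivity : 0 ≤ ‖w 1‖ ^ 2 + ‖w 1‖ ^ 2)
  have key : |convForm w U w| ≤ |tri (w 0) (U 2) (w 0)| + |tri (w 1) (U 3) (w 0)| +
      (|tri (w 0) (U 4) (w 1)| + |tri (w 1) (U 2) (w 1)|) :=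
    (abs_add_le _ _).trans (add_le_add (abs_add_le _ _) (abs_sub _ _))
  have fin : 0 ≤ (97 + 48 * ‖U 2‖ ^ 2 + 66 * ‖U 3‖ ^ 2 + 66 * ‖U 4‖ ^ 2 + 82 * ‖q‖ ^ 2) *
      (‖w 0‖ ^ 2 + ‖w 1‖ ^ 2) := by positivity
  have p1 : 0 ≤ ‖w 2‖ ^ 2 := by positivity
  have p2 : 0 ≤ ‖w 4‖ ^ 2 := by positivity
  have p3 : 0 ≤ (‖U 2‖ ^ 2 + ‖U 3‖ ^ 2 + ‖U 4‖ ^ 2 + ‖q‖ ^ 2) * ‖w 0‖ ^ 2 := by positivity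
  have p4 : 0 ≤ (‖U 2‖ ^ 2 + ‖U 3‖ ^ 2 + ‖U 4‖ ^ 2 + ‖q‖ ^ 2) * ‖w 1‖ ^ 2 := by positivity
  have p5 : 0 ≤ ‖w 0‖ ^ 2 := by positivity
  have p6 : 0 ≤ ‖w 1‖ ^ 2 := by positivity
  unfold gronwallCoeff energy
  nlinarith

/-! ### Solutions on the torus -/

/-- Weak solutions on the torus, as curves of jets together with `q = u_xy`. Only the velocity is
continuous in time; the derivatives in the jet are meaningful at almost every time. -/
structure IsTorusSolution (U : ℝ → Jet) (q : ℝ → L2T) : Prop where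
  cont₀ : ContinuousOn (fun t => U t 0) (Ici 0)
  cont₁ : ContinuousOn (fun t => U t 1) (Ici 0)
  ae_jet : ∀ᵐ t ∂(volume.restrict (Ioi (0 : ℝ))),
    IsDivFree (U t) ∧ HasOrbitDeriv dirY (U t 2) (q t)
  bdd₃ : ∀ T, 0 < T → MemLp (fun t => U t 3) ⊤ (volume.restrict (Ioo 0 T))
  sq₂ : ∀ T, 0 < T → MemLp (fun t => U t 2) 2 (volume.restrict (Ioo 0 T))
  sq₄ : ∀ T, 0 < T → MemLp (fun t => U t 4) 2 (volume.restrict (Ioo 0 T))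
  sq_mixed : ∀ T, 0 < T → MemLp q 2 (volume.restrict (Ioo 0 T))
  weak : ∀ y, IsDivFree y → ∀ t, 0 ≤ t →
    inner ℝ (U t 0) (y 0) + inner ℝ (U t 1) (y 1) -
      (inner ℝ (U 0 0) (y 0) + inner ℝ (U 0 1) (y 1)) = ∫ r in (0 : ℝ)..t, weakRhs (U r) y

theorem memLp_top_of_continuousOn {E : Type*} [NormedAddCommGroup E] {f : ℝ → E}
    (hf : ContinuousOn f (Ici 0)) (T : ℝ) : MemLp f ⊤ (volume.restrict (Ioo 0 T)) := by
  have hf' : ContinuousOn f (Icc 0 T) := hf.mono Icc_subset_Ici_self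
  obtain ⟨C, hC⟩ := isCompact_Icc.exists_bound_of_continuousOn hf'
  refine MemLp.of_bound (hf'.aestronglyMeasurable_of_subset_isCompact isCompact_Icc
    measurableSet_Ioo Ioo_subset_Icc_self) C ?_
  filter_upwards [ae_restrict_mem measurableSet_Ioo] with t ht
  exact hC t (Ioo_subset_Icc_self ht)

theorem tri_zero₁ (g h : L2T) : tri 0 g h = 0 := by
  simpa using tri_smul₁ (f := 0) (g := g) (h := h) 0

theorem intervalIntegrable_of_integrableOn_Ioo {f : ℝ → ℝ}
    (hf : ∀ T, 0 < T → IntegrableOn f (Ioo 0 T)) {a b : ℝ} (ha : 0 ≤ a) (hab : a ≤ b) :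
    IntervalIntegrable f volume a b := by
  have hT : 0 < b + 1 := by linarith
  have h1 : IntervalIntegrable f volume 0 (b + 1) :=
    (intervalIntegrable_iff_integrableOn_Ioo_of_le hT.le).2 (hf _ hT)
  refine h1.mono_set ?_
  rw [uIcc_of_le hab, uIcc_of_le hT.le]
  exact Icc_subset_Icc ha (by linarith)

theorem ae_restrict_Ioo_of_Ioi {p : ℝ → Prop} (h : ∀ᵐ t ∂(volume.restrict (Ioi (0 : ℝ))), p t)
    (T : ℝ) : ∀ᵐ t ∂(volume.restrict (Ioo 0 T)), p t :=
  ae_mono (Measure.restrict_mono Ioo_subset_Ioi_self le_rfl) h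

theorem ae_Ioc_of_Ioi {p : ℝ → Prop} (h : ∀ᵐ t ∂(volume.restrict (Ioi (0 : ℝ))), p t) {a b : ℝ}
    (ha : 0 ≤ a) : ∀ᵐ t ∂volume, t ∈ Ioc a b → p t := by
  rw [ae_restrict_iff' measurableSet_Ioi] at h
  filter_upwards [h] with t ht hm
  exact ht (ha.trans_lt hm.1)

namespace IsTorusSolution

variable {U U' : ℝ → Jet} {q q' : ℝ → L2T}

theorem top₀ (h : IsTorusSolution U q) (T : ℝ) :
    MemLp (fun t => U t 0) ⊤ (volume.restrict (Ioo 0 T)) := memLp_top_of_continuousOn h.cont₀ T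

theorem top₁ (h : IsTorusSolution U q) (T : ℝ) :
    MemLp (fun t => U t 1) ⊤ (volume.restrict (Ioo 0 T)) := memLp_top_of_continuousOn h.cont₁ T

theorem memLp (h : IsTorusSolution U q) {T : ℝ} (hT : 0 < T) :
    MemLp U 2 (volume.restrict (Ioo 0 T)) := by
  rw [memLp_pi_iff]
  intro i
  fin_cases i
  · exact (h.top₀ T).mono_exponent le_top
  · exact (h.top₁ T).mono_exponent le_top
  · exact h.sq₂ T hT
  · exact (h.bdd₃ T hT).mono_exponent le_top
  · exact h.sq₄ T hT

theorem memLp_apply (h : IsTorusSolution U q) (i : Fin 5) {T : ℝ} (hT : 0 < T) :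
    MemLp (fun t => U t i) 2 (volume.restrict (Ioo 0 T)) := (h.memLp hT).eval i

/-- The bound in `abs_weakRhs_le` is locally square integrable in time. -/
theorem memLp_growth (h : IsTorusSolution U q) {T : ℝ} (hT : 0 < T) :
    MemLp (fun t => 8 * ((1 + ‖U t 0‖ + ‖U t 1‖ + ‖U t 3‖) *
      (‖U t 1‖ + ‖U t 2‖ + ‖U t 4‖ + ‖q t‖))) 2 (volume.restrict (Ioo 0 T)) := by
  have h1 : MemLp (fun t => 1 + ‖U t 0‖ + ‖U t 1‖ + ‖U t 3‖) ⊤ (volume.restrict (Ioo 0 T)) :=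
    (((memLp_const (1 : ℝ)).add (h.top₀ T).norm).add (h.top₁ T).norm).add (h.bdd₃ T hT).norm
  have h2 : MemLp (fun t => ‖U t 1‖ + ‖U t 2‖ + ‖U t 4‖ + ‖q t‖) 2 (volume.restrict (Ioo 0 T)) :=
    (((h.memLp_apply 1 hT).norm.add (h.sq₂ T hT).norm).add (h.sq₄ T hT).norm).add
      (h.sq_mixed T hT).norm
  exact (h2.mul' h1).const_mul 8

theorem aestronglyMeasurable_convForm {μ : Measure ℝ} {A B C : ℝ → Jet}
    (hA : ∀ i, AEStronglyMeasurable (fun t => A t i) μ)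
    (hB : ∀ i, AEStronglyMeasurable (fun t => B t i) μ)
    (hC : ∀ i, AEStronglyMeasurable (fun t => C t i) μ)
    (h : ∀ᵐ t ∂μ, IsDivFree (A t) ∧ IsDivFree (C t)) :
    AEStronglyMeasurable (fun t => convForm (A t) (B t) (C t)) μ := by
  refine ((aestronglyMeasurable_tri (hA 0) (hB 2) (hC 0) ?_).add
    (aestronglyMeasurable_tri (hA 1) (hB 3) (hC 0) ?_)).add
    ((aestronglyMeasurable_tri (hA 0) (hB 4) (hC 1) ?_).sub
    (aestronglyMeasurable_tri (hA 1) (hB 2) (hC 1) ?_))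
  · filter_upwards [h] with t ht using ht.1.triInt₀₀ ht.2 _
  · filter_upwards [h] with t ht using ht.1.triInt₁₀ ht.2 _
  · filter_upwards [h] with t ht using ht.1.triInt₀₁ ht.2 _
  · filter_upwards [h] with t ht using ht.1.triInt₁₁ ht.2 _

theorem integrableOn_weakRhs (h : IsTorusSolution U q) {Z : ℝ → Jet} {T : ℝ} (hT : 0 < T)
    (hZ : MemLp Z 2 (volume.restrict (Ioo 0 T)))
    (hZd : ∀ᵐ t ∂(volume.restrict (Ioo 0 T)), IsDivFree (Z t)) :
    IntegrableOn (fun t => weakRhs (U t) (Z t)) (Ioo 0 T) := by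
  have hU := ae_restrict_Ioo_of_Ioi h.ae_jet T
  refine Integrable.mono' ((h.memLp_growth hT).integrable_mul hZ.norm) ?_ ?_
  · have hUm := fun i => (h.memLp_apply i hT).1
    have hZm := fun i => (hZ.eval i).1
    refine AEStronglyMeasurable.sub (((hUm 2).inner (hZm 2)).add ((hUm 4).inner (hZm 4))).neg
      (aestronglyMeasurable_convForm hUm hUm hZm ?_)
    filter_upwards [hU, hZd] with t h1 h2 using ⟨h1.1, h2⟩
  · filter_upwards [hU, hZd] with t h1 h2
    exact abs_weakRhs_le h1.1 h1.2 h2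

/-- Translates of solutions are solutions; horizontally and, thanks to the reflection, vertically. -/
theorem shift (h : IsTorusSolution U q) (a : Torus) :
    IsTorusSolution (fun t => jetShift a (U t)) (fun t => tshift a (q t)) where
  cont₀ := (tshift a).continuous.comp_continuousOn h.cont₀
  cont₁ := (tshift a).continuous.comp_continuousOn h.cont₁
  ae_jet := by
    filter_upwards [h.ae_jet] with t ht
    exact ⟨ht.1.jetShift a, ht.2.comp_tshift a⟩
  bdd₃ T hT := (tshift a).toContinuousLinearMap.comp_memLp' (h.bdd₃ T hT)
  sq₂ T hT := (tshift a).toContinuousLinearMap.comp_memLp' (h.sq₂ T hT)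
  sq₄ T hT := (tshift a).toContinuousLinearMap.comp_memLp' (h.sq₄ T hT)
  sq_mixed T hT := (tshift a).toContinuousLinearMap.comp_memLp' (h.sq_mixed T hT)
  weak y hy t ht := by
    have h1 := h.weak _ (hy.jetShift (-a)) t ht
    simp only [weakRhs_jetShift]
    simp only [jetShift, inner_tshift] at h1 ⊢
    exact h1

theorem zero : IsTorusSolution (fun _ => 0) (fun _ => 0) where
  cont₀ := continuousOn_const
  cont₁ := continuousOn_const
  ae_jet := Eventually.of_forall fun _ => ⟨divFree.zero_mem, HasOrbitDeriv.zero⟩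
  bdd₃ T hT := MemLp.zero
  sq₂ T hT := MemLp.zero
  sq₄ T hT := MemLp.zero
  sq_mixed T hT := MemLp.zero
  weak y hy t ht := by
    simp [weakRhs, convForm, tri_zero₁]

/-- Energy identity for the difference of two solutions. -/
theorem energy_sub (h : IsTorusSolution U q) (h' : IsTorusSolution U' q') {a b : ℝ} (ha : 0 ≤ a)
    (hab : a ≤ b) :
    energy (U' b - U b) - energy (U' a - U a) =
      2 * ∫ r in a..b, (-(‖(U' r - U r) 2‖ ^ 2 + ‖(U' r - U r) 4‖ ^ 2) -
        convForm (U' r - U r) (U r) (U' r - U r)) := by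
  -- the velocity of a jet, in the Hilbert space `L² × L²`
  let J : Jet →ₗ[ℝ] WithLp 2 (L2T × L2T) :=
    { toFun := fun y => WithLp.toLp 2 (y 0, y 1)
      map_add' := fun _ _ => rfl
      map_smul' := fun _ _ => rfl }
  have hn : ∀ y, ‖J y‖ ^ 2 = energy y := fun y => WithLp.prod_norm_sq_eq_of_L2 _
  have hi : ∀ y z, inner ℝ (J y) (J z) = inner ℝ (y 0) (z 0) + inner ℝ (y 1) (z 1) :=
    fun y z => WithLp.prod_inner_apply _ _
  have hWm : ∀ T, 0 < T → MemLp (fun t => U' t - U t) 2 (volume.restrict (Ioo 0 T)) :=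
    fun T hT => (h'.memLp hT).sub (h.memLp hT)
  have hWd : ∀ᵐ t ∂(volume.restrict (Ioi (0 : ℝ))), IsDivFree (U' t - U t) := by
    filter_upwards [h.ae_jet, h'.ae_jet] with t h1 h2 using h2.1.sub h1.1
  have hconst : ∀ y : Jet, ∀ T : ℝ, MemLp (fun _ : ℝ => y) 2 (volume.restrict (Ioo 0 T)) :=
    fun y T => memLp_const y
  have key := energy_identity J divFree (w := fun t => J (U' t - U t)) (W := fun t => U' t - U t)
    (g := fun t => 8 * ((1 + ‖U t 0‖ + ‖U t 1‖ + ‖U t 3‖) * (‖U t 1‖ + ‖U t 2‖ + ‖U t 4‖ + ‖q t‖)) +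
      8 * ((1 + ‖U' t 0‖ + ‖U' t 1‖ + ‖U' t 3‖) * (‖U' t 1‖ + ‖U' t 2‖ + ‖U' t 4‖ + ‖q' t‖)))
    (F := fun r y => weakRhs (U' r) y - weakRhs (U r) y) ?_ hWm
    (fun T hT => (h.memLp_growth hT).add (h'.memLp_growth hT)) ?_ ?_ ?_ ?_ ?_ ?_ ha hab
  · rw [hn, hn] at key
    rw [key]
    congr 1
    refine intervalIntegral.integral_congr_ae ?_
    filter_upwards [ae_Ioc_of_Ioi (b := b) h.ae_jet ha, ae_Ioc_of_Ioi (b := b) h'.ae_jet ha]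
      with t h1 h2 ht
    rw [uIoc_of_le hab] at ht
    exact weakRhs_sub_self (h1 ht).1 (h2 ht).1
  · exact (WithLp.prod_continuous_toLp 2 L2T L2T).comp_continuousOn
      ((h'.cont₀.sub h.cont₀).prodMk (h'.cont₁.sub h.cont₁))
  · filter_upwards [hWd] with t ht using ⟨ht, rfl⟩
  · filter_upwards [h.ae_jet, h'.ae_jet] with t h1 h2 y hy y' hy'
    rw [weakRhs_add h1.1 hy hy', weakRhs_add h2.1 hy hy']; ring
  · filter_upwards [h.ae_jet, h'.ae_jet] with t h1 h2 y hy
    refine (abs_sub _ _).trans ?_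
    have e1 := abs_weakRhs_le h1.1 h1.2 hy
    have e2 := abs_weakRhs_le h2.1 h2.2 hy
    linarith
  · intro y hy T hT
    rw [intervalIntegrable_iff_integrableOn_Ioo_of_le hT.le]
    exact (h'.integrableOn_weakRhs hT (hconst y T) (Eventually.of_forall fun _ => hy)).sub
      (h.integrableOn_weakRhs hT (hconst y T) (Eventually.of_forall fun _ => hy))
  · intro T hT
    rw [intervalIntegrable_iff_integrableOn_Ioo_of_le hT.le]
    exact (h'.integrableOn_weakRhs hT (hWm T hT) (ae_restrict_Ioo_of_Ioi hWd T)).sub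
      (h.integrableOn_weakRhs hT (hWm T hT) (ae_restrict_Ioo_of_Ioi hWd T))
  · intro y hy t ht
    have e1 := h.weak y hy t ht
    have e2 := h'.weak y hy t ht
    have hI : ∀ {V : ℝ → Jet} {p : ℝ → L2T}, IsTorusSolution V p →
        IntervalIntegrable (fun r => weakRhs (V r) y) volume 0 t := fun hV =>
      intervalIntegrable_of_integrableOn_Ioo (fun T hT =>
        hV.integrableOn_weakRhs hT (hconst y T) (Eventually.of_forall fun _ => hy)) le_rfl ht
    rw [intervalIntegral.integral_sub (hI h') (hI h), ← e1, ← e2, hi, hi]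
    simp only [Pi.sub_apply, inner_sub_left]
    ring

end IsTorusSolution

/-! ### Reflection turns solutions on the channel into solutions on the torus -/

theorem integrable_mul_resL {σ τ : ℝ} {f g : L2Omega} {W : L2T}
    (h : TriInt (extL σ f) (extL τ g) W) :
    Integrable (fun w => f w * g w * resL (σ * τ) W w) volOmega := by
  have h' : Integrable (fun z => extL σ f z * extL τ g z * W z) (volume : Measure Torus) := h
  refine (h'.comp_toTorus.add h'.comp_toTorus_reflY).congr ?_
  filter_upwards [extL_toTorus σ f, extL_toTorus_reflY σ f, extL_toTorus τ g,
    extL_toTorus_reflY τ g, resL_ae (σ * τ) W] with w h1 h2 h3 h4 h5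
  rw [Pi.add_apply, h1, h2, h3, h4, h5]; ring

theorem tri_extL {σ τ : ℝ} {f g : L2Omega} {W : L2T} (h : TriInt (extL σ f) (extL τ g) W) :
    tri (extL σ f) (extL τ g) W = ∫ w, f w * g w * resL (σ * τ) W w ∂volOmega := by
  have h' : Integrable (fun z => extL σ f z * extL τ g z * W z) (volume : Measure Torus) := h
  rw [tri, integral_torus h']
  refine integral_congr_ae ?_
  filter_upwards [extL_toTorus σ f, extL_toTorus_reflY σ f, extL_toTorus τ g,
    extL_toTorus_reflY τ g, resL_ae (σ * τ) W] with w h1 h2 h3 h4 h5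
  rw [h1, h2, h3, h4, h5]; ring

theorem integral_mul_resL_add (f g : L2Omega) (W Z : L2T) :
    ∫ z, (f z * resL 1 W z + g z * resL (-1) Z z) ∂volOmega =
      inner ℝ (extL 1 f) W + inner ℝ (extL (-1) g) Z := by
  have i1 : Integrable (fun z => f z * resL 1 W z) volOmega :=
    (Lp.memLp f).integrable_mul (Lp.memLp _)
  have i2 : Integrable (fun z => g z * resL (-1) Z z) volOmega :=
    (Lp.memLp g).integrable_mul (Lp.memLp _)
  rw [integral_add i1 i2, inner_extL, inner_extL, real_inner_eq_integral_mul,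
    real_inner_eq_integral_mul]

/-- The jet on the torus of a field on the channel: the tangential velocity is extended evenly and
the normal velocity oddly across the walls. -/
def channelJet (u v ux uy vx : L2Omega) : Jet :=
  ![extL 1 u, extL (-1) v, extL 1 ux, extL (-1) uy, extL (-1) vx]

theorem isDivFree_channelJet {u v ux uy vx : L2Omega} (h : MemH u v) (hux : HasWeakDerivX u ux)
    (huy : HasWeakDerivY u uy) (hvx : HasWeakDerivX v vx) :
    IsDivFree (channelJet u v ux uy vx) :=
  ⟨⟨hux.hasOrbitDeriv 1, huy.hasOrbitDeriv⟩, ⟨hvx.hasOrbitDeriv (-1), h.hasOrbitDeriv hux⟩⟩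

/-- The convection term on the channel against a folded test field is the convection form on the
torus: the integrand is even across the walls. -/
theorem convForm_channelJet {u v ux uy vx : L2Omega} {y : Jet}
    (hU : IsDivFree (channelJet u v ux uy vx)) (hy : IsDivFree y) :
    convForm (channelJet u v ux uy vx) (channelJet u v ux uy vx) y =
      ∫ z, ((u z * ux z + v z * uy z) * resL 1 (y 0) z +
        (u z * vx z + v z * (-ux : L2Omega) z) * resL (-1) (y 1) z) ∂volOmega := by
  have t1 : TriInt (extL 1 u) (extL 1 ux) (y 0) := hU.triInt₀₀ hy _
  have t2 : TriInt (extL (-1) v) (extL (-1) uy) (y 0) := hU.triInt₁₀ hy _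
  have t3 : TriInt (extL 1 u) (extL (-1) vx) (y 1) := hU.triInt₀₁ hy _
  have t4 : TriInt (extL (-1) v) (extL 1 ux) (y 1) := hU.triInt₁₁ hy _
  have e : convForm (channelJet u v ux uy vx) (channelJet u v ux uy vx) y =
      tri (extL 1 u) (extL 1 ux) (y 0) + tri (extL (-1) v) (extL (-1) uy) (y 0) +
      (tri (extL 1 u) (extL (-1) vx) (y 1) - tri (extL (-1) v) (extL 1 ux) (y 1)) := rfl
  have i1 := integrable_mul_resL t1
  have i2 := integrable_mul_resL t2
  have i3 := integrable_mul_resL t3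
  have i4 := integrable_mul_resL t4
  rw [e, tri_extL t1, tri_extL t2, tri_extL t3, tri_extL t4,
    ← integral_add' i1 i2, ← integral_sub' i3 i4, ← integral_add' (i1.add i2) (i3.sub i4)]
  refine integral_congr_ae ?_
  filter_upwards [Lp.coeFn_neg ux] with z hz
  simp only [Pi.add_apply, Pi.sub_apply]
  rw [hz, Pi.neg_apply]
  norm_num
  ring

/-- Test fields on the torus are folded back to the channel, where they are admissible. -/
theorem IsGlobalWeakSolution.exists_torusSolution {u v : ℝ → L2Omega} {u₀ v₀ : L2Omega}
    (h : IsGlobalWeakSolution u v u₀ v₀) :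
    ∃ (U : ℝ → Jet) (q : ℝ → L2T), IsTorusSolution U q ∧ (∀ t, U t 0 = extL 1 (u t)) ∧
      (∀ t, U t 1 = extL (-1) (v t)) ∧ ∀ᵐ t ∂(volume.restrict (Ioi (0 : ℝ))),
        ∃ uy, HasWeakDerivY (u t) uy ∧ U t 3 = extL (-1) uy := by
  obtain ⟨hcu, hcv, hH, hu0, hv0, ux, uy, vx, vy, uxy, hae, hmem, hweak⟩ := h
  have hdf : ∀ᵐ t ∂(volume.restrict (Ioi (0 : ℝ))),
      IsDivFree (channelJet (u t) (v t) (ux t) (uy t) (vx t)) ∧ vy t = -ux t := by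
    filter_upwards [hae, ae_restrict_mem measurableSet_Ioi] with t ht ht0
    have hHt := hH t (le_of_lt ht0)
    exact ⟨isDivFree_channelJet hHt ht.1 ht.2.1 ht.2.2.1, hHt.weakDerivY_eq ht.1 ht.2.2.2.1⟩
  refine ⟨fun t => channelJet (u t) (v t) (ux t) (uy t) (vx t), fun t => extL (-1) (uxy t),
    ⟨(extL 1).continuous.comp_continuousOn hcu, (extL (-1)).continuous.comp_continuousOn hcv, ?_,
      fun T hT => (extL (-1)).comp_memLp' (hmem T hT).1,
      fun T hT => (extL 1).comp_memLp' (hmem T hT).2.1,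
      fun T hT => (extL (-1)).comp_memLp' (hmem T hT).2.2.1,
      fun T hT => (extL (-1)).comp_memLp' (hmem T hT).2.2.2, ?_⟩, fun _ => rfl, fun _ => rfl, ?_⟩
  · filter_upwards [hae, hdf] with t h1 h2
    exact ⟨h2.1, h1.2.2.2.2.hasOrbitDeriv⟩
  · intro y hy t ht
    have hV : MemV (resL 1 (y 0)) (resL (-1) (y 1)) := memV_resL hy.1.1 hy.1.2 hy.2.1 hy.2.2
    have h1 := hweak _ _ hV _ _ (hy.1.1.hasWeakDerivX_resL 1) (hy.2.1.hasWeakDerivX_resL (-1)) t ht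
    have h2 : (∫ s in (0 : ℝ)..t,
        ((∫ z, (ux s z * resL 1 (y 2) z + vx s z * resL (-1) (y 4) z) ∂volOmega)
        + ∫ z, ((u s z * ux s z + v s z * uy s z) * resL 1 (y 0) z
            + (u s z * vx s z + v s z * vy s z) * resL (-1) (y 1) z) ∂volOmega)) =
        -∫ s in (0 : ℝ)..t, weakRhs (channelJet (u s) (v s) (ux s) (uy s) (vx s)) y := by
      rw [← intervalIntegral.integral_neg]
      refine intervalIntegral.integral_congr_ae ?_
      filter_upwards [ae_Ioc_of_Ioi (b := t) hdf le_rfl] with s hs hst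
      rw [uIoc_of_le ht] at hst
      obtain ⟨hs1, hs2⟩ := hs hst
      rw [integral_mul_resL_add, hs2, ← convForm_channelJet hs1 hy, weakRhs, neg_sub, sub_neg_eq_add,
        add_comm]
      rfl
    rw [h2, integral_mul_resL_add, integral_mul_resL_add, ← hu0, ← hv0] at h1
    change inner ℝ (extL 1 (u t)) (y 0) + inner ℝ (extL (-1) (v t)) (y 1) -
      (inner ℝ (extL 1 (u 0)) (y 0) + inner ℝ (extL (-1) (v 0)) (y 1)) = _
    linarith
  · filter_upwards [hae] with t ht
    exact ⟨_, ht.2.1, rfl⟩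

/-! ### Energy estimates -/

theorem energy_smul (c : ℝ) (y : Jet) : energy (c • y) = c ^ 2 * energy y := by
  simp only [energy, Pi.smul_apply, norm_smul, mul_pow, Real.norm_eq_abs, sq_abs]; ring

/-- Rate of viscous dissipation. -/
def dissipation (y : Jet) : ℝ := ‖y 2‖ ^ 2 + ‖y 4‖ ^ 2

theorem dissipation_nonneg (y : Jet) : 0 ≤ dissipation y := by unfold dissipation; positivity

theorem dissipation_smul (c : ℝ) (y : Jet) : dissipation (c • y) = c ^ 2 * dissipation y := by
  simp only [dissipation, Pi.smul_apply, norm_smul, mul_pow, Real.norm_eq_abs, sq_abs]; ring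

theorem intervalIntegral_mono_ae_Ioi {f g : ℝ → ℝ} {a b : ℝ} (ha : 0 ≤ a) (hab : a ≤ b)
    (hf : IntervalIntegrable f volume a b) (hg : IntervalIntegrable g volume a b)
    (h : ∀ᵐ t ∂(volume.restrict (Ioi (0 : ℝ))), f t ≤ g t) :
    ∫ x in a..b, f x ≤ ∫ x in a..b, g x := by
  refine intervalIntegral.integral_mono_ae_restrict hab hf hg ?_
  rw [EventuallyLE, Measure.restrict_congr_set Ioc_ae_eq_Icc.symm]
  refine (ae_restrict_iff' measurableSet_Ioc).2 ?_
  exact ae_Ioc_of_Ioi h ha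

namespace IsTorusSolution

variable {U U' : ℝ → Jet} {q q' : ℝ → L2T}

theorem integrableOn_sq {f : ℝ → L2T} {S : Set ℝ} (h : MemLp f 2 (volume.restrict S)) :
    IntegrableOn (fun t => ‖f t‖ ^ 2) S := h.norm.integrable_sq

theorem integrableOn_dissipation_sub (h : IsTorusSolution U q) (h' : IsTorusSolution U' q') {T : ℝ}
    (hT : 0 < T) : IntegrableOn (fun t => dissipation (U' t - U t)) (Ioo 0 T) :=
  (integrableOn_sq (((h'.memLp hT).sub (h.memLp hT)).eval 2)).add
    (integrableOn_sq (((h'.memLp hT).sub (h.memLp hT)).eval 4))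

theorem integrableOn_dissipation (h : IsTorusSolution U q) {T : ℝ} (hT : 0 < T) :
    IntegrableOn (fun t => dissipation (U t)) (Ioo 0 T) :=
  (integrableOn_sq (h.sq₂ T hT)).add (integrableOn_sq (h.sq₄ T hT))

/-- The convection term is integrable since it is the difference of integrable terms of
`weakRhs_sub_self`. -/
theorem integrableOn_convForm_sub (h : IsTorusSolution U q) (h' : IsTorusSolution U' q') {T : ℝ}
    (hT : 0 < T) :
    IntegrableOn (fun t => convForm (U' t - U t) (U t) (U' t - U t)) (Ioo 0 T) := by
  have hWd : ∀ᵐ t ∂(volume.restrict (Ioo 0 T)), IsDivFree (U' t - U t) := by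
    filter_upwards [ae_restrict_Ioo_of_Ioi h.ae_jet T, ae_restrict_Ioo_of_Ioi h'.ae_jet T]
      with t h1 h2 using h2.1.sub h1.1
  have hWm := (h'.memLp hT).sub (h.memLp hT)
  have h1 := (h.integrableOn_weakRhs hT hWm hWd).sub (h'.integrableOn_weakRhs hT hWm hWd)
  refine (h1.sub (h.integrableOn_dissipation_sub h' hT)).congr ?_
  filter_upwards [ae_restrict_Ioo_of_Ioi h.ae_jet T, ae_restrict_Ioo_of_Ioi h'.ae_jet T]
    with t h1 h2
  have := weakRhs_sub_self h1.1 h2.1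
  simp only [Pi.sub_apply] at this ⊢
  rw [dissipation]
  simp only [Pi.sub_apply]
  linarith

theorem integrableOn_gronwallCoeff (h : IsTorusSolution U q) {T : ℝ} (hT : 0 < T) :
    IntegrableOn (fun t => gronwallCoeff (U t) (q t)) (Ioo 0 T) := by
  have i0 : IntegrableOn (fun _ : ℝ => (1 : ℝ)) (Ioo 0 T) := integrable_const 1
  exact ((((i0.add (integrableOn_sq (h.sq₂ T hT))).add
    (integrableOn_sq (h.memLp_apply 3 hT))).add (integrableOn_sq (h.sq₄ T hT))).add
    (integrableOn_sq (h.sq_mixed T hT))).const_mul 100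

theorem continuousOn_energy_sub (h : IsTorusSolution U q) (h' : IsTorusSolution U' q') :
    ContinuousOn (fun t => energy (U' t - U t)) (Ici 0) :=
  ((h'.cont₀.sub h.cont₀).norm.pow 2).add ((h'.cont₁.sub h.cont₁).norm.pow 2)

/-- Energy identity for a multiple of the difference of two solutions. -/
theorem energy_smul_sub (h : IsTorusSolution U q) (h' : IsTorusSolution U' q') (c : ℝ) {a b : ℝ}
    (ha : 0 ≤ a) (hab : a ≤ b) :
    energy (c • (U' b - U b)) + 2 * (∫ r in a..b, dissipation (c • (U' r - U r))) =
      energy (c • (U' a - U a)) -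
        2 * ∫ r in a..b, convForm (c • (U' r - U r)) (U r) (c • (U' r - U r)) := by
  have h1 := h.energy_sub h' ha hab
  have i1 := intervalIntegrable_of_integrableOn_Ioo
    (fun T hT => h.integrableOn_dissipation_sub h' hT) ha hab
  have i2 := intervalIntegrable_of_integrableOn_Ioo
    (fun T hT => h.integrableOn_convForm_sub h' hT) ha hab
  have e : ∫ r in a..b, (-(‖(U' r - U r) 2‖ ^ 2 + ‖(U' r - U r) 4‖ ^ 2) -
      convForm (U' r - U r) (U r) (U' r - U r)) = -(∫ r in a..b, dissipation (U' r - U r)) -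
      ∫ r in a..b, convForm (U' r - U r) (U r) (U' r - U r) := by
    have i1' : IntervalIntegrable (fun t => -dissipation (U' t - U t)) volume a b := i1.neg
    rw [← intervalIntegral.integral_neg, ← intervalIntegral.integral_sub i1' i2]
    rfl
  rw [e] at h1
  simp only [energy_smul, dissipation_smul, convForm_smul_smul, intervalIntegral.integral_const_mul]
  linear_combination c ^ 2 * h1

/-- The energy balance: energy decreases at the rate of viscous dissipation. -/
theorem energy_eq (h : IsTorusSolution U q) {a b : ℝ} (ha : 0 ≤ a) (hab : a ≤ b) :
    energy (U b) + 2 * (∫ r in a..b, dissipation (U r)) = energy (U a) := by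
  -- compare with the solution at rest
  have h1 := zero.energy_smul_sub h 1 ha hab
  have h2 : ∀ a c : Jet, convForm a 0 c = 0 := fun a c => by
    simp [convForm, tri_comm₁₂ _ 0, tri_zero₁]
  simpa [h2] using h1

/-- Differences of solutions grow at most by a factor that depends on one of them only. -/
theorem exists_stability_const (h : IsTorusSolution U q) {s T : ℝ} (hs : 0 ≤ s) (hsT : s ≤ T) :
    ∃ M : ℝ, 0 ≤ M ∧ ∀ (U' : ℝ → Jet) (q' : ℝ → L2T), IsTorusSolution U' q' →
      (∀ t ∈ Icc s T, energy (U' t - U t) ≤ M * energy (U' s - U s)) ∧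
      ∫ r in s..T, dissipation (U' r - U r) ≤ M * energy (U' s - U s) := by
  set a : ℝ → ℝ := fun t => 2 * gronwallCoeff (U t) (q t) with ha
  have ha0 : ∀ t, 0 ≤ a t := fun t => mul_nonneg (by norm_num) (gronwallCoeff_nonneg _ _)
  have hai : ∀ r t, 0 ≤ r → r ≤ t → IntervalIntegrable a volume r t := fun r t h1 h2 =>
    intervalIntegrable_of_integrableOn_Ioo
      (fun T hT => (h.integrableOn_gronwallCoeff hT).const_mul 2) h1 h2
  set A := ∫ x in s..T, a x
  have hA0 : 0 ≤ A := intervalIntegral.integral_nonneg hsT fun t _ => ha0 t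
  set M₀ : ℝ := 2 ^ ⌈2 * A⌉₊
  have hM₀ : 0 ≤ M₀ := by positivity
  refine ⟨M₀ + (1 + M₀ * A), by positivity, fun U' q' h' => ?_⟩
  have hcont := h.continuousOn_energy_sub h'
  have hmul : ∀ r t, 0 ≤ r → r ≤ t →
      IntervalIntegrable (fun x => a x * energy (U' x - U x)) volume r t := fun r t h1 h2 =>
    (hai r t h1 h2).mul_continuousOn (hcont.mono (by
      rw [uIcc_of_le h2]; exact fun x hx => h1.trans hx.1))
  have main : ∀ r t, 0 ≤ r → r ≤ t → energy (U' t - U t) +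
      ∫ x in r..t, dissipation (U' x - U x) ≤
      energy (U' r - U r) + ∫ x in r..t, a x * energy (U' x - U x) := fun r t h1 h2 => by
    have e := h.energy_smul_sub h' 1 h1 h2
    simp only [one_smul] at e
    have i1 := intervalIntegrable_of_integrableOn_Ioo
      (fun T hT => h.integrableOn_dissipation_sub h' hT) h1 h2
    have i2 := intervalIntegrable_of_integrableOn_Ioo
      (fun T hT => h.integrableOn_convForm_sub h' hT) h1 h2
    have e2 := intervalIntegral_mono_ae_Ioi h1 h2 (i2.const_mul (-2))
      ((hmul r t h1 h2).add i1) (by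
        filter_upwards [h.ae_jet, h'.ae_jet] with x hx hx'
        have := abs_convForm_le hx.2 (hx'.1.sub hx.1)
        have h3 := neg_abs_le (convForm (U' x - U x) (U x) (U' x - U x))
        simp only [ha, dissipation]
        nlinarith)
    rw [intervalIntegral.integral_const_mul, intervalIntegral.integral_add (hmul r t h1 h2) i1] at e2
    linarith
  have hdiss : ∀ r t, r ≤ t → 0 ≤ ∫ x in r..t, dissipation (U' x - U x) := fun r t h2 =>
    intervalIntegral.integral_nonneg h2 fun t _ => dissipation_nonneg _
  have hg := gronwall_of_integrable_coeff (y := fun t => energy (U' t - U t)) (a := a) (s := s)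
    (T := T) (hcont.mono fun x hx => hs.trans hx.1) (fun t _ => energy_nonneg _) (hai s T hs hsT) ha0
    (fun r t h1 h2 _ => by
      have := main r t (hs.trans h1) h2
      have := hdiss r t h2
      linarith)
  have he0 := energy_nonneg (U' s - U s)
  have hp : 0 ≤ M₀ * A * energy (U' s - U s) := by positivity
  have hp2 : 0 ≤ M₀ * energy (U' s - U s) := by positivity
  refine ⟨fun t ht => (hg t ht).trans ?_, ?_⟩
  · linarith
  · have h1 := main s T hs hsT
    have h2 : ∫ x in s..T, a x * energy (U' x - U x) ≤
        ∫ x in s..T, a x * (M₀ * energy (U' s - U s)) := by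
      refine intervalIntegral.integral_mono_on hsT (hmul s T hs hsT)
        ((hai s T hs hsT).mul_const _) fun x hx => ?_
      exact mul_le_mul_of_nonneg_left (hg x hx) (ha0 x)
    rw [intervalIntegral.integral_mul_const] at h2
    have h3 := energy_nonneg (U' T - U T)
    have h4 : (∫ x in s..T, a x) = A := rfl
    rw [h4] at h2
    linarith

end IsTorusSolution

/-! ### Difference quotients of solutions and horizontal regularity -/

/-- Difference quotient of a jet along a one-parameter group of translations. -/
def jetQuot (e : ℝ →+ Torus) (r : ℝ) (y : Jet) : Jet := r⁻¹ • (jetShift (e r) y - y)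

theorem IsDivFree.jetQuot {y : Jet} (h : IsDivFree y) (e : ℝ →+ Torus) (r : ℝ) :
    IsDivFree (jetQuot e r y) :=
  divFree.smul_mem _ ((h.jetShift _).sub h)

theorem energy_jetQuot_le {e : ℝ →+ Torus} {y : Jet} {a b : L2T} (ha : HasOrbitDeriv e (y 0) a)
    (hb : HasOrbitDeriv e (y 1) b) (r : ℝ) : energy (jetQuot e r y) ≤ ‖a‖ ^ 2 + ‖b‖ ^ 2 :=
  add_le_add (pow_le_pow_left₀ (norm_nonneg _) (ha.norm_diffQuot_le r) 2)
    (pow_le_pow_left₀ (norm_nonneg _) (hb.norm_diffQuot_le r) 2)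

theorem tendsto_energy_jetQuot {e : ℝ →+ Torus} {y : Jet} {a b : L2T}
    (ha : HasOrbitDeriv e (y 0) a) (hb : HasOrbitDeriv e (y 1) b) :
    Tendsto (fun r => energy (jetQuot e r y)) (𝓝[≠] 0) (𝓝 (‖a‖ ^ 2 + ‖b‖ ^ 2)) :=
  (ha.tendsto_diffQuot.norm.pow 2).add (hb.tendsto_diffQuot.norm.pow 2)

/-- A sequence of nonzero steps tending to zero. -/
def step (n : ℕ) : ℝ := 1 / ((n : ℝ) + 1)

theorem tendsto_step : Tendsto step atTop (𝓝[≠] 0) := by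
  refine tendsto_nhdsWithin_iff.2 ⟨tendsto_one_div_add_atTop_nhds_zero_nat, ?_⟩
  exact Eventually.of_forall fun n => (by unfold step; positivity : step n ≠ 0)

theorem eLpNorm_two_lt_top_iff {α : Type*} [MeasurableSpace α] {μ : Measure α} {f : α → L2T} :
    eLpNorm f 2 μ < ⊤ ↔ ∫⁻ t, ‖f t‖ₑ ^ 2 ∂μ < ⊤ := by
  rw [eLpNorm_lt_top_iff_lintegral_rpow_enorm_lt_top two_ne_zero (by simp)]
  simp

namespace IsTorusSolution

variable {U : ℝ → Jet} {q : ℝ → L2T}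

theorem memLp_jetQuot (h : IsTorusSolution U q) (e : ℝ →+ Torus) (r : ℝ) {T : ℝ} (hT : 0 < T) :
    MemLp (fun t => jetQuot e r (U t)) 2 (volume.restrict (Ioo 0 T)) :=
  (((h.shift (e r)).memLp hT).sub (h.memLp hT)).const_smul (r⁻¹)

/-- From a time at which the jet is regular on, the horizontal derivative of the velocity is bounded
and itself has a square integrable horizontal derivative. -/
theorem exists_horizontal_regularity (h : IsTorusSolution U q) {s T : ℝ} (hs : 0 ≤ s)
    (hsT : s ≤ T) (hd : IsDivFree (U s)) :
    ∃ (R : ℝ) (p : ℝ → L2T), MemLp p 2 (volume.restrict (Ioo s T)) ∧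
      ∀ᵐ t ∂(volume.restrict (Ioo s T)),
        ‖U t 2‖ ≤ R ∧ ‖U t 4‖ ≤ R ∧ HasOrbitDeriv dirX (U t 2) (p t) := by
  -- the constant does not depend on the translate with which `U` is compared
  obtain ⟨M, hM0, hM⟩ := h.exists_stability_const hs hsT
  set N₀ := ‖U s 2‖ ^ 2 + ‖U s 4‖ ^ 2
  have hT1 : 0 < T + 1 := by linarith
  have hsub : Ioo s T ⊆ Ioo 0 (T + 1) := Ioo_subset_Ioo hs (by linarith)
  have hle : volume.restrict (Ioo s T) ≤ volume.restrict (Ioo 0 (T + 1)) :=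
    Measure.restrict_mono hsub le_rfl
  have hK : ∀ r : ℝ, (∀ t ∈ Icc s T, energy (jetQuot dirX r (U t)) ≤ M * N₀) ∧
      ∫ t in s..T, dissipation (jetQuot dirX r (U t)) ≤ M * N₀ := fun r => by
    obtain ⟨h1, h2⟩ := hM _ _ (h.shift (dirX r))
    have e0 : (r⁻¹) ^ 2 * energy (jetShift (dirX r) (U s) - U s) ≤ N₀ := by
      rw [← energy_smul]; exact energy_jetQuot_le hd.1.1 hd.2.1 r
    have e1 := mul_le_mul_of_nonneg_left e0 hM0
    have hr : 0 ≤ (r⁻¹) ^ 2 := by positivity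
    refine ⟨fun t ht => ?_, ?_⟩
    · have := mul_le_mul_of_nonneg_left (h1 t ht) hr
      rw [jetQuot, energy_smul]; linarith
    · have := mul_le_mul_of_nonneg_left h2 hr
      simp only [jetQuot, dissipation_smul, intervalIntegral.integral_const_mul]
      linarith
  set f : ℕ → ℝ → L2T := fun n t => jetQuot dirX (step n) (U t) 2
  have hf : ∀ n, MemLp (f n) 2 (volume.restrict (Ioo s T)) := fun n =>
    ((h.memLp_jetQuot dirX (step n) hT1).eval 2).mono_measure hle
  have hint : ∀ n, ∫⁻ t in Ioo s T, ‖f n t‖ₑ ^ 2 ≤ ENNReal.ofReal (M * N₀) := fun n => by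
    have hi : IntegrableOn (fun t => dissipation (jetQuot dirX (step n) (U t))) (Ioo s T) :=
      ((integrableOn_sq ((h.memLp_jetQuot dirX (step n) hT1).eval 2)).add
        (integrableOn_sq ((h.memLp_jetQuot dirX (step n) hT1).eval 4))).mono_set hsub
    have h1 := (hK (step n)).2
    rw [intervalIntegral.integral_of_le hsT, integral_Ioc_eq_integral_Ioo] at h1
    refine le_trans ?_ (ENNReal.ofReal_le_ofReal h1)
    rw [ofReal_integral_eq_lintegral_ofReal hi (Eventually.of_forall fun t => dissipation_nonneg _)]
    refine lintegral_mono fun t => ?_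
    rw [← ofReal_norm, ← ENNReal.ofReal_pow (norm_nonneg _)]
    refine ENNReal.ofReal_le_ofReal ?_
    have : 0 ≤ ‖jetQuot dirX (step n) (U t) 4‖ ^ 2 := by positivity
    simp only [f, dissipation]; linarith
  have hmeas : ∀ n, AEMeasurable (fun t => ‖f n t‖ₑ ^ 2) (volume.restrict (Ioo s T)) := fun n =>
    (hf n).1.enorm.pow_const 2
  have hfatou : ∫⁻ t in Ioo s T, liminf (fun n => ‖f n t‖ₑ ^ 2) atTop ≤ ENNReal.ofReal (M * N₀) :=
    (lintegral_liminf_le' hmeas).trans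
      (liminf_le_of_frequently_le' (Frequently.of_forall hint))
  have hliminf : AEMeasurable (fun t => liminf (fun n => ‖f n t‖ₑ ^ 2) atTop)
      (volume.restrict (Ioo s T)) := by
    refine ⟨fun t => liminf (fun n => (hmeas n).mk _ t) atTop,
      Measurable.liminf fun n => (hmeas n).measurable_mk, ?_⟩
    filter_upwards [ae_all_iff.2 fun n => (hmeas n).ae_eq_mk] with t ht
    simp only [ht]
  have hae := ae_restrict_of_ae_restrict_of_subset (hsub.trans Ioo_subset_Ioi_self) h.ae_jet
  -- by Fatou the difference quotients are bounded along a subsequence of the steps, for almost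
  -- every time
  have hex : ∀ᵐ t ∂(volume.restrict (Ioo s T)), ∃ g, HasOrbitDeriv dirX (U t 2) g := by
    filter_upwards [ae_lt_top' hliminf (hfatou.trans_lt ENNReal.ofReal_lt_top).ne] with t ht
    obtain ⟨C, hC1, hC2⟩ := exists_between ht
    refine HasOrbitDeriv.exists_of_bounded_diffQuot continuous_dirX tendsto_step (C := C.toReal + 1) ?_
    refine (frequently_lt_of_liminf_lt (by isBoundedDefault) hC1).mono fun n hn => ?_
    have h1 : ‖f n t‖ ^ 2 ≤ C.toReal := by
      have := ENNReal.toReal_mono hC2.ne hn.le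
      simpa using this
    change ‖f n t‖ ≤ _
    nlinarith [norm_nonneg (f n t)]
  classical
  set p : ℝ → L2T := fun t =>
    if hg : ∃ g, HasOrbitDeriv dirX (U t 2) g then hg.choose else 0
  have hp : ∀ᵐ t ∂(volume.restrict (Ioo s T)), HasOrbitDeriv dirX (U t 2) (p t) := by
    filter_upwards [hex] with t ht
    simp only [p, dif_pos ht]
    exact ht.choose_spec
  have hlim : ∀ᵐ t ∂(volume.restrict (Ioo s T)), Tendsto (fun n => f n t) atTop (𝓝 (p t)) := by
    filter_upwards [hp] with t ht
    exact ht.tendsto_diffQuot.comp tendsto_step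
  refine ⟨M * N₀ + 1, p, ⟨aestronglyMeasurable_of_tendsto_ae atTop (fun n => (hf n).1) hlim, ?_⟩, ?_⟩
  · rw [eLpNorm_two_lt_top_iff]
    refine lt_of_le_of_lt ?_ (hfatou.trans_lt ENNReal.ofReal_lt_top)
    refine lintegral_mono_ae ?_
    filter_upwards [hlim] with t ht
    exact ((((ENNReal.continuous_pow 2).tendsto _).comp ht.enorm).liminf_eq).ge
  · filter_upwards [hp, hae, ae_restrict_mem measurableSet_Ioo] with t h1 h2 h3
    have h4 : ‖U t 2‖ ^ 2 + ‖U t 4‖ ^ 2 ≤ M * N₀ :=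
      le_of_tendsto (tendsto_energy_jetQuot h2.1.1.1 h2.1.2.1)
        (Eventually.of_forall fun r => (hK r).1 t (Ioo_subset_Icc_self h3))
    refine ⟨?_, ?_, h1⟩
    · nlinarith [norm_nonneg (U t 2), sq_nonneg (‖U t 4‖)]
    · nlinarith [norm_nonneg (U t 4), sq_nonneg (‖U t 2‖)]

end IsTorusSolution

/-! ### The balance for the velocity gradient -/

/-- The generator of translations is closed. -/
theorem HasOrbitDeriv.of_tendsto {e : ℝ →+ Torus} (he : Continuous e) {ι : Type*} {l : Filter ι}
    [NeBot l] {F F' : ι → L2T} {f f' : L2T} (h : ∀ i, HasOrbitDeriv e (F i) (F' i))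
    (hF : Tendsto F l (𝓝 f)) (hF' : Tendsto F' l (𝓝 f')) : HasOrbitDeriv e f f' := by
  refine HasOrbitDeriv.of_forall_inner he fun χ χ' hχ => ?_
  have h1 : Tendsto (fun i => inner ℝ (F' i) χ) l (𝓝 (inner ℝ f' χ)) :=
    hF'.inner tendsto_const_nhds
  have h2 : Tendsto (fun i => -inner ℝ (F i) χ') l (𝓝 (-inner ℝ f χ')) :=
    (hF.inner tendsto_const_nhds).neg
  refine tendsto_nhds_unique h1 (h2.congr fun i => ?_)
  rw [(h i).inner_right hχ]

/-- Mixed derivatives commute. -/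
theorem HasOrbitDeriv.mixed {e e' : ℝ →+ Torus} (he : Continuous e) {f f₁ f₂ f₁₂ : L2T}
    (h₁ : HasOrbitDeriv e f f₁) (h₂ : HasOrbitDeriv e' f f₂) (h₁₂ : HasOrbitDeriv e' f₁ f₁₂) :
    HasOrbitDeriv e f₂ f₁₂ :=
  .of_tendsto he (fun r : ℝ => ((h₁.comp_tshift (e' r)).sub h₁).smul r⁻¹) h₂.tendsto_diffQuot
    h₁₂.tendsto_diffQuot

/-- The integrable majorant for the convection terms of difference quotients. -/
theorem abs_convForm_le_of_bounds {w y : Jet} {p q : L2T} (hw : IsDivFree w)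
    (hq : HasOrbitDeriv dirY (y 2) q) (hp : HasOrbitDeriv dirX (y 2) p) {R : ℝ}
    (h2 : ‖y 2‖ ≤ R) (h3 : ‖y 3‖ ≤ R) (h4 : ‖y 4‖ ≤ R) (hw0 : ‖w 0‖ ≤ R) (hw1 : ‖w 1‖ ≤ R)
    (hw2 : ‖w 2‖ ≤ ‖p‖ + ‖q‖) : |convForm w y w| ≤ 8 * R * (R + (‖p‖ + ‖q‖)) ^ 2 := by
  set S := R + (‖p‖ + ‖q‖)
  have hR : 0 ≤ R := (norm_nonneg _).trans h2
  have hS : 0 ≤ S := by positivity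
  have gen : ∀ {f g h fy hx : L2T}, HasOrbitDeriv dirY f fy → HasOrbitDeriv dirX h hx →
      ‖f‖ + ‖fy‖ ≤ S → ‖g‖ ≤ R → ‖h‖ + ‖hx‖ ≤ S → |tri f g h| ≤ 2 * R * S ^ 2 := by
    intro f g h fy hx hf hh b1 b2 b3
    refine (abs_tri_le hf g hh).trans ?_
    have e1 : 2 * (‖f‖ + ‖fy‖) * ‖g‖ ≤ 2 * S * R := by gcongr
    calc 2 * (‖f‖ + ‖fy‖) * ‖g‖ * (‖h‖ + ‖hx‖) ≤ 2 * S * R * S :=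
          mul_le_mul e1 b3 (by positivity) (by positivity)
      _ = 2 * R * S ^ 2 := by ring
  have n1 := norm_nonneg p
  have n2 := norm_nonneg q
  have w1 : ‖w 1‖ + ‖-(w 2)‖ ≤ S := by rw [norm_neg]; exact add_le_add hw1 hw2
  have t1 := gen hq hw.1.1 (by simp only [S]; linarith) hw0 (add_le_add hw0 hw2)
  rw [tri_comm₁₂] at t1
  have t2 := gen hw.2.2 hw.1.1 w1 h3 (add_le_add hw0 hw2)
  have t3 := gen hw.2.2 hw.1.1 w1 h4 (add_le_add hw0 hw2)
  rw [tri_comm₁₂, tri_comm₂₃, tri_comm₁₂] at t3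
  have t4 := gen hw.2.2 hp w1 hw1 (by simp only [S]; linarith)
  rw [tri_comm₂₃] at t4
  have key : |convForm w y w| ≤ |tri (w 0) (y 2) (w 0)| + |tri (w 1) (y 3) (w 0)| +
      (|tri (w 0) (y 4) (w 1)| + |tri (w 1) (y 2) (w 1)|) :=
    (abs_add_le _ _).trans (add_le_add (abs_add_le _ _) (abs_sub _ _))
  linarith

theorem tendsto_convForm {ι : Type*} {l : Filter ι} {w : ι → Jet} {y : Jet} {p q a₀ a₁ a₂ : L2T}
    (hw : ∀ i, IsDivFree (w i)) (hq : HasOrbitDeriv dirY (y 2) q)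
    (hp : HasOrbitDeriv dirX (y 2) p) (ha₀ : HasOrbitDeriv dirX a₀ a₂)
    (ha₁ : HasOrbitDeriv dirY a₁ (-a₂)) (l0 : Tendsto (fun i => w i 0) l (𝓝 a₀))
    (l1 : Tendsto (fun i => w i 1) l (𝓝 a₁)) (l2 : Tendsto (fun i => w i 2) l (𝓝 a₂)) :
    Tendsto (fun i => convForm (w i) y (w i)) l
      (𝓝 (tri a₀ (y 2) a₀ + tri a₁ (y 3) a₀ + (tri a₀ (y 4) a₁ - tri a₁ (y 2) a₁))) := by
  have c : ∀ g : L2T, Tendsto (fun _ : ι => g) l (𝓝 g) := fun g => tendsto_const_nhds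
  have t1 := tendsto_tri (fun _ => hq) (fun i => (hw i).1.1) hq ha₀ (c _) (c _) l0 l0 l2
  have t2 := tendsto_tri (fun i => (hw i).2.2) (fun i => (hw i).1.1) ha₁ ha₀ l1 l2.neg (c (y 3))
    l0 l2
  have t3 := tendsto_tri (fun i => (hw i).2.2) (fun i => (hw i).1.1) ha₁ ha₀ l1 l2.neg (c (y 4))
    l0 l2
  have t4 := tendsto_tri (fun i => (hw i).2.2) (fun _ => hp) ha₁ hp l1 l2.neg l1 (c _) (c _)
  have e3 : ∀ a b d : L2T, tri a b d = tri d b a := fun a b d => by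
    rw [tri_comm₁₂, tri_comm₂₃, tri_comm₁₂]
  simp only [tri_comm₁₂ (y 2)] at t1
  simp only [tri_comm₂₃ _ _ (y 2)] at t4
  simp only [e3 _ (y 4)] at t3
  exact (t1.add t2).add (t3.sub t4)

/-- In the limit the stretching terms of the horizontal and the vertical difference quotients
cancel. -/
theorem tendsto_convForm_jetQuot {y : Jet} {p q : L2T} (hy : IsDivFree y)
    (hq : HasOrbitDeriv dirY (y 2) q) (hp : HasOrbitDeriv dirX (y 2) p) :
    Tendsto (fun r => convForm (jetQuot dirX r y) y (jetQuot dirX r y) +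
      convForm (jetQuot dirY r y) y (jetQuot dirY r y)) (𝓝[≠] 0) (𝓝 0) := by
  -- `v_xy = -u_xx`
  have hp' : HasOrbitDeriv dirY (y 4) (-p) := by
    refine HasOrbitDeriv.mixed continuous_dirY hy.2.2 hy.2.1 ?_
    exact hp.neg
  have hq' : HasOrbitDeriv dirX (y 3) q := HasOrbitDeriv.mixed continuous_dirX hy.1.1 hy.1.2 hq
  have t1 := tendsto_convForm (w := fun r => jetQuot dirX r y) (l := 𝓝[≠] 0)
    (fun r => hy.jetQuot dirX r) hq hp hp hp' hy.1.1.tendsto_diffQuot hy.2.1.tendsto_diffQuot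
    hp.tendsto_diffQuot
  have t2 := tendsto_convForm (w := fun r => jetQuot dirY r y) (l := 𝓝[≠] 0)
    (fun r => hy.jetQuot dirY r) hq hp hq' hq.neg hy.1.2.tendsto_diffQuot
    hy.2.2.tendsto_diffQuot hq.tendsto_diffQuot
  convert t1.add t2 using 2
  simp only [tri_neg₁, tri_neg₃]
  rw [tri_comm₁₂ (y 4) (y 3) (y 2), tri_comm₂₃ (y 3) (y 4) (y 2), tri_comm₂₃ (y 2) (y 4) (y 4),
    tri_comm₁₂ (y 2) (y 4) (y 4), tri_comm₂₃ (y 4) (y 2) (y 4), tri_comm₁₂ (y 3) (y 2) (y 4),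
    tri_comm₁₂ (y 3) (y 2) (y 3)]
  ring

/-- Energy of the velocity gradient; `u_x` counts twice because `v_y = -u_x`. -/
def gradEnergy (y : Jet) : ℝ := 2 * ‖y 2‖ ^ 2 + ‖y 3‖ ^ 2 + ‖y 4‖ ^ 2

namespace IsTorusSolution

variable {U : ℝ → Jet} {q : ℝ → L2T}

theorem integrableOn_convForm_jetQuot (h : IsTorusSolution U q) (e : ℝ →+ Torus) (r : ℝ) {T : ℝ}
    (hT : 0 < T) :
    IntegrableOn (fun t => convForm (jetQuot e r (U t)) (U t) (jetQuot e r (U t))) (Ioo 0 T) := by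
  simp only [jetQuot, convForm_smul_smul]
  exact (h.integrableOn_convForm_sub (h.shift (e r)) hT).const_mul _

theorem integrableOn_dissipation_jetQuot (h : IsTorusSolution U q) (e : ℝ →+ Torus) (r : ℝ) {T : ℝ}
    (hT : 0 < T) : IntegrableOn (fun t => dissipation (jetQuot e r (U t))) (Ioo 0 T) := by
  simp only [jetQuot, dissipation_smul]
  exact (h.integrableOn_dissipation_sub (h.shift (e r)) hT).const_mul _

theorem exists_bound₃ (h : IsTorusSolution U q) {T : ℝ} (hT : 0 < T) :
    ∃ R : ℝ, ∀ᵐ t ∂(volume.restrict (Ioo 0 T)), ‖U t 3‖ ≤ R := by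
  have h1 := h.bdd₃ T hT
  refine ⟨(eLpNorm (fun t => U t 3) ⊤ (volume.restrict (Ioo 0 T))).toReal, ?_⟩
  have h2 := ae_le_eLpNormEssSup (f := fun t => U t 3) (μ := volume.restrict (Ioo 0 T))
  filter_upwards [h2] with t ht
  rw [← eLpNorm_exponent_top] at ht
  have := ENNReal.toReal_mono h1.2.ne ht
  simpa using this

/-- The gradient energy decreases: the cubic stretching terms cancel exactly. -/
theorem gradEnergy_add_le (h : IsTorusSolution U q) {s t : ℝ} (hs : 0 ≤ s) (hst : s ≤ t)
    (hds : IsDivFree (U s)) (hdt : IsDivFree (U t)) :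
    gradEnergy (U t) + 2 * (∫ r in s..t, ‖q r‖ ^ 2) ≤ gradEnergy (U s) := by
  obtain ⟨R₀, p, hpm, hp⟩ := h.exists_horizontal_regularity hs hst hds
  have hT : 0 < t + 1 := by linarith
  obtain ⟨R₁, hR₁⟩ := h.exists_bound₃ hT
  have hsub : Ioo s t ⊆ Ioo 0 (t + 1) := Ioo_subset_Ioo hs (by linarith)
  have hle : volume.restrict (Ioo s t) ≤ volume.restrict (Ioo 0 (t + 1)) :=
    Measure.restrict_mono hsub le_rfl
  have hae := ae_restrict_of_ae_restrict_of_subset (hsub.trans Ioo_subset_Ioi_self) h.ae_jet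
  have hR₁' := ae_restrict_of_ae_restrict_of_subset hsub hR₁
  set R := max R₀ R₁
  have hqm : MemLp q 2 (volume.restrict (Ioo s t)) := (h.sq_mixed _ hT).mono_measure hle
  set μ := volume.restrict (Ioo s t) with hμ
  have hii : ∀ f : ℝ → ℝ, ∫ r in s..t, f r = ∫ r, f r ∂μ := fun f => by
    rw [intervalIntegral.integral_of_le hst, integral_Ioc_eq_integral_Ioo]
  set C : ℝ → ℝ → ℝ := fun k r => convForm (jetQuot dirX k (U r)) (U r) (jetQuot dirX k (U r)) +
    convForm (jetQuot dirY k (U r)) (U r) (jetQuot dirY k (U r)) with hC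
  have iC : ∀ (e : ℝ →+ Torus) k, Integrable (fun r => convForm (jetQuot e k (U r)) (U r) (jetQuot e k (U r))) μ :=
    fun e k => (h.integrableOn_convForm_jetQuot e k hT).mono_set hsub
  have iD : ∀ (e : ℝ →+ Torus) k, Integrable (fun r => dissipation (jetQuot e k (U r))) μ :=
    fun e k => (h.integrableOn_dissipation_jetQuot e k hT).mono_set hsub
  have iq : ∀ k, MemLp (fun r => jetQuot dirY k (U r) 2) 2 μ := fun k =>
    ((h.memLp_jetQuot dirY k hT).eval 2).mono_measure hle
  -- the energy identities of the horizontal and the vertical difference quotients, added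
  have step_le : ∀ k : ℝ, energy (jetQuot dirX k (U t)) + energy (jetQuot dirY k (U t)) +
      2 * ∫ r, ‖jetQuot dirY k (U r) 2‖ ^ 2 ∂μ ≤
      energy (jetQuot dirX k (U s)) + energy (jetQuot dirY k (U s)) - 2 * ∫ r, C k r ∂μ := by
    intro k
    have e1 : energy (jetQuot dirX k (U t)) + 2 * (∫ r in s..t, dissipation (jetQuot dirX k (U r))) =
      energy (jetQuot dirX k (U s)) -
        2 * ∫ r in s..t, convForm (jetQuot dirX k (U r)) (U r) (jetQuot dirX k (U r)) :=
      h.energy_smul_sub (h.shift (dirX k)) k⁻¹ hs hst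
    have e2 : energy (jetQuot dirY k (U t)) + 2 * (∫ r in s..t, dissipation (jetQuot dirY k (U r))) =
      energy (jetQuot dirY k (U s)) -
        2 * ∫ r in s..t, convForm (jetQuot dirY k (U r)) (U r) (jetQuot dirY k (U r)) :=
      h.energy_smul_sub (h.shift (dirY k)) k⁻¹ hs hst
    rw [hii, hii] at e1 e2
    have e3 : 0 ≤ ∫ r, dissipation (jetQuot dirX k (U r)) ∂μ :=
      integral_nonneg fun r => dissipation_nonneg _
    have e4 : ∫ r, ‖jetQuot dirY k (U r) 2‖ ^ 2 ∂μ ≤ ∫ r, dissipation (jetQuot dirY k (U r)) ∂μ := by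
      refine integral_mono (iq k).norm.integrable_sq (iD dirY k) fun r => ?_
      have : 0 ≤ ‖jetQuot dirY k (U r) 4‖ ^ 2 := by positivity
      simp only [dissipation]; linarith
    have e5 := integral_add (iC dirX k) (iC dirY k)
    simp only [hC]
    linarith
  have limE : ∀ τ, IsDivFree (U τ) → Tendsto (fun n => energy (jetQuot dirX (step n) (U τ)) +
      energy (jetQuot dirY (step n) (U τ))) atTop (𝓝 (gradEnergy (U τ))) := fun τ hτ => by
    have h1 := (tendsto_energy_jetQuot hτ.1.1 hτ.2.1).add (tendsto_energy_jetQuot hτ.1.2 hτ.2.2)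
    have h2 : ‖U τ 2‖ ^ 2 + ‖U τ 4‖ ^ 2 + (‖U τ 3‖ ^ 2 + ‖-U τ 2‖ ^ 2) = gradEnergy (U τ) := by
      rw [norm_neg, gradEnergy]; ring
    rw [h2] at h1
    exact h1.comp tendsto_step
  have limq : Tendsto (fun n => ∫ r, ‖jetQuot dirY (step n) (U r) 2‖ ^ 2 ∂μ) atTop
      (𝓝 (∫ r, ‖q r‖ ^ 2 ∂μ)) := by
    refine tendsto_integral_of_dominated_convergence (fun r => ‖q r‖ ^ 2)
      (fun n => ((iq (step n)).1.norm.pow 2)) hqm.norm.integrable_sq (fun n => ?_) ?_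
    · filter_upwards [hae] with r hr
      rw [Real.norm_eq_abs, abs_of_nonneg (by positivity)]
      exact pow_le_pow_left₀ (norm_nonneg _) (hr.2.norm_diffQuot_le _) 2
    · filter_upwards [hae] with r hr
      exact ((hr.2.tendsto_diffQuot.norm.pow 2).comp tendsto_step)
  -- the horizontal regularity provides the majorant and the cancellation of the limits
  have limC : Tendsto (fun n => ∫ r, C (step n) r ∂μ) atTop (𝓝 (∫ _, (0 : ℝ) ∂μ)) := by
    refine tendsto_integral_of_dominated_convergence
      (fun r => 16 * R * (R + (‖p r‖ + ‖q r‖)) ^ 2)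
      (fun n => ((iC dirX _).add (iC dirY _)).1) ?_ (fun n => ?_) ?_
    · exact (((memLp_const R).add (hpm.norm.add hqm.norm)).integrable_sq).const_mul _
    · filter_upwards [hae, hp, hR₁'] with r h1 h2 h3
      have b2 : ‖U r 2‖ ≤ R := h2.1.trans (le_max_left _ _)
      have b4 : ‖U r 4‖ ≤ R := h2.2.1.trans (le_max_left _ _)
      have b3 : ‖U r 3‖ ≤ R := h3.trans (le_max_right _ _)
      have c1 := abs_convForm_le_of_bounds (h1.1.jetQuot dirX (step n)) h1.2 h2.2.2 b2 b3 b4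
        ((h1.1.1.1.norm_diffQuot_le _).trans b2) ((h1.1.2.1.norm_diffQuot_le _).trans b4)
        ((h2.2.2.norm_diffQuot_le _).trans (by linarith [norm_nonneg (q r)]))
      have c2 := abs_convForm_le_of_bounds (h1.1.jetQuot dirY (step n)) h1.2 h2.2.2 b2 b3 b4
        ((h1.1.1.2.norm_diffQuot_le _).trans b3)
        ((h1.1.2.2.norm_diffQuot_le _).trans (by rwa [norm_neg]))
        ((h1.2.norm_diffQuot_le _).trans (by linarith [norm_nonneg (p r)]))
      rw [Real.norm_eq_abs]
      exact (abs_add_le _ _).trans (by linarith)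
    · filter_upwards [hae, hp] with r h1 h2
      exact (tendsto_convForm_jetQuot h1.1 h1.2 h2.2.2).comp tendsto_step
  rw [integral_zero] at limC
  have fin := le_of_tendsto_of_tendsto' ((limE t hdt).add (limq.const_mul 2))
    ((limE s hds).sub (limC.const_mul 2)) fun n => step_le (step n)
  rw [hii]
  linarith

end IsTorusSolution

/-! ### Convergence of the horizontal mean and decay of the rest -/

theorem exists_gt_of_ae {p : ℝ → Prop} (h : ∀ᵐ t ∂(volume.restrict (Ioi (0 : ℝ))), p t) {a : ℝ}
    (ha : 0 ≤ a) : ∃ t, a < t ∧ p t := by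
  have h1 : ∀ᵐ t ∂(volume.restrict (Ioi a)), p t :=
    ae_restrict_of_ae_restrict_of_subset (Ioi_subset_Ioi ha) h
  have : NeBot (ae (volume.restrict (Ioi a))) := by
    rw [ae_neBot, Ne, Measure.restrict_eq_zero]; simp
  obtain ⟨t, h2, h3⟩ := (h1.and (ae_restrict_mem measurableSet_Ioi)).exists
  exact ⟨t, h3, h2⟩

namespace IsTorusSolution

variable {U : ℝ → Jet} {q : ℝ → L2T}

/-- Transport of the mean flow is quadratic in the oscillating quantities: the self-interaction of
the mean drops out because the normal velocity has zero mean. -/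
theorem abs_weakRhs_mean_le {y : Jet} {r φ φy g : L2T} (hy : IsDivFree y)
    (hr : HasOrbitDeriv dirY (y 2) r) (hm : meanX (y 1) = 0) (hφ : φ = meanX g)
    (hφy : HasOrbitDeriv dirY φ φy) :
    |weakRhs y ![φ, 0, 0, φy, 0]| ≤ (2 * dissipation y + ‖r‖ ^ 2) * ‖φ‖ := by
  have hφx : HasOrbitDeriv dirX φ 0 := hφ ▸ hasOrbitDeriv_dirX_meanX g
  have e0 : weakRhs y ![φ, 0, 0, φy, 0] = -(tri (y 0) (y 2) φ + tri (y 1) (y 3) φ) := by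
    have z : ∀ a b : L2T, tri a b 0 = 0 := fun a b => by
      rw [tri_comm₂₃, tri_comm₁₂, tri_zero₁]
    simp [weakRhs, convForm, z]
  -- `∫ u u_x φ = ½ ∫ (u²)_x φ` and `φ` does not depend on `x`
  have e1 : tri (y 0) (y 2) φ = 0 := by
    have h1 := tri_leibniz continuous_dirX hy.1 hy.1 ⟨hφx, hφy⟩ hy.1.1 hy.1.1 hφx
    have z : ∀ a b : L2T, tri a b 0 = 0 := fun a b => by
      rw [tri_comm₂₃, tri_comm₁₂, tri_zero₁]
    rw [z, tri_comm₁₂ (y 2)] at h1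
    linarith
  have hI : ∀ k : L2T, TriInt (y 1) k φ := fun k => triInt_of_hasOrbitDeriv hy.2.2 k hφx
  -- `v` has no horizontal mean, so only the oscillation of `u_y` contributes
  have e2 : tri (y 1) (y 3) φ = tri (y 1) (y 3 - meanX (y 3)) φ := by
    have h1 := tri_meanX_meanX_eq_zero (g := y 3) (h := g) hm (hφ ▸ hI _)
    rw [tri_sub₂ (hI _) (hI _), hφ, h1, sub_zero]
  have h3 := abs_tri_le hy.2.2 (y 3 - meanX (y 3)) hφx
  have h4 : ‖y 3 - meanX (y 3)‖ ≤ ‖r‖ :=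
    norm_sub_meanX_le (HasOrbitDeriv.mixed continuous_dirX hy.1.1 hy.1.2 hr)
  have h5 : ‖y 1‖ ≤ ‖y 4‖ := by
    have := norm_sub_meanX_le hy.2.1
    rwa [hm, sub_zero] at this
  rw [e0, e1, zero_add, abs_neg, e2]
  rw [norm_neg, norm_zero, add_zero] at h3
  refine h3.trans (mul_le_mul_of_nonneg_right ?_ (norm_nonneg _))
  have h6 : 2 * (‖y 1‖ + ‖y 2‖) * ‖y 3 - meanX (y 3)‖ ≤ 2 * (‖y 4‖ + ‖y 2‖) * ‖r‖ := by
    gcongr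
  refine h6.trans ?_
  unfold dissipation
  nlinarith [sq_nonneg (‖y 4‖ + ‖y 2‖ - ‖r‖), sq_nonneg (‖y 4‖ - ‖y 2‖)]

/-- The rate that controls the motion of the horizontal mean. -/
def meanRate (U : ℝ → Jet) (q : ℝ → L2T) (t : ℝ) : ℝ := 2 * dissipation (U t) + ‖q t‖ ^ 2

theorem meanRate_nonneg (U : ℝ → Jet) (q : ℝ → L2T) (t : ℝ) : 0 ≤ meanRate U q t :=
  add_nonneg (mul_nonneg (by norm_num) (dissipation_nonneg _)) (by positivity)

theorem intervalIntegrable_meanRate (h : IsTorusSolution U q) {a b : ℝ} (ha : 0 ≤ a) (hab : a ≤ b) :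
    IntervalIntegrable (meanRate U q) volume a b :=
  intervalIntegrable_of_integrableOn_Ioo (fun T hT =>
    ((h.integrableOn_dissipation hT).const_mul 2).add (integrableOn_sq (h.sq_mixed T hT))) ha hab

/-- The mean moves no further than the integrated rate: the weak equation is tested with the
increment of the mean itself. -/
theorem norm_meanX_sub_le (h : IsTorusSolution U q) (hm : ∀ t, 0 ≤ t → meanX (U t 1) = 0) {s t : ℝ}
    (hs : 0 ≤ s) (hst : s ≤ t) (hds : IsDivFree (U s)) (hdt : IsDivFree (U t)) :
    ‖meanX (U t 0) - meanX (U s 0)‖ ≤ ∫ r in s..t, meanRate U q r := by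
  set φ := meanX (U t 0) - meanX (U s 0) with hφd
  set φy := meanX (U t 3) - meanX (U s 3)
  have hφ : φ = meanX (U t 0 - U s 0) := (meanX_sub _ _).symm
  have hφx : HasOrbitDeriv dirX φ 0 := hφ ▸ hasOrbitDeriv_dirX_meanX _
  have hφy : HasOrbitDeriv dirY φ φy := hdt.1.2.meanX.sub hds.1.2.meanX
  set y : Jet := ![φ, 0, 0, φy, 0]
  have hy : IsDivFree y := ⟨⟨hφx, hφy⟩, ⟨HasOrbitDeriv.zero, by
    change HasOrbitDeriv dirY (0 : L2T) (-(0 : L2T))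
    rw [neg_zero]; exact HasOrbitDeriv.zero⟩⟩
  have hint : ∀ a b, 0 ≤ a → a ≤ b → IntervalIntegrable (fun r => weakRhs (U r) y) volume a b :=
    fun a b h1 h2 => intervalIntegrable_of_integrableOn_Ioo (fun T hT =>
      h.integrableOn_weakRhs hT (memLp_const y) (Eventually.of_forall fun _ => hy)) h1 h2
  have w1 := h.weak y hy s hs
  have w2 := h.weak y hy t (hs.trans hst)
  rw [← intervalIntegral.integral_add_adjacent_intervals (hint 0 s le_rfl hs) (hint s t hs hst)] at w2
  have e1 : inner ℝ (U t 0) φ - inner ℝ (U s 0) φ = ∫ r in s..t, weakRhs (U r) y := by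
    have z : ∀ a : L2T, inner ℝ a (y 1) = 0 := fun a => inner_zero_right a
    have z0 : y 0 = φ := rfl
    simp only [z, z0, add_zero] at w1 w2
    linarith
  have e2 : ‖φ‖ ^ 2 = ∫ r in s..t, weakRhs (U r) y := by
    rw [← e1, ← inner_sub_left, real_inner_comm, ← real_inner_self_eq_norm_sq]
    have := inner_meanX_left (f := φ) (g := U t 0 - U s 0)
      (fun r => by rw [hφ]; exact tshift_dirX_meanX r _)
    rw [← hφ] at this
    exact this
  have e3 : ∫ r in s..t, weakRhs (U r) y ≤ ∫ r in s..t, meanRate U q r * ‖φ‖ := by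
    refine intervalIntegral_mono_ae_Ioi hs hst (hint s t hs hst)
      ((h.intervalIntegrable_meanRate hs hst).mul_const _) ?_
    filter_upwards [h.ae_jet, ae_restrict_mem measurableSet_Ioi] with r hr hr0
    exact (le_abs_self _).trans (abs_weakRhs_mean_le hr.1 hr.2 (hm r (le_of_lt hr0)) hφ hφy)
  rw [intervalIntegral.integral_mul_const, ← e2] at e3
  rcases (norm_nonneg φ).eq_or_lt with h0 | h0
  · rw [← h0]; exact intervalIntegral.integral_nonneg hst fun r _ => meanRate_nonneg _ _ _
  · rw [sq] at e3
    exact le_of_mul_le_mul_right e3 h0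

theorem integral_dissipation_le (h : IsTorusSolution U q) {s t : ℝ} (hs : 0 ≤ s) (hst : s ≤ t) :
    ∫ r in s..t, dissipation (U r) ≤ energy (U s) / 2 := by
  have := h.energy_eq hs hst
  have := energy_nonneg (U t)
  linarith

/-- The dissipation is integrable by the energy balance and `‖u_xy‖²` by the balance of the gradient. -/
theorem exists_integral_meanRate_le (h : IsTorusSolution U q) {s : ℝ} (hs : 0 ≤ s)
    (hds : IsDivFree (U s)) :
    ∃ C, ∀ t, s ≤ t → ∫ r in s..t, meanRate U q r ≤ C := by
  refine ⟨energy (U s) + gradEnergy (U s), fun t hst => ?_⟩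
  -- the gradient balance holds between regular times, so pass to a later regular time
  obtain ⟨t', htt', ht'⟩ := exists_gt_of_ae h.ae_jet (hs.trans hst)
  have hst' : s ≤ t' := hst.trans htt'.le
  have i1 : IntervalIntegrable (fun r => dissipation (U r)) volume s t' :=
    intervalIntegrable_of_integrableOn_Ioo (fun T hT => h.integrableOn_dissipation hT) hs hst'
  have i2 : IntervalIntegrable (fun r => ‖q r‖ ^ 2) volume s t' :=
    intervalIntegrable_of_integrableOn_Ioo (fun T hT => integrableOn_sq (h.sq_mixed T hT)) hs hst'
  have e1 : ∫ r in s..t, meanRate U q r ≤ ∫ r in s..t', meanRate U q r := by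
    rw [← intervalIntegral.integral_add_adjacent_intervals
      (h.intervalIntegrable_meanRate hs hst)
      (h.intervalIntegrable_meanRate (hs.trans hst) htt'.le)]
    have := intervalIntegral.integral_nonneg (μ := volume) htt'.le
      (fun r _ => meanRate_nonneg U q r)
    linarith
  have e2 : ∫ r in s..t', meanRate U q r =
      2 * (∫ r in s..t', dissipation (U r)) + ∫ r in s..t', ‖q r‖ ^ 2 := by
    simp only [meanRate]
    rw [intervalIntegral.integral_add (i1.const_mul 2) i2, intervalIntegral.integral_const_mul]
  have e3 := h.integral_dissipation_le hs hst'
  have e4 := h.gradEnergy_add_le hs hst' hds ht'.1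
  have e5 : 0 ≤ gradEnergy (U t') := by unfold gradEnergy; positivity
  have e6 : 0 ≤ gradEnergy (U s) := by unfold gradEnergy; positivity
  linarith

theorem exists_tendsto_meanX (h : IsTorusSolution U q) (hm : ∀ t, 0 ≤ t → meanX (U t 1) = 0) :
    ∃ L, Tendsto (fun t => meanX (U t 0)) atTop (𝓝 L) := by
  obtain ⟨s, hs, hds⟩ := exists_gt_of_ae h.ae_jet le_rfl
  obtain ⟨C, hC⟩ := h.exists_integral_meanRate_le hs.le hds.1
  have hi := fun a b (h1 : s ≤ a) (h2 : a ≤ b) => h.intervalIntegrable_meanRate (hs.le.trans h1) h2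
  refine exists_tendsto_of_increment_le (K := fun t => ∫ r in s..t, meanRate U q r) (s := s)
    (continuous_meanX.comp_continuousOn (h.cont₀.mono (Ici_subset_Ici.2 hs.le))) ?_ ?_ hC
    (p := fun t => IsDivFree (U t)) ?_ ?_
  · intro t ht
    have h1 := intervalIntegral.continuousOn_primitive_interval' (hi s (t + 1) le_rfl
      (by have : s ≤ t := ht; linarith)) left_mem_uIcc
    rw [uIcc_of_le (by have : s ≤ t := ht; linarith)] at h1
    refine (h1 t ⟨ht, by linarith⟩).mono_of_mem_nhdsWithin ?_
    rw [← Ici_inter_Iic]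
    exact inter_mem self_mem_nhdsWithin (mem_nhdsWithin_of_mem_nhds (Iic_mem_nhds (by linarith)))
  · intro a ha b hb hab
    have ha' : s ≤ a := ha
    have := intervalIntegral.integral_add_adjacent_intervals (hi s a le_rfl ha') (hi a b ha' hab)
    have h2 := intervalIntegral.integral_nonneg (μ := volume) hab
      (fun r _ => meanRate_nonneg U q r)
    simp only
    linarith
  · have := ae_restrict_of_ae_restrict_of_subset (s := Ici s)
      (fun x hx => hs.trans_le hx : Ici s ⊆ Ioi 0) h.ae_jet
    filter_upwards [this] with t ht using ht.1
  · intro r t hr hrt hdr hdt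
    have := intervalIntegral.integral_add_adjacent_intervals (hi s r le_rfl hr) (hi r t hr hrt)
    have h2 := h.norm_meanX_sub_le hm (hs.le.trans hr) hrt hdr hdt
    linarith

theorem exists_tendsto_energy (h : IsTorusSolution U q) :
    ∃ E, Tendsto (fun t => energy (U t)) atTop (𝓝 E) := by
  have hanti : Antitone fun t => energy (U (max t 0)) := fun a b hab => by
    have h1 := h.energy_eq (le_max_right a 0) (max_le_max_right 0 hab)
    have h2 := intervalIntegral.integral_nonneg (μ := volume) (max_le_max_right 0 hab)
      (fun r _ => dissipation_nonneg (U r))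
    simp only
    linarith
  have hb : BddBelow (range fun t => energy (U (max t 0))) :=
    ⟨0, by rintro _ ⟨t, rfl⟩; exact energy_nonneg _⟩
  refine ⟨_, (tendsto_atTop_ciInf hanti hb).congr' ?_⟩
  filter_upwards [eventually_ge_atTop 0] with t ht
  rw [max_eq_left ht]

/-- The oscillating part of a solution decays. -/
theorem tendsto_oscillation (h : IsTorusSolution U q) (hm : ∀ t, 0 ≤ t → meanX (U t 1) = 0) :
    Tendsto (fun t => ‖U t 0 - meanX (U t 0)‖ ^ 2 + ‖U t 1‖ ^ 2) atTop (𝓝 0) := by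
  obtain ⟨L, hL⟩ := h.exists_tendsto_meanX hm
  obtain ⟨E, hE⟩ := h.exists_tendsto_energy
  set y : ℝ → ℝ := fun t => ‖U t 0 - meanX (U t 0)‖ ^ 2 + ‖U t 1‖ ^ 2
  have hy : Tendsto y atTop (𝓝 (E - ‖L‖ ^ 2)) := by
    refine (hE.sub (hL.norm.pow 2)).congr fun t => ?_
    have := norm_sq_eq_meanX_add (U t 0)
    simp only [y, energy]
    linarith
  have h0 : 0 ≤ E - ‖L‖ ^ 2 := ge_of_tendsto' hy fun t => by positivity
  have hyc : ContinuousOn y (Ici 0) :=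
    ((h.cont₀.sub (continuous_meanX.comp_continuousOn h.cont₀)).norm.pow 2).add
      (h.cont₁.norm.pow 2)
  have hint : ∀ t, 0 ≤ t → IntervalIntegrable y volume 0 t := fun t ht =>
    (hyc.mono (by rw [uIcc_of_le ht]; exact Icc_subset_Ici_self)).intervalIntegrable
  -- by the Poincaré inequality `y` is at most the dissipation, which is integrable
  have h1 := nonpos_of_tendsto_of_integral_bounded (s := 0) (C := energy (U 0) / 2) hy hint
    fun t ht => by
      refine le_trans ?_ (h.integral_dissipation_le le_rfl ht)
      refine intervalIntegral_mono_ae_Ioi le_rfl ht (hint t ht)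
        (intervalIntegrable_of_integrableOn_Ioo (fun T hT => h.integrableOn_dissipation hT)
          le_rfl ht) ?_
      filter_upwards [h.ae_jet, ae_restrict_mem measurableSet_Ioi] with r hr hr0
      have e1 := norm_sub_meanX_le hr.1.1.1
      have e2 := norm_sub_meanX_le hr.1.2.1
      rw [hm r (le_of_lt hr0), sub_zero] at e2
      exact add_le_add (pow_le_pow_left₀ (norm_nonneg _) e1 2)
        (pow_le_pow_left₀ (norm_nonneg _) e2 2)
  rwa [le_antisymm h1 h0] at hy

/-- The vertical derivative of the tangential velocity stays bounded for all times. -/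
theorem exists_ae_bound₃ (h : IsTorusSolution U q) :
    ∃ s R : ℝ, 0 < s ∧ ∀ᵐ t ∂(volume.restrict (Ioi (0 : ℝ))), s ≤ t → ‖U t 3‖ ≤ R := by
  obtain ⟨s, hs, hds⟩ := exists_gt_of_ae h.ae_jet le_rfl
  refine ⟨s, gradEnergy (U s) + 1, hs, ?_⟩
  filter_upwards [h.ae_jet] with t ht hst
  have h1 := h.gradEnergy_add_le hs.le hst hds.1 ht.1
  have h2 : 0 ≤ ∫ r in s..t, ‖q r‖ ^ 2 :=
    intervalIntegral.integral_nonneg hst fun r _ => by positivity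
  have h3 : ‖U t 3‖ ^ 2 ≤ gradEnergy (U t) := by
    have : 0 ≤ 2 * ‖U t 2‖ ^ 2 + ‖U t 4‖ ^ 2 := by positivity
    unfold gradEnergy; linarith
  nlinarith [norm_nonneg (U t 3)]

end IsTorusSolution

/-! ### The steady state -/

theorem integral_zero_mul (ψ : ℝ × ℝ → ℝ) : ∫ z, (0 : L2Omega) z * ψ z ∂volOmega = 0 := by
  refine integral_eq_zero_of_ae ?_
  filter_upwards [Lp.coeFn_zero ℝ 2 volOmega] with z hz
  rw [hz]; simp

theorem hasWeakDerivX_zero : HasWeakDerivX 0 0 := fun ψ _ => by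
  rw [integral_zero_mul, integral_zero_mul, neg_zero]

theorem hasWeakDerivY_zero : HasWeakDerivY 0 0 := fun ψ _ => by
  rw [integral_zero_mul, integral_zero_mul, neg_zero]

/-- Shear flows with a weak derivative are steady states. -/
theorem isSteadyState_liftY {φ : L2I} {g : L2Omega} (hg : HasWeakDerivY (liftY φ) g) :
    IsSteadyState (liftY φ) 0 := by
  have h0 := Lp.coeFn_zero ℝ 2 volOmega
  refine ⟨continuousOn_const, continuousOn_const, fun _ _ => ⟨Lp.memLp _, Lp.memLp _, fun ψ hψ => ?_⟩,
    rfl, rfl, fun _ => 0, fun _ => g, fun _ => 0, fun _ => 0, fun _ => 0,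
    Eventually.of_forall fun _ => ⟨hasWeakDerivX_liftY φ, hg, hasWeakDerivX_zero,
      hasWeakDerivY_zero, hasWeakDerivY_zero⟩,
    fun T _ => ⟨memLp_const g, MemLp.zero, MemLp.zero, MemLp.zero⟩, ?_⟩
  · have h1 := (hasWeakDerivX_liftY φ).integral_eq hψ
    rw [integral_zero_mul, neg_zero] at h1
    rw [← h1]
    refine integral_congr_ae ?_
    filter_upwards [h0] with z hz
    rw [hz]; simp
  · intro w₁ w₂ _ w₁x w₂x _ _ t _
    have e1 : ∫ z, ((0 : L2Omega) z * w₁x z + (0 : L2Omega) z * w₂x z) ∂volOmega = 0 := by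
      refine integral_eq_zero_of_ae ?_
      filter_upwards [h0] with z hz
      rw [hz]; simp
    have e2 : ∫ z, ((liftY φ z * (0 : L2Omega) z + (0 : L2Omega) z * g z) * w₁ z +
        (liftY φ z * (0 : L2Omega) z + (0 : L2Omega) z * (0 : L2Omega) z) * w₂ z) ∂volOmega = 0 := by
      refine integral_eq_zero_of_ae ?_
      filter_upwards [h0] with z hz
      rw [hz]; simp
    simp only [e1, e2, add_zero, intervalIntegral.integral_zero]

/-- Weak derivatives survive in the limit as long as they stay bounded at almost all times. -/
theorem exists_hasWeakDerivY_of_tendsto {f : ℝ → L2Omega} {F : L2Omega} {C : ℝ}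
    (hf : Tendsto f atTop (𝓝 F)) {s : ℝ}
    (h : ∀ᵐ t ∂(volume.restrict (Ioi (0 : ℝ))), s ≤ t → ∃ g, HasWeakDerivY (f t) g ∧ ‖g‖ ≤ C) :
    ∃ g, HasWeakDerivY F g := by
  classical
  set S := {t : ℝ | ∃ g, HasWeakDerivY (f t) g ∧ ‖g‖ ≤ C} with hS
  have hfreq : ∃ᶠ t in atTop, t ∈ S := by
    rw [frequently_atTop]
    intro a
    obtain ⟨t, ht, ht'⟩ := exists_gt_of_ae h (le_max_right (max a s) 0)
    have h1 : max a s < t := (le_max_left _ _).trans_lt ht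
    exact ⟨t, ((le_max_left a s).trans_lt h1).le, ht' ((le_max_right a s).trans_lt h1).le⟩
  have hne : NeBot (atTop ⊓ 𝓟 S) := frequently_mem_iff_neBot.1 hfreq
  set G : ℝ → L2Omega := fun t => if ht : t ∈ S then ht.choose else 0
  have hG : ∀ᶠ t in atTop ⊓ 𝓟 S, HasWeakDerivY (f t) (G t) ∧ ‖G t‖ ≤ C := by
    filter_upwards [mem_inf_of_right (mem_principal_self S)] with t ht
    simp only [G, dif_pos ht]
    exact Exists.choose_spec ht
  obtain ⟨𝒰, h𝒰, g, -, hg⟩ := exists_weak_cluster _ G C (hG.mono fun _ h => h.2)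
  refine ⟨g, fun ψ hψ => ?_⟩
  rw [← inner_toLp_eq _ hψ.1.partialY.memLp, ← inner_toLp_eq _ hψ.1.memLp]
  have l1 : Tendsto (fun t => inner ℝ (f t) (hψ.1.partialY.memLp.toLp _)) 𝒰
      (𝓝 (inner ℝ F (hψ.1.partialY.memLp.toLp _))) :=
    ((hf.mono_left (h𝒰.trans inf_le_left)).inner tendsto_const_nhds)
  refine tendsto_nhds_unique_of_eventuallyEq l1 (hg _).neg ?_
  filter_upwards [h𝒰 hG] with t ht
  rw [inner_toLp_eq, inner_toLp_eq]
  exact ht.1 ψ hψ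

theorem norm_le_of_norm_extL_le {σ : ℝ} {f : L2Omega} {R : ℝ} (h : ‖extL σ f‖ ≤ R) : ‖f‖ ≤ R := by
  have h1 := norm_extL_sq σ f
  have h2 := pow_le_pow_left₀ (norm_nonneg _) h 2
  have h3 : 0 ≤ σ ^ 2 * ‖f‖ ^ 2 := by positivity
  exact le_of_sq_le_sq (by linarith) ((norm_nonneg _).trans h)

theorem tendsto_of_tendsto_extL {σ : ℝ} {f : ℝ → L2Omega}
    (h : Tendsto (fun t => ‖extL σ (f t)‖) atTop (𝓝 0)) : Tendsto (fun t => ‖f t‖) atTop (𝓝 0) :=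
  squeeze_zero (fun _ => norm_nonneg _) (fun _ => norm_le_of_norm_extL_le le_rfl) h

theorem tendsto_eLpNorm_of_norm {α : Type*} [MeasurableSpace α] {μ : Measure α} {f : ℝ → Lp ℝ 2 μ}
    {g : ℝ → α → ℝ} (hg : ∀ t, g t =ᵐ[μ] f t) (h : Tendsto (fun t => ‖f t‖) atTop (𝓝 0)) :
    Tendsto (fun t => eLpNorm (g t) 2 μ) atTop (𝓝 0) := by
  have h1 : Tendsto (fun t => ENNReal.ofReal ‖f t‖) atTop (𝓝 (ENNReal.ofReal 0)) :=
    ENNReal.tendsto_ofReal h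
  rw [ENNReal.ofReal_zero] at h1
  refine h1.congr fun t => ?_
  rw [ofReal_norm, Lp.enorm_def, eLpNorm_congr_ae (hg t)]

end

theorem proposition1p4 (u₀ v₀ : L2Omega) (h₀ : MemV u₀ v₀)
    (u v : ℝ → L2Omega) (hu : IsGlobalWeakSolution u v u₀ v₀) :
    ((∀ t : ℝ, 0 ≤ t → MemH (osc (u t)) (v t)) ∧
      Tendsto (fun t : ℝ => eLpNorm (osc (u t)) 2 volOmega) atTop (𝓝 0) ∧
      Tendsto (fun t : ℝ => eLpNorm (v t) 2 volOmega) atTop (𝓝 0)) ∧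
    ∃ φ : L2I,
      ((∀ t : ℝ, 0 ≤ t → MemLp (hmean (u t)) 2 volI) ∧
        Tendsto (fun t : ℝ => eLpNorm (fun y => hmean (u t) y - φ y) 2 volI) atTop (𝓝 0)) ∧
      IsSteadyState (liftY φ) 0 := by
  obtain ⟨U, q, hU, hU0, hU1, hU3⟩ := hu.exists_torusSolution
  have hH : ∀ t, 0 ≤ t → MemH (u t) (v t) := hu.2.2.1
  have hm : ∀ t, 0 ≤ t → meanX (U t 1) = 0 := fun t ht => by
    rw [hU1]; exact (hH t ht).meanX_eq_zero (-1)
  have hdecay := hU.tendsto_oscillation hm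
  have hosc : Tendsto (fun t => ‖u t - liftY (hmeanLp (u t))‖) atTop (𝓝 0) := by
    refine tendsto_of_tendsto_extL (σ := 1) ?_
    have h1 : Tendsto (fun t => ‖U t 0 - meanX (U t 0)‖ ^ 2) atTop (𝓝 0) :=
      squeeze_zero (fun _ => by positivity) (fun t => le_add_of_nonneg_right (by positivity)) hdecay
    have h2 := (Real.continuous_sqrt.tendsto 0).comp h1
    rw [Real.sqrt_zero] at h2
    refine h2.congr fun t => ?_
    rw [Function.comp_apply, Real.sqrt_sq (norm_nonneg _), hU0, meanX_extL, ← map_sub]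
  have hv : Tendsto (fun t => ‖v t‖) atTop (𝓝 0) := by
    refine tendsto_of_tendsto_extL (σ := -1) ?_
    have h1 : Tendsto (fun t => ‖U t 1‖ ^ 2) atTop (𝓝 0) :=
      squeeze_zero (fun _ => by positivity) (fun t => le_add_of_nonneg_left (by positivity)) hdecay
    have h2 := (Real.continuous_sqrt.tendsto 0).comp h1
    rw [Real.sqrt_zero] at h2
    refine h2.congr fun t => ?_
    rw [Function.comp_apply, Real.sqrt_sq (norm_nonneg _), hU1]
  obtain ⟨L, hL⟩ := hU.exists_tendsto_meanX hm
  -- the extension to the torus does not decrease distances, so the means converge on the interval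
  have hcauchy : CauchySeq fun t => hmeanLp (u t) := by
    have h1 := hL.cauchySeq
    rw [Metric.cauchySeq_iff] at h1 ⊢
    intro ε hε
    obtain ⟨N, hN⟩ := h1 ε hε
    refine ⟨N, fun a ha b hb => lt_of_le_of_lt ?_ (hN a ha b hb)⟩
    rw [dist_eq_norm, dist_eq_norm, hU0, hU0, meanX_extL, meanX_extL, ← map_sub, ← liftY_sub,
      ← norm_liftY]
    exact norm_le_of_norm_extL_le le_rfl
  obtain ⟨φ, hφ⟩ := cauchySeq_tendsto_of_complete hcauchy
  have hmean : Tendsto (fun t => ‖hmeanLp (u t) - φ‖) atTop (𝓝 0) :=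
    tendsto_iff_norm_sub_tendsto_zero.1 hφ
  have hlim : Tendsto u atTop (𝓝 (liftY φ)) := by
    rw [tendsto_iff_norm_sub_tendsto_zero]
    have h1 := hosc.add hmean
    rw [add_zero] at h1
    refine squeeze_zero (fun _ => norm_nonneg _) (fun t => ?_) h1
    rw [← norm_liftY (hmeanLp (u t) - φ), liftY_sub]
    calc ‖u t - liftY φ‖ = ‖(u t - liftY (hmeanLp (u t))) + (liftY (hmeanLp (u t)) - liftY φ)‖ := by
          congr 1; abel
      _ ≤ _ := norm_add_le _ _
  obtain ⟨s, R, -, hR⟩ := hU.exists_ae_bound₃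
  -- the uniform bound on `u_y` makes the limit weakly differentiable, hence a steady state
  obtain ⟨g, hg⟩ := exists_hasWeakDerivY_of_tendsto (C := R) hlim (s := s) (by
    filter_upwards [hR, hU3] with t h1 h2 hst
    obtain ⟨uy, huy, huy'⟩ := h2
    exact ⟨uy, huy, norm_le_of_norm_extL_le (huy' ▸ h1 hst)⟩)
  refine ⟨⟨fun t ht => (hH t ht).osc, tendsto_eLpNorm_of_norm (fun t => osc_ae (u t)) hosc,
    tendsto_eLpNorm_of_norm (fun t => EventuallyEq.rfl) hv⟩, φ,
    ⟨fun t _ => memLp_hmean (u t), tendsto_eLpNorm_of_norm (fun t => ?_) hmean⟩,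
    isSteadyState_liftY hg⟩
  filter_upwards [hmeanLp_ae (u t), Lp.coeFn_sub (hmeanLp (u t)) φ] with y h1 h2
  rw [h2, Pi.sub_apply, h1]
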